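/- Let $d\ge 1$. There is a constant $c=c(d)>0$, depending only on $d$, such that the following holds. Let $J>0$ and let $\rho$ be a probability measure on $\mathbb R$ in the Griffiths--Simon (GS) class, i.e. either (1) $\rho$ is the law of $\alpha\sum_{n=1}^N b_n\sigma_n$ for some $N$, $\alpha\in\mathbb R$, $b_n\ge 0$, where $\sigma\in\{-1,1\}^N$ has probability proportional to $\exp\big(\sum_{n,m=1}^N K_{n,m}\sigma_n\sigma_m\big)$ with all $K_{n,m}\ge 0$; or (2) $\rho$ is a weak limit of a sequence of probability measures as in (1), and $\int e^{|\varphi|^\alpha}\rho(d\varphi)<\infty$ for some $\alpha>2$. Consider the nearest-neighbour ferromagnetic model on $\mathbb Z^d$: $J_{x,y}=J$ if $\|x-y\|_1=1$ and $J_{x,y}=0$ otherwise, $|J|:=\sum_y J_{0,y}$, and for finite $\Lambda\subset\mathbb Z^d$, $\beta\ge0$, $h\in\mathbb R$, $$\langle F\rangle_{\Lambda,\rho,\beta,h}:=\frac{\int F(\tau)\exp\big(\beta\sum_{\{x,y\}\subset\Lambda}J_{x,y}\tau_x\tau_y+\beta h\sum_{x\in\Lambda}\tau_x\big)\prod_{x\in\Lambda}\rho(d\tau_x)}{\int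 \exp\big(\beta\sum_{\{x,y\}\subset\Lambda}J_{x,y}\tau_x\tau_y+\beta h\sum_{x\in\Lambda}\tau_x\big)\prod_{x\in\Lambda}\rho(d\tau_x)} .$$ Put $S_{\rho,\beta}(x):=\lim_{\Lambda\nearrow\mathbb Z^d}\langle\tau_0\tau_x\rangle_{\Lambda,\rho,\beta,0}$. Let $M(\rho,\beta):=\lim_{h\downarrow0}\lim_{\Lambda\nearrow\mathbb Z^d}\langle\tau_0\rangle_{\Lambda,\rho,\beta,h}$ (limits of functions that are monotone in $\Lambda$ and in $h>0$) be the spontaneous magnetization, $\beta_c(\rho):=\inf\{\beta\ge0: M(\rho,\beta)>0\}\in[0,\infty]$ the critical inverse temperature, and $$\xi(\rho,\beta):=\limsup_{n\to\infty}\frac{-n}{\log S_{\rho,\beta}(n\mathbf e_1)}\in[0,\infty]$$ the correlation length (it is the limit whenever the limit exists; terms with $S_{\rho,\beta}(n\mathbf e_1)=0$ count as $0$, those with $S_{\rho,\beta}(n\mathbf e_1)\ge1$ as $\infty$). Then, for every $0<\beta<\infty$ with $\beta\le\beta_c(\rho)$, the limit defining $S_{\rho,\beta}(x)$ exists for every $x\in\mathbb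 Z^d$, and for every $x\in\mathbb Z^d\setminus\{0\}$ (and also for $x=0$ if $d=1$, with $0^0=1$) $$S_{\rho,\beta}(x)\ \ge\ \frac{c}{\beta\,|J|\,\|x\|_\infty^{d-1}}\ \exp\Big(-\frac{d\,\|x\|_\infty+1}{\xi(\rho,\beta)}\Big),$$ where $e^{-a/\infty}:=1$ and $e^{-a/0}:=0$ for $a>0$. -/

import Mathlib

open MeasureTheory Filter Topology
open scoped ENNReal NNReal

noncomputable section

namespace GSModel

/-- Sites of the lattice `ℤ^d`. The instance norm `‖x‖` on this type is the sup norm `‖x‖_∞`. -/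
abbrev Site (d : ℕ) : Type := Fin d → ℤ

/-! ### The Griffiths-Simon class of single-site measures -/

/-- The unnormalised law of `α ∑ₙ bₙ σₙ` when the signs `σ ∈ {-1, 1}^N` carry the weight
`exp (∑ₙₘ Kₙₘ σₙ σₘ)`. -/
def blockLaw {N : ℕ} (α : ℝ) (b : Fin N → ℝ) (K : Fin N → Fin N → ℝ) : Measure ℝ :=
  ∑ σ : Fin N → ℤˣ,
    ENNReal.ofReal (Real.exp (∑ n, ∑ m, K n m * ((σ n : ℤ) : ℝ) * ((σ m : ℤ) : ℝ))) •
      Measure.dirac (α * ∑ n, b n * ((σ n : ℤ) : ℝ))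

/-- `ρ` is the law of a (rescaled) block sum of finitely many ferromagnetically coupled
Ising spins. -/
def IsIsingBlock (ρ : ProbabilityMeasure ℝ) : Prop :=
  ∃ (N : ℕ) (α : ℝ) (b : Fin N → ℝ) (K : Fin N → Fin N → ℝ),
    (∀ n, 0 ≤ b n) ∧ (∀ n m, 0 ≤ K n m) ∧
      (ρ : Measure ℝ) = (blockLaw α b K Set.univ)⁻¹ • blockLaw α b K

/-- `ρ` has sub-gaussian growth: `∫ exp (|φ|^α) dρ < ∞` for some `α > 2`. -/
def HasSubgaussianGrowth (ρ : ProbabilityMeasure ℝ) : Prop :=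
  ∃ α : ℝ, 2 < α ∧ Integrable (fun φ : ℝ => Real.exp (|φ| ^ α)) (ρ : Measure ℝ)

/-- The Griffiths-Simon class: laws of Ising blocks, and weak limits of such laws that have
sub-gaussian growth. The topology on `ProbabilityMeasure ℝ` is that of weak convergence. -/
def IsGriffithsSimon (ρ : ProbabilityMeasure ℝ) : Prop :=
  IsIsingBlock ρ ∨
    ((∃ ρs : ℕ → ProbabilityMeasure ℝ, (∀ k, IsIsingBlock (ρs k)) ∧ Tendsto ρs atTop (𝓝 ρ)) ∧
      HasSubgaussianGrowth ρ)

/-! ### The nearest-neighbour ferromagnetic model in finite volume -/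

variable {d : ℕ}

/-- The nearest-neighbour coupling: `J_{x,y} = J` if `‖x - y‖ = 1`, and `0` otherwise. -/
def nnCoupling (J : ℝ) (x y : Site d) : ℝ :=
  if ∑ i, |x i - y i| = 1 then J else 0

/-- `|J| = ∑_y J_{0,y}`. -/
def totalCoupling (d : ℕ) (J : ℝ) : ℝ :=
  ∑' y : Site d, nnCoupling J 0 y

/-- The Hamiltonian `-∑_{{x,y} ⊆ Λ} J_{x,y} τ_x τ_y - h ∑_{x ∈ Λ} τ_x` with free boundary
conditions; the factor `1/2` turns the sum over ordered pairs into one over unordered pairs. -/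
def hamiltonian (J h : ℝ) (Λ : Finset (Site d)) (τ : Λ → ℝ) : ℝ :=
  -((1 / 2 : ℝ) * ∑ x : Λ, ∑ y : Λ, nnCoupling J (x : Site d) (y : Site d) * τ x * τ y)
    - h * ∑ x : Λ, τ x

/-- The finite-volume Gibbs expectation `⟨F⟩_{Λ,ρ,β}` in the field `h`. -/
def gibbsExpectation (J h : ℝ) (ρ : ProbabilityMeasure ℝ) (β : ℝ) (Λ : Finset (Site d))
    (F : (Λ → ℝ) → ℝ) : ℝ :=
  (∫ τ, F τ * Real.exp (-β * hamiltonian J h Λ τ) ∂(Measure.pi fun _ : Λ => (ρ : Measure ℝ))) /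
    ∫ τ, Real.exp (-β * hamiltonian J h Λ τ) ∂(Measure.pi fun _ : Λ => (ρ : Measure ℝ))

/-- The spin at `x` as a function of the configuration in `Λ`, set to `0` if `x ∉ Λ`. -/
def spin (Λ : Finset (Site d)) (x : Site d) (τ : Λ → ℝ) : ℝ :=
  if hx : x ∈ Λ then τ ⟨x, hx⟩ else 0

/-- The finite-volume two-point function `⟨τ_x τ_y⟩_{Λ,ρ,β}` at zero field. -/
def twoPointIn (J : ℝ) (ρ : ProbabilityMeasure ℝ) (β : ℝ) (Λ : Finset (Site d))
    (x y : Site d) : ℝ :=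
  gibbsExpectation J 0 ρ β Λ fun τ => spin Λ x τ * spin Λ y τ

/-- The finite-volume magnetization `⟨τ_0⟩_{Λ,ρ,β}` in the field `h`. -/
def magnetizationIn (J h : ℝ) (ρ : ProbabilityMeasure ℝ) (β : ℝ) (Λ : Finset (Site d)) : ℝ :=
  gibbsExpectation J h ρ β Λ fun τ => spin Λ 0 τ

/-! ### Infinite-volume quantities -/

/-- The two-point function `S_{ρ,β}(x) = ⟨τ_0 τ_x⟩_{ρ,β}` of the infinite-volume limit, which
is taken along all finite `Λ ↗ ℤ^d`. -/
def twoPoint (J : ℝ) (ρ : ProbabilityMeasure ℝ) (β : ℝ) (x : Site d) : ℝ :=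
  limUnder atTop fun Λ : Finset (Site d) => twoPointIn J ρ β Λ 0 x

/-- The spontaneous magnetization `M(ρ,β) = lim_{h ↓ 0} lim_{Λ ↗ ℤ^d} ⟨τ_0⟩_{Λ,ρ,β,h}`. The
limits are those of functions increasing in `Λ` and in `h > 0`, so they are written as a supremum
and an infimum. -/
def spontaneousMagnetization (d : ℕ) (J : ℝ) (ρ : ProbabilityMeasure ℝ) (β : ℝ) : ℝ≥0∞ :=
  ⨅ (h : ℝ) (_ : 0 < h), ⨆ Λ : Finset (Site d), ENNReal.ofReal (magnetizationIn J h ρ β Λ)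

/-- The critical inverse temperature `β_c(ρ) ∈ [0, ∞]`: the infimum of the `β ≥ 0` with
non-zero spontaneous magnetization. -/
def criticalBeta (d : ℕ) (J : ℝ) (ρ : ProbabilityMeasure ℝ) : ℝ≥0∞ :=
  ⨅ (β : ℝ≥0) (_ : 0 < spontaneousMagnetization d J ρ β), (β : ℝ≥0∞)

/-- The lattice point `n e₁ = (n, 0, …, 0)`. -/
def axisPoint (d n : ℕ) : Site d := fun i => if (i : ℕ) = 0 then (n : ℤ) else 0

/-- The correlation length `ξ(ρ,β) ∈ [0, ∞]`, the limit of `-n / log S_{ρ,β}(n e₁)`. It is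
written as an upper limit, so that it equals the limit whenever that exists. Terms with
`S_{ρ,β}(n e₁) = 0` count as `0`, and terms with `S_{ρ,β}(n e₁) ≥ 1`, `n ≥ 1`, count as `∞`. -/
def correlationLength (d : ℕ) (J : ℝ) (ρ : ProbabilityMeasure ℝ) (β : ℝ) : ℝ≥0∞ :=
  limsup (fun n : ℕ =>
    (n : ℝ≥0∞) / (-ENNReal.log (ENNReal.ofReal (twoPoint J ρ β (axisPoint d n)))).toENNReal) atTop

/-- `exp (-a / ξ)` for `ξ ∈ [0, ∞]` and `a > 0`, equal to `1` at `ξ = ∞` and to `0` at `ξ = 0`. -/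
def expNegDiv (a : ℝ) (ξ : ℝ≥0∞) : ℝ :=
  (EReal.exp (-((ENNReal.ofReal a / ξ : ℝ≥0∞) : EReal))).toReal

end GSModel

end

/-! Write S for the two-point function and put n = d‖x‖. The bound holds because a value of S(n e₁)
that is too small would force exponential decay faster than the correlation length permits.

Remove the couplings crossing the boundary of the box {-n, …, n}^d and restore them by
interpolation. The Lebowitz inequality controls the derivative, and the result is a Simon-Lieb
bound: for z beyond the box, S(z) ≤ M · A, where A bounds S at sites at least |z_i| - (n + 1) away
in direction i, and M = 2β|J| |∂box| S(n e₁). Iteration gives S(k e₁) ≤ B M^⌊k/(n+1)⌋. If M < 1 this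
says ξ ≤ (n+1)/(-log M), that is e^{-(n+1)/ξ} ≤ M; if M ≥ 1 the last inequality is trivial.
Messager-Miracle-Solé monotonicity enters twice: S(n e₁) dominates S at every site of sup norm at
least n, which gives the form of M, and S(d‖x‖ e₁) ≤ S(x), which moves the bound to x
(`axisPoint_le_twoPoint`). The estimate |∂box| ≤ 2d(2n+1)^{d-1} then produces the power of ‖x‖.

The correlation inequalities all follow one principle of Ginibre (`integral_mul_exp_nonneg`): if
monomials in certain functions have nonnegative integrals, so do f·exp(Q) for f and Q in the cone
they generate. With sums and differences of spins under a reflection or an exchange of two copies,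
monomials are handled by symmetry (`reflection_positivity`); this gives the Griffiths and
Messager-Miracle-Solé inequalities for any even measure with gaussian moments.

The Lebowitz inequality needs more about ρ, namely the Ellis-Monroe-Newman positivity `QuadPositive`
for four orthogonal forms in four copies. It is a finite check for a single sign, passes to
ferromagnetic blocks by Ginibre's principle, and passes to weak limits because it implies moment
bounds that make all moments converge.

The infinite-volume limit exists because correlations increase with Λ and are bounded, the bound
coming from an estimate of the average second moment in a box. -/

namespace GSModel

/-! ### Functions of controlled growth -/

/-- `N ≥ 0` is an exponential gauge for `μ` if all exponential moments of `N` are finite. -/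
structure ExpGauge {Ω : Type*} [MeasurableSpace Ω] (μ : Measure Ω) (N : Ω → ℝ) : Prop where
  measurable : Measurable N
  nonneg : ∀ ω, 0 ≤ N ω
  integrable : ∀ C : ℝ, Integrable (fun ω => Real.exp (C * (1 + N ω))) μ

/-- Measurable functions growing at most like `exp (C (1 + N))`. -/
def Tame {Ω : Type*} [MeasurableSpace Ω] (N F : Ω → ℝ) : Prop :=
  Measurable F ∧ ∃ C : ℝ, 0 ≤ C ∧ ∀ ω, |F ω| ≤ Real.exp (C * (1 + N ω))

/-- Measurable functions growing at most like `C (1 + N)`. -/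
def LinearGrowth {Ω : Type*} [MeasurableSpace Ω] (N Q : Ω → ℝ) : Prop :=
  Measurable Q ∧ ∃ C : ℝ, 0 ≤ C ∧ ∀ ω, |Q ω| ≤ C * (1 + N ω)

section Growth

variable {Ω : Type*} [MeasurableSpace Ω] {μ : Measure Ω} {N F G Q R : Ω → ℝ}

theorem Tame.integrable (hN : ExpGauge μ N) (hF : Tame N F) : Integrable F μ := by
  obtain ⟨hm, C, -, hC⟩ := hF
  exact (hN.integrable C).mono' hm.aestronglyMeasurable (Eventually.of_forall hC)

theorem Tame.mul (hF : Tame N F) (hG : Tame N G) : Tame N (fun ω => F ω * G ω) := by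
  obtain ⟨hm, C, h0, hC⟩ := hF
  obtain ⟨hm', C', h0', hC'⟩ := hG
  refine ⟨hm.mul hm', C + C', by positivity, fun ω => ?_⟩
  rw [abs_mul, add_mul, Real.exp_add]
  exact mul_le_mul (hC ω) (hC' ω) (abs_nonneg _) (Real.exp_pos _).le

theorem LinearGrowth.add (hQ : LinearGrowth N Q) (hR : LinearGrowth N R) :
    LinearGrowth N (fun ω => Q ω + R ω) := by
  obtain ⟨hm, C, h0, hC⟩ := hQ
  obtain ⟨hm', C', h0', hC'⟩ := hR
  refine ⟨hm.add hm', C + C', by positivity, fun ω => ?_⟩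
  rw [add_mul]
  exact (abs_add_le _ _).trans (add_le_add (hC ω) (hC' ω))

theorem LinearGrowth.const_mul (c : ℝ) (hQ : LinearGrowth N Q) :
    LinearGrowth N (fun ω => c * Q ω) := by
  obtain ⟨hm, C, h0, hC⟩ := hQ
  refine ⟨hm.const_mul c, |c| * C, by positivity, fun ω => ?_⟩
  rw [abs_mul, mul_assoc]
  exact mul_le_mul_of_nonneg_left (hC ω) (abs_nonneg _)

theorem LinearGrowth.const (hN : ∀ ω, 0 ≤ N ω) (c : ℝ) : LinearGrowth N (fun _ => c) :=
  ⟨measurable_const, |c|, abs_nonneg _, fun ω => by nlinarith [hN ω, abs_nonneg c]⟩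

theorem LinearGrowth.sum (hN : ∀ ω, 0 ≤ N ω) {ι : Type*} (s : Finset ι) {Q : ι → Ω → ℝ}
    (hQ : ∀ i ∈ s, LinearGrowth N (Q i)) : LinearGrowth N (fun ω => ∑ i ∈ s, Q i ω) := by
  classical
  induction s using Finset.induction_on with
  | empty => simpa using LinearGrowth.const hN 0
  | insert i s hi ih =>
    simp_rw [Finset.sum_insert hi]
    exact (hQ i (by simp)).add (ih fun j hj => hQ j (by simp [hj]))

theorem LinearGrowth.tame (hQ : LinearGrowth N Q) : Tame N Q := by
  obtain ⟨hm, C, h0, hC⟩ := hQ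
  exact ⟨hm, C, h0, fun ω => (hC ω).trans (by linarith [Real.add_one_le_exp (C * (1 + N ω))])⟩

theorem LinearGrowth.tame_exp (hQ : LinearGrowth N Q) : Tame N (fun ω => Real.exp (Q ω)) := by
  obtain ⟨hm, C, h0, hC⟩ := hQ
  refine ⟨hm.exp, C, h0, fun ω => ?_⟩
  rw [abs_of_pos (Real.exp_pos _)]
  exact Real.exp_le_exp.2 ((le_abs_self _).trans (hC ω))

theorem LinearGrowth.abs (hQ : LinearGrowth N Q) : LinearGrowth N (fun ω => |Q ω|) := by
  obtain ⟨hm, C, h0, hC⟩ := hQ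
  exact ⟨hm.abs, C, h0, fun ω => by simpa using hC ω⟩

theorem Tame.abs (hF : Tame N F) : Tame N (fun ω => |F ω|) := by
  obtain ⟨hm, C, h0, hC⟩ := hF
  exact ⟨hm.abs, C, h0, fun ω => by simpa using hC ω⟩

theorem Tame.const (hN : ∀ ω, 0 ≤ N ω) (c : ℝ) : Tame N (fun _ => c) :=
  (LinearGrowth.const hN c).tame

theorem Tame.add (hN : ∀ ω, 0 ≤ N ω) (hF : Tame N F) (hG : Tame N G) :
    Tame N (fun ω => F ω + G ω) := by
  obtain ⟨hm, C, h0, hC⟩ := hF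
  obtain ⟨hm', C', h0', hC'⟩ := hG
  refine ⟨hm.add hm', C + C' + 1, by positivity, fun ω => ?_⟩
  have hNω := hN ω
  have h1 : Real.exp (C * (1 + N ω)) ≤ Real.exp ((C + C') * (1 + N ω)) := by gcongr; linarith
  have h2 : Real.exp (C' * (1 + N ω)) ≤ Real.exp ((C + C') * (1 + N ω)) := by gcongr; linarith
  have h3 : 2 ≤ Real.exp (1 + N ω) := by linarith [Real.add_one_le_exp (1 + N ω)]
  calc |F ω + G ω| ≤ |F ω| + |G ω| := abs_add_le _ _
    _ ≤ 2 * Real.exp ((C + C') * (1 + N ω)) := by linarith [hC ω, hC' ω]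
    _ ≤ Real.exp (1 + N ω) * Real.exp ((C + C') * (1 + N ω)) := by gcongr
    _ = Real.exp ((C + C' + 1) * (1 + N ω)) := by rw [← Real.exp_add]; ring_nf

theorem Tame.sub (hN : ∀ ω, 0 ≤ N ω) (hF : Tame N F) (hG : Tame N G) :
    Tame N (fun ω => F ω - G ω) := by
  simpa [sub_eq_add_neg] using hF.add hN ((Tame.const hN (-1)).mul hG)

theorem Tame.pow (hN : ∀ ω, 0 ≤ N ω) (hF : Tame N F) (n : ℕ) : Tame N (fun ω => F ω ^ n) := by
  induction n with
  | zero => simpa using Tame.const hN 1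
  | succ n ih => simpa [pow_succ] using ih.mul hF

theorem Tame.prod (hN : ∀ ω, 0 ≤ N ω) {ι : Type*} (s : Finset ι) {F : ι → Ω → ℝ}
    (hF : ∀ i ∈ s, Tame N (F i)) : Tame N (fun ω => ∏ i ∈ s, F i ω) := by
  classical
  induction s using Finset.induction_on with
  | empty => simpa using Tame.const hN 1
  | insert i s hi ih =>
    simp_rw [Finset.prod_insert hi]
    exact (hF i (by simp)).mul (ih fun j hj => hF j (by simp [hj]))

/-- A product of two functions dominated by `√N` grows at most linearly in `N`. -/
theorem LinearGrowth.of_sq_le (hF : Measurable F) (hG : Measurable G)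
    (hFN : ∀ ω, F ω ^ 2 ≤ N ω) (hGN : ∀ ω, G ω ^ 2 ≤ N ω) :
    LinearGrowth N (fun ω => F ω * G ω) := by
  refine ⟨hF.mul hG, 1, zero_le_one, fun ω => ?_⟩
  rw [abs_mul]
  nlinarith [hFN ω, hGN ω, sq_abs (F ω), sq_abs (G ω), sq_nonneg (|F ω| - |G ω|)]

theorem LinearGrowth.of_sq_le_one (hF : Measurable F) (hFN : ∀ ω, F ω ^ 2 ≤ N ω) :
    LinearGrowth N F := by
  refine ⟨hF, 1, zero_le_one, fun ω => ?_⟩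
  nlinarith [hFN ω, sq_abs (F ω), sq_nonneg (|F ω| - 1)]

end Growth

/-! ### Positivity of integrals over cones of functions -/

/-- If all the integrals of `f * Q ^ n * w` are non-negative, so is that of `f * exp Q * w`. -/
theorem integral_mul_exp_nonneg_of_pow {Ω : Type*} [MeasurableSpace Ω] {μ : Measure Ω}
    {N f Q w : Ω → ℝ} (hN : ExpGauge μ N) (hf : Tame N f) (hQ : LinearGrowth N Q) (hw : Tame N w)
    (hpow : ∀ n : ℕ, 0 ≤ ∫ ω, f ω * Q ω ^ n * w ω ∂μ) :
    0 ≤ ∫ ω, f ω * Real.exp (Q ω) * w ω ∂μ := by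
  have hs : HasSum (fun n : ℕ => ∫ ω, f ω * (Q ω ^ n / n.factorial) * w ω ∂μ)
      (∫ ω, f ω * Real.exp (Q ω) * w ω ∂μ) := by
    have hexp : ∀ x : ℝ, HasSum (fun n : ℕ => x ^ n / n.factorial) (Real.exp x) := fun x => by
      rw [Real.exp_eq_exp_ℝ]; exact NormedSpace.expSeries_div_hasSum_exp x
    -- The dominating series sums to |f| exp|Q| |w|, which is integrable because Q grows at most
    -- linearly in the gauge.
    refine hasSum_integral_of_dominated_convergence
      (fun n ω => |f ω| * (|Q ω| ^ n / n.factorial) * |w ω|) (fun n => ?_) (fun n => ?_) ?_ ?_ ?_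
    · exact ((hf.1.mul ((hQ.1.pow_const n).div_const _)).mul hw.1).aestronglyMeasurable
    · refine Eventually.of_forall fun ω => le_of_eq ?_
      simp
    · exact Eventually.of_forall fun ω =>
        (((hexp |Q ω|).mul_left |f ω|).mul_right |w ω|).summable
    · have : (fun ω => ∑' n : ℕ, |f ω| * (|Q ω| ^ n / n.factorial) * |w ω|) =
          fun ω => |f ω| * Real.exp |Q ω| * |w ω| := by
        funext ω
        exact (((hexp |Q ω|).mul_left |f ω|).mul_right |w ω|).tsum_eq
      rw [this]
      exact ((hf.abs.mul hQ.abs.tame_exp).mul hw.abs).integrable hN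
    · exact Eventually.of_forall fun ω => ((hexp (Q ω)).mul_left (f ω)).mul_right (w ω)
  refine hs.nonneg fun n => ?_
  have h := hpow n
  have e : (fun ω => f ω * (Q ω ^ n / n.factorial) * w ω) =
      fun ω => (1 / (n.factorial : ℝ)) * (f ω * Q ω ^ n * w ω) := by
    funext ω; ring
  rw [e, integral_const_mul]
  positivity

/-- The convex cone, closed under products, generated by a set of functions. -/
def positiveCone {Ω : Type*} (S : Set (Ω → ℝ)) : Subsemiring (Ω → ℝ) :=
  Subsemiring.closure ({f | ∃ c : ℝ, 0 ≤ c ∧ f = fun _ => c} ∪ S)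

section Cone

variable {Ω : Type*} {S : Set (Ω → ℝ)} {f g Q : Ω → ℝ}

theorem const_mem_positiveCone {c : ℝ} (hc : 0 ≤ c) : (fun _ => c) ∈ positiveCone S :=
  Subsemiring.subset_closure (Or.inl ⟨c, hc, rfl⟩)

theorem mem_positiveCone (hf : f ∈ S) : f ∈ positiveCone S :=
  Subsemiring.subset_closure (Or.inr hf)

theorem positiveCone_const_mul {c : ℝ} (hc : 0 ≤ c) (hf : f ∈ positiveCone S) :
    (fun ω => c * f ω) ∈ positiveCone S :=
  (positiveCone S).mul_mem (const_mem_positiveCone hc) hf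

theorem positiveCone_mul (hf : f ∈ positiveCone S) (hg : g ∈ positiveCone S) :
    (fun ω => f ω * g ω) ∈ positiveCone S :=
  (positiveCone S).mul_mem hf hg

theorem positiveCone_add (hf : f ∈ positiveCone S) (hg : g ∈ positiveCone S) :
    (fun ω => f ω + g ω) ∈ positiveCone S :=
  (positiveCone S).add_mem hf hg

theorem positiveCone_sum {ι : Type*} (s : Finset ι) {F : ι → Ω → ℝ}
    (hF : ∀ i ∈ s, F i ∈ positiveCone S) : (fun ω => ∑ i ∈ s, F i ω) ∈ positiveCone S := by
  have : (fun ω => ∑ i ∈ s, F i ω) = ∑ i ∈ s, F i := by ext; simp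
  rw [this]
  exact (positiveCone S).sum_mem hF

/-- After distributing products over sums, a cone element is a sum of nonnegative constants times
monomials in the generators, so positivity needs to be checked on monomials only. -/
theorem tame_and_integral_nonneg_of_mem_positiveCone [MeasurableSpace Ω] {μ : Measure Ω}
    {N w : Ω → ℝ} (hN : ExpGauge μ N) (hw : Tame N w)
    (h : ∀ m ∈ Submonoid.closure S, Tame N m ∧ 0 ≤ ∫ ω, m ω * w ω ∂μ)
    (hf : f ∈ positiveCone S) : Tame N f ∧ 0 ≤ ∫ ω, f ω * w ω ∂μ := by
  have key : ∀ m ∈ Submonoid.closure ({f | ∃ c : ℝ, 0 ≤ c ∧ f = fun _ => c} ∪ S),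
      ∃ c : ℝ, 0 ≤ c ∧ ∃ m' ∈ Submonoid.closure S, m = fun ω => c * m' ω := by
    intro m hm
    induction hm using Submonoid.closure_induction with
    | mem x hx =>
      rcases hx with ⟨c, hc, rfl⟩ | hx
      · exact ⟨c, hc, 1, Submonoid.one_mem _, by simp⟩
      · exact ⟨1, zero_le_one, x, Submonoid.subset_closure hx, by simp⟩
    | one => exact ⟨1, zero_le_one, 1, Submonoid.one_mem _, by ext; simp⟩
    | mul x y _ _ hx hy =>
      obtain ⟨c, hc, x', hx', rfl⟩ := hx
      obtain ⟨c', hc', y', hy', rfl⟩ := hy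
      refine ⟨c * c', mul_nonneg hc hc', x' * y', Submonoid.mul_mem _ hx' hy', ?_⟩
      ext ω; simp only [Pi.mul_apply]; ring
  rw [positiveCone, Subsemiring.mem_closure_iff] at hf
  induction hf using AddSubmonoid.closure_induction with
  | mem x hx =>
    obtain ⟨c, hc, m, hm, rfl⟩ := key x hx
    obtain ⟨h1, h2⟩ := h m hm
    refine ⟨(Tame.const hN.nonneg c).mul h1, ?_⟩
    simp_rw [mul_assoc]
    rw [integral_const_mul]
    exact mul_nonneg hc h2
  | zero => exact ⟨Tame.const hN.nonneg 0, by simp⟩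
  | add x y _ _ hx hy =>
    refine ⟨hx.1.add hN.nonneg hy.1, ?_⟩
    simp_rw [Pi.add_apply, add_mul]
    rw [integral_add ((hx.1.mul hw).integrable hN) ((hy.1.mul hw).integrable hN)]
    exact add_nonneg hx.2 hy.2

/-- Ginibre's principle: if all monomials in the generators have a non-negative integral against
the weight `w`, then so does `f * exp Q` for `f` and `Q` in the cone they generate. -/
theorem integral_mul_exp_nonneg [MeasurableSpace Ω] {μ : Measure Ω}
    {N w : Ω → ℝ} (hN : ExpGauge μ N) (hw : Tame N w)
    (h : ∀ m ∈ Submonoid.closure S, Tame N m ∧ 0 ≤ ∫ ω, m ω * w ω ∂μ)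
    (hf : f ∈ positiveCone S) (hQ : Q ∈ positiveCone S) (hQ' : LinearGrowth N Q) :
    0 ≤ ∫ ω, f ω * Real.exp (Q ω) * w ω ∂μ :=
  integral_mul_exp_nonneg_of_pow hN
    (tame_and_integral_nonneg_of_mem_positiveCone hN hw h hf).1 hQ' hw fun n =>
    (tame_and_integral_nonneg_of_mem_positiveCone hN hw h
      ((positiveCone S).mul_mem hf ((positiveCone S).pow_mem hQ n))).2

/-- Monomials in functions each of which can be given the opposite sign by a symmetry that fixes
the others have non-negative integrals. -/
theorem integral_monomial_nonneg_of_symmetry [MeasurableSpace Ω] {μ : Measure Ω}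
    {N w : Ω → ℝ} (hN : ExpGauge μ N) (hw : Tame N w) (hw0 : ∀ ω, 0 ≤ w ω)
    {ι : Type*} [Fintype ι] (x : ι → Ω → ℝ) (hx : ∀ i, Tame N (x i)) (T : ι → Ω → Ω)
    (hT : ∀ i, MeasurePreserving (T i) μ μ) (hneg : ∀ i ω, x i (T i ω) = -x i ω)
    (hfix : ∀ i j, j ≠ i → ∀ ω, x j (T i ω) = x j ω) (hwT : ∀ i ω, w (T i ω) = w ω)
    {m : Ω → ℝ} (hm : m ∈ Submonoid.closure (Set.range x)) :
    Tame N m ∧ 0 ≤ ∫ ω, m ω * w ω ∂μ := by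
  classical
  obtain ⟨k, rfl⟩ : ∃ k : ι → ℕ, m = fun ω => ∏ i, x i ω ^ k i := by
    induction hm using Submonoid.closure_induction with
    | mem y hy =>
      obtain ⟨i, rfl⟩ := hy
      refine ⟨fun j => if j = i then 1 else 0, ?_⟩
      ext ω
      rw [Finset.prod_eq_single i] <;> simp +contextual
    | one => exact ⟨0, by ext; simp⟩
    | mul y z _ _ hy hz =>
      obtain ⟨k, rfl⟩ := hy
      obtain ⟨l, rfl⟩ := hz
      exact ⟨k + l, by ext ω; simp [pow_add, Finset.prod_mul_distrib]⟩
  have htame : Tame N fun ω => ∏ i, x i ω ^ k i :=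
    Tame.prod hN.nonneg _ fun i _ => (hx i).pow hN.nonneg _
  refine ⟨htame, ?_⟩
  -- If all exponents are even the integrand is pointwise nonnegative. If the exponent of `x i` is
  -- odd, `T i` reverses the sign of the integrand while preserving the measure, so the integral
  -- vanishes.
  by_cases hk : ∀ i, Even (k i)
  · exact integral_nonneg fun ω =>
      mul_nonneg (Finset.prod_nonneg fun i _ => (hk i).pow_nonneg _) (hw0 ω)
  · push Not at hk
    obtain ⟨i, hi⟩ := hk
    have hodd : Odd (k i) := by simpa using hi
    have h1 : ∀ ω, (∏ j, x j (T i ω) ^ k j) * w (T i ω) = -((∏ j, x j ω ^ k j) * w ω) := by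
      intro ω
      rw [hwT, ← Finset.mul_prod_erase _ _ (Finset.mem_univ i),
        ← Finset.mul_prod_erase _ (fun j => x j ω ^ k j) (Finset.mem_univ i), hneg,
        hodd.neg_pow, Finset.prod_congr rfl fun j hj => by rw [hfix i j (Finset.ne_of_mem_erase hj)]]
      ring
    have h2 : ∫ ω, (∏ j, x j ω ^ k j) * w ω ∂μ =
        ∫ ω, (∏ j, x j (T i ω) ^ k j) * w (T i ω) ∂μ := by
      conv_lhs => rw [← (hT i).map_eq]
      refine integral_map (hT i).measurable.aemeasurable ?_
      exact (htame.1.mul hw.1).aestronglyMeasurable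
    simp_rw [h1, integral_neg] at h2
    linarith

end Cone

end GSModel

namespace GSModel

/-! ### Ferromagnetic models on finite sets -/

/-- Even single-site measures all of whose gaussian moments `∫ exp (C φ²) dρ` are finite. -/
structure EvenSubgaussian (ρ : Measure ℝ) : Prop where
  even : ρ.map (fun x => -x) = ρ
  integrable : ∀ C : ℝ, Integrable (fun x => Real.exp (C * x ^ 2)) ρ

/-- The sum of the squares of the spins. -/
def sqSum {V : Type*} [Fintype V] (τ : V → ℝ) : ℝ := ∑ v, τ v ^ 2

/-- The quadratic form `∑ K_{xy} τ_x τ_y`. -/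
def pairEnergy {V : Type*} [Fintype V] (K : V → V → ℝ) (τ : V → ℝ) : ℝ :=
  ∑ x, ∑ y, K x y * τ x * τ y

/-- The expectation of `F` under the Gibbs measure with weight `exp (∑ K_{xy} τ_x τ_y)`. -/
noncomputable def gibbsMean {V : Type*} [Fintype V] (ρ : Measure ℝ) (K : V → V → ℝ)
    (F : (V → ℝ) → ℝ) : ℝ :=
  (∫ τ, F τ * Real.exp (pairEnergy K τ) ∂(Measure.pi fun _ : V => ρ)) /
    ∫ τ, Real.exp (pairEnergy K τ) ∂(Measure.pi fun _ : V => ρ)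

section Reflection

variable {V : Type*}

/-- The even and odd parts `τ_v ± τ_{θ v}` of a configuration under a reflection `θ`, one for each
orbit: the odd parts on one side of the reflection, the even ones on that side and on the mirror. -/
def reflectionParts (θ : Equiv.Perm V) (P : V → Prop) :
    ({v // P v ∨ θ v = v} ⊕ {v // P v}) → (V → ℝ) → ℝ :=
  Sum.elim (fun v τ => τ v + τ (θ v)) (fun v τ => τ v - τ (θ v))

theorem add_mem_reflectionCone {θ : Equiv.Perm V} {P : V → Prop} (hθ : ∀ v, θ (θ v) = v)
    (hcover : ∀ v, P v ∨ P (θ v) ∨ θ v = v) (v : V) :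
    (fun τ : V → ℝ => τ v + τ (θ v)) ∈ positiveCone (Set.range (reflectionParts θ P)) := by
  rcases hcover v with h | h | h
  · exact mem_positiveCone ⟨Sum.inl ⟨v, Or.inl h⟩, rfl⟩
  · refine mem_positiveCone ⟨Sum.inl ⟨θ v, Or.inl h⟩, ?_⟩
    ext τ; simp [reflectionParts, hθ, add_comm]
  · exact mem_positiveCone ⟨Sum.inl ⟨v, Or.inr h⟩, rfl⟩

/-- Odd parts change sign under θ, so only sites on the chosen side qualify; on the mirror the odd
part is zero. -/
theorem sub_mem_reflectionCone {θ : Equiv.Perm V} {P : V → Prop} {v : V}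
    (hv : P v ∨ θ v = v) :
    (fun τ : V → ℝ => τ v - τ (θ v)) ∈ positiveCone (Set.range (reflectionParts θ P)) := by
  rcases hv with h | h
  · exact mem_positiveCone ⟨Sum.inr ⟨v, h⟩, rfl⟩
  · simpa [h] using const_mem_positiveCone (S := Set.range (reflectionParts θ P)) le_rfl

end Reflection

/-! ### Griffiths and Messager-Miracle-Solé inequalities -/

section FiniteModel

variable {V : Type*} [Fintype V] {ρ : Measure ℝ} [IsProbabilityMeasure ρ]

theorem sqSum_nonneg (τ : V → ℝ) : 0 ≤ sqSum τ := Finset.sum_nonneg fun _ _ => sq_nonneg _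

theorem sq_le_sqSum (τ : V → ℝ) (v : V) : τ v ^ 2 ≤ sqSum τ :=
  Finset.single_le_sum (f := fun v => τ v ^ 2) (fun _ _ => sq_nonneg _) (Finset.mem_univ v)

theorem measurable_sqSum : Measurable (sqSum : (V → ℝ) → ℝ) := by
  unfold sqSum; fun_prop

theorem EvenSubgaussian.expGauge (hρ : EvenSubgaussian ρ) :
    ExpGauge (Measure.pi fun _ : V => ρ) sqSum := by
  refine ⟨measurable_sqSum, sqSum_nonneg, fun C => ?_⟩
  have h := (Integrable.fintype_prod (μ := fun _ : V => ρ)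
    (f := fun (_ : V) (x : ℝ) => Real.exp (C * x ^ 2)) fun _ => hρ.integrable C).const_mul
      (Real.exp C)
  refine h.congr (Eventually.of_forall fun τ => ?_)
  simp only [sqSum]
  rw [← Real.exp_sum, ← Real.exp_add, ← Finset.mul_sum]
  ring_nf

theorem linearGrowth_coord (v : V) : LinearGrowth sqSum (fun τ : V → ℝ => τ v) :=
  LinearGrowth.of_sq_le_one (measurable_pi_apply v) fun τ => sq_le_sqSum τ v

theorem linearGrowth_mul (u v : V) : LinearGrowth sqSum (fun τ : V → ℝ => τ u * τ v) :=
  LinearGrowth.of_sq_le (measurable_pi_apply u) (measurable_pi_apply v)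
    (fun τ => sq_le_sqSum τ u) fun τ => sq_le_sqSum τ v

theorem linearGrowth_pairEnergy (K : V → V → ℝ) :
    LinearGrowth sqSum (pairEnergy K) := by
  unfold pairEnergy
  refine LinearGrowth.sum sqSum_nonneg _ fun x _ => LinearGrowth.sum sqSum_nonneg _ fun y _ => ?_
  simpa only [mul_assoc] using (linearGrowth_mul x y).const_mul (K x y)

theorem integral_exp_pairEnergy_pos (hρ : EvenSubgaussian ρ) (K : V → V → ℝ) :
    0 < ∫ τ, Real.exp (pairEnergy K τ) ∂(Measure.pi fun _ : V => ρ) :=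
  integral_exp_pos ((linearGrowth_pairEnergy K).tame_exp.integrable hρ.expGauge)

theorem measurePreserving_sign_perm (hρ : EvenSubgaussian ρ) (ε : V → ℝ)
    (hε : ∀ v, ε v = 1 ∨ ε v = -1) (σ : Equiv.Perm V) :
    MeasurePreserving (fun (τ : V → ℝ) v => ε v * τ (σ v))
      (Measure.pi fun _ : V => ρ) (Measure.pi fun _ : V => ρ) := by
  have h1 := (measurePreserving_piCongrLeft (fun _ : V => ρ) σ.symm)
  have h2 : MeasurePreserving (fun (τ : V → ℝ) v => ε v * τ v)
      (Measure.pi fun _ : V => ρ) (Measure.pi fun _ : V => ρ) := by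
    refine measurePreserving_pi (fun _ : V => ρ) (fun _ : V => ρ)
      (f := fun v x => ε v * x) fun v => ⟨by fun_prop, ?_⟩
    rcases hε v with h | h
    · simp [h]
    · simpa [h] using hρ.even
  have h3 := h2.comp h1
  convert h3 using 1
  ext τ v
  simp only [Function.comp_apply, MeasurableEquiv.coe_piCongrLeft]
  congr 1
  have := Equiv.piCongrLeft_apply_apply (fun _ : V => ℝ) σ.symm τ (σ v)
  simpa using this.symm

/-- Exchanging the spins at v and θ v negates the odd part of that orbit and fixes every other even
or odd part. Exchanging them with a change of both signs negates the even part instead. Both maps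
preserve an even product measure, so monomials are covered by
`integral_monomial_nonneg_of_symmetry`. The invariant weight w makes room for interactions outside
the cone. -/
theorem reflection_positivity [DecidableEq V] (hρ : EvenSubgaussian ρ) {θ : Equiv.Perm V} {P : V → Prop}
    (hθ : ∀ v, θ (θ v) = v) (hP : ∀ v, P v → ¬ P (θ v)) {w : (V → ℝ) → ℝ}
    (hw : Tame sqSum w) (hw0 : ∀ τ, 0 ≤ w τ)
    (hw1 : ∀ v τ, w (fun u => τ (Equiv.swap v (θ v) u)) = w τ)
    (hw2 : ∀ v τ, w (fun u => (if u = v ∨ u = θ v then -1 else 1) * τ (Equiv.swap v (θ v) u)) =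
      w τ)
    {f Q : (V → ℝ) → ℝ} (hf : f ∈ positiveCone (Set.range (reflectionParts θ P)))
    (hQ : Q ∈ positiveCone (Set.range (reflectionParts θ P))) (hQ' : LinearGrowth sqSum Q) :
    0 ≤ ∫ τ, f τ * Real.exp (Q τ) * w τ ∂(Measure.pi fun _ : V => ρ) := by
  classical
  refine integral_mul_exp_nonneg hρ.expGauge hw (fun m hm => ?_) hf hQ hQ'
  refine integral_monomial_nonneg_of_symmetry hρ.expGauge hw hw0 (reflectionParts θ P) ?_
    (Sum.elim
      (fun v τ u => (if u = v.1 ∨ u = θ v.1 then -1 else 1) * τ (Equiv.swap v.1 (θ v.1) u))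
      (fun v τ u => τ (Equiv.swap v.1 (θ v.1) u))) ?_ ?_ ?_ ?_ hm
  · rintro (v | v)
    · exact ((linearGrowth_coord v.1).add (linearGrowth_coord (θ v.1))).tame
    · exact (linearGrowth_coord v.1).tame.sub sqSum_nonneg (linearGrowth_coord (θ v.1)).tame
  · rintro (v | v)
    · refine measurePreserving_sign_perm hρ _ (fun u => ?_) _
      split_ifs <;> simp
    · simpa using measurePreserving_sign_perm hρ (fun _ => 1) (fun _ => Or.inl rfl)
        (Equiv.swap v.1 (θ v.1))
  · rintro (v | v) τ
    · simp [reflectionParts]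
    · simp [reflectionParts]
  -- Distinct representatives lie in distinct θ-orbits, so a symmetry acting on one orbit does not
  -- touch the spins of the other.
  · have hne : ∀ v u : V, (P v ∨ θ v = v) → (P u ∨ θ u = u) → u ≠ v →
        u ≠ θ v ∧ θ u ≠ v ∧ θ u ≠ θ v := by
      intro v u hv hu huv
      have h1 : u ≠ θ v := by
        rintro rfl
        rcases hu with hu | hu
        · rcases hv with hv | hv
          · exact hP v hv hu
          · exact huv hv
        · rw [hθ] at hu; exact huv hu.symm
      refine ⟨h1, fun h => h1 (by rw [← h, hθ]), fun h => huv (θ.injective h)⟩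
    rintro (v | v) (u | u) huv τ
    · have h : u.1 ≠ v.1 := fun h => huv (by rw [Subtype.ext h])
      obtain ⟨h1, h2, h3⟩ := hne v u v.2 u.2 h
      simp [reflectionParts, h, h1, h2, h3, Equiv.swap_apply_of_ne_of_ne]
    · by_cases h : u.1 = v.1
      · simp [reflectionParts, h]; ring
      · obtain ⟨h1, h2, h3⟩ := hne v u v.2 (Or.inl u.2) h
        simp [reflectionParts, h, h1, h2, h3, Equiv.swap_apply_of_ne_of_ne]
    · by_cases h : u.1 = v.1
      · simp [reflectionParts, h]; ring
      · obtain ⟨h1, h2, h3⟩ := hne v u (Or.inl v.2) u.2 h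
        simp [reflectionParts, h, h1, h2, h3, Equiv.swap_apply_of_ne_of_ne]
    · have h : u.1 ≠ v.1 := fun h => huv (by rw [Subtype.ext h])
      obtain ⟨h1, h2, h3⟩ := hne v u (Or.inl v.2) (Or.inl u.2) h
      simp [reflectionParts, h, h1, h2, h3, Equiv.swap_apply_of_ne_of_ne]
  · rintro (v | v) τ
    · exact hw2 v.1 τ
    · exact hw1 v.1 τ

/-- The first Griffiths inequality. -/
theorem gibbsMean_mul_nonneg (hρ : EvenSubgaussian ρ) {K : V → V → ℝ} (hK : ∀ x y, 0 ≤ K x y)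
    (u v : V) : 0 ≤ gibbsMean ρ K (fun τ => τ u * τ v) := by
  classical
  refine div_nonneg ?_ (integral_exp_pairEnergy_pos hρ K).le
  -- For the identity reflection the even part at v is 2τ_v, so the spins themselves lie in the
  -- cone.
  have hc : ∀ v : V, (fun τ : V → ℝ => τ v) ∈
      positiveCone (Set.range (reflectionParts (1 : Equiv.Perm V) fun _ => False)) := by
    intro v
    have := positiveCone_const_mul (c := 1 / 2) (by norm_num)
      (add_mem_reflectionCone (θ := (1 : Equiv.Perm V)) (P := fun _ => False) (by simp)
        (by simp) v)
    convert this using 2 with τ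
    simp only [Equiv.Perm.coe_one, id_eq]; ring
  have h := reflection_positivity hρ (θ := (1 : Equiv.Perm V)) (P := fun _ => False)
    (w := fun _ => 1) (by simp) (by simp) (Tame.const sqSum_nonneg 1) (by simp) (by simp) (by simp)
    (positiveCone_mul (hc u) (hc v)) (Q := pairEnergy K)
    (positiveCone_sum _ fun x _ => positiveCone_sum _ fun y _ =>
      positiveCone_mul (positiveCone_const_mul (hK x y) (hc x)) (hc y))
    (linearGrowth_pairEnergy K)
  simpa using h

/-- The second Griffiths inequality: correlations increase with the couplings. -/
theorem gibbsMean_mul_mono (hρ : EvenSubgaussian ρ) {K K' : V → V → ℝ} (hK : ∀ x y, 0 ≤ K x y)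
    (hKK' : ∀ x y, K x y ≤ K' x y) (u v : V) :
    gibbsMean ρ K (fun τ => τ u * τ v) ≤ gibbsMean ρ K' (fun τ => τ u * τ v) := by
  classical
  -- Two independent copies, with couplings K' on the left and K on the right, are exchanged by θ.
  -- The difference of the two means, multiplied by both partition functions, is the integral of τ_u
  -- τ_v - τ'_u τ'_v over the doubled system.
  set θ : Equiv.Perm (V ⊕ V) := Equiv.sumComm V V with hθ
  set P : V ⊕ V → Prop := fun x => x.isLeft with hPdef
  have hθ2 : ∀ x, θ (θ x) = x := by rintro (x | x) <;> rfl
  have hP : ∀ x, P x → ¬ P (θ x) := by rintro (x | x) <;> simp [hPdef, hθ]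
  have hcov : ∀ x, P x ∨ P (θ x) ∨ θ x = x := by rintro (x | x) <;> simp [hPdef, hθ]
  have ha : ∀ x : V, (fun τ : V ⊕ V → ℝ => τ (Sum.inl x) + τ (Sum.inr x)) ∈
      positiveCone (Set.range (reflectionParts θ P)) := fun x =>
    add_mem_reflectionCone hθ2 hcov (Sum.inl x)
  have hb : ∀ x : V, (fun τ : V ⊕ V → ℝ => τ (Sum.inl x) - τ (Sum.inr x)) ∈
      positiveCone (Set.range (reflectionParts θ P)) := fun x =>
    sub_mem_reflectionCone (v := Sum.inl x) (Or.inl (by simp [hPdef]))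
  set L : V ⊕ V → V ⊕ V → ℝ :=
    Sum.elim (fun x => Sum.elim (K' x) fun _ => 0) (fun x => Sum.elim (fun _ => 0) (K x)) with hL
  have hE : ∀ τ : V ⊕ V → ℝ, pairEnergy L τ =
      pairEnergy K' (fun x => τ (Sum.inl x)) + pairEnergy K (fun x => τ (Sum.inr x)) := by
    intro τ; simp [pairEnergy, hL]
  have hQ : pairEnergy L ∈ positiveCone (Set.range (reflectionParts θ P)) := by
    -- Polarisation in sums and differences of the copies: equal types carry K' + K, mixed types
    -- carry K' - K, which is where monotonicity of the couplings is used.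
    have : pairEnergy L = fun τ : V ⊕ V → ℝ => ∑ x, ∑ y,
        ((K' x y + K x y) / 4 * ((τ (Sum.inl x) + τ (Sum.inr x)) * (τ (Sum.inl y) + τ (Sum.inr y))
          + (τ (Sum.inl x) - τ (Sum.inr x)) * (τ (Sum.inl y) - τ (Sum.inr y))) +
        (K' x y - K x y) / 4 *
          ((τ (Sum.inl x) + τ (Sum.inr x)) * (τ (Sum.inl y) - τ (Sum.inr y))
          + (τ (Sum.inl x) - τ (Sum.inr x)) * (τ (Sum.inl y) + τ (Sum.inr y)))) := by
      funext τ
      rw [hE]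
      simp only [pairEnergy, ← Finset.sum_add_distrib]
      refine Finset.sum_congr rfl fun x _ => Finset.sum_congr rfl fun y _ => ?_
      ring
    rw [this]
    refine positiveCone_sum _ fun x _ => positiveCone_sum _ fun y _ => ?_
    have h1 := hK x y
    have h2 := hKK' x y
    exact positiveCone_add
      (positiveCone_const_mul (by linarith)
        (positiveCone_add (positiveCone_mul (ha x) (ha y)) (positiveCone_mul (hb x) (hb y))))
      (positiveCone_const_mul (by linarith)
        (positiveCone_add (positiveCone_mul (ha x) (hb y)) (positiveCone_mul (hb x) (ha y))))
  have hf : (fun τ : V ⊕ V → ℝ => τ (Sum.inl u) * τ (Sum.inl v) - τ (Sum.inr u) * τ (Sum.inr v)) ∈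
      positiveCone (Set.range (reflectionParts θ P)) := by
    have := positiveCone_const_mul (c := 1 / 2) (by norm_num)
      (positiveCone_add (positiveCone_mul (ha u) (hb v)) (positiveCone_mul (hb u) (ha v)))
    convert this using 2 with τ
    ring
  have h := reflection_positivity hρ hθ2 hP (w := fun _ => 1) (Tame.const sqSum_nonneg 1)
    (by simp) (by simp) (by simp) hf hQ (linearGrowth_pairEnergy L)
  simp only [mul_one] at h
  have hmp := (measurePreserving_sumPiEquivProdPi (ι := V) (ι' := V) (fun _ => ρ)).symm
  rw [← hmp.integral_comp'] at h
  have hint : ∀ (K : V → V → ℝ), Integrable (fun τ : V → ℝ => Real.exp (pairEnergy K τ))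
      (Measure.pi fun _ : V => ρ) := fun K =>
    (linearGrowth_pairEnergy K).tame_exp.integrable hρ.expGauge
  have hint2 : ∀ (K : V → V → ℝ), Integrable
      (fun τ : V → ℝ => τ u * τ v * Real.exp (pairEnergy K τ)) (Measure.pi fun _ : V => ρ) :=
    fun K => ((linearGrowth_mul u v).tame.mul
      (linearGrowth_pairEnergy K).tame_exp).integrable hρ.expGauge
  have hcalc : ∀ p : (V → ℝ) × (V → ℝ),
      (((MeasurableEquiv.sumPiEquivProdPi fun _ : V ⊕ V => ℝ).symm p) (Sum.inl u) *
        ((MeasurableEquiv.sumPiEquivProdPi fun _ : V ⊕ V => ℝ).symm p) (Sum.inl v) -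
        ((MeasurableEquiv.sumPiEquivProdPi fun _ : V ⊕ V => ℝ).symm p) (Sum.inr u) *
        ((MeasurableEquiv.sumPiEquivProdPi fun _ : V ⊕ V => ℝ).symm p) (Sum.inr v)) *
        Real.exp (pairEnergy L ((MeasurableEquiv.sumPiEquivProdPi fun _ : V ⊕ V => ℝ).symm p)) =
      (p.1 u * p.1 v * Real.exp (pairEnergy K' p.1)) * Real.exp (pairEnergy K p.2) -
      Real.exp (pairEnergy K' p.1) * (p.2 u * p.2 v * Real.exp (pairEnergy K p.2)) := by
    intro p
    rw [hE, Real.exp_add]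
    have e1 : ∀ x, (MeasurableEquiv.sumPiEquivProdPi fun _ : V ⊕ V => ℝ).symm p (Sum.inl x) =
      p.1 x := fun x => rfl
    have e2 : ∀ x, (MeasurableEquiv.sumPiEquivProdPi fun _ : V ⊕ V => ℝ).symm p (Sum.inr x) =
      p.2 x := fun x => rfl
    simp only [e1, e2]
    ring
  simp_rw [hcalc] at h
  rw [integral_sub ((hint2 K').mul_prod (hint K)) ((hint K').mul_prod (hint2 K)),
    integral_prod_mul (fun τ : V → ℝ => τ u * τ v * Real.exp (pairEnergy K' τ))
      (fun τ : V → ℝ => Real.exp (pairEnergy K τ)),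
    integral_prod_mul (fun τ : V → ℝ => Real.exp (pairEnergy K' τ))
      (fun τ : V → ℝ => τ u * τ v * Real.exp (pairEnergy K τ))] at h
  unfold gibbsMean
  rw [div_le_div_iff₀ (integral_exp_pairEnergy_pos hρ K) (integral_exp_pairEnergy_pos hρ K')]
  linarith

/-- The Messager-Miracle-Solé inequality for a reflection `θ` such that only mirror pairs interact
across the mirror. -/
theorem gibbsMean_mul_reflection_le (hρ : EvenSubgaussian ρ) {K : V → V → ℝ}
    (hK : ∀ x y, 0 ≤ K x y) {θ : Equiv.Perm V} {P : V → Prop} (hθ : ∀ v, θ (θ v) = v)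
    (hP : ∀ v, P v → ¬ P (θ v)) (hcover : ∀ v, P v ∨ P (θ v) ∨ θ v = v)
    (hKθ : ∀ x y, K (θ x) (θ y) = K x y)
    (hKP : ∀ x y, P x → P (θ y) → y ≠ θ x → K x y = 0 ∧ K y x = 0) {u v : V}
    (hu : P u ∨ θ u = u) (hv : P v ∨ θ v = v) :
    gibbsMean ρ K (fun τ => τ u * τ (θ v)) ≤ gibbsMean ρ K (fun τ => τ u * τ v) := by
  classical
  set a : V → (V → ℝ) → ℝ := fun x τ => τ x + τ (θ x) with ha
  set b : V → (V → ℝ) → ℝ := fun x τ => τ x - τ (θ x) with hb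
  -- The energy is split into even parts a and odd parts b. Mixed products cancel by the
  -- θ-invariance of K. Products b_x b_y on one side are in the cone, but a mirror pair contributes
  -- -K b²/4, which is not. These terms form the weight w, invariant under the symmetries because it
  -- depends on squares of odd parts only.
  set Q : (V → ℝ) → ℝ := fun τ => (∑ x, ∑ y, K x y / 4 * (a x τ * a y τ)) +
    ∑ x, ∑ y, (if y = θ x then 0 else K x y / 4 * (b x τ * b y τ)) with hQdef
  set w : (V → ℝ) → ℝ := fun τ => Real.exp (-∑ x, K x (θ x) / 4 * b x τ ^ 2) with hwdef
  have hba : ∀ x τ, b (θ x) τ = -b x τ := fun x τ => by simp [hb, hθ]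
  have haa : ∀ x τ, a (θ x) τ = a x τ := fun x τ => by simp [ha, hθ, add_comm]
  have hcross : ∀ τ, ∑ x, ∑ y, K x y * (a x τ * b y τ) = 0 := by
    intro τ
    have h : ∑ x, ∑ y, K x y * (a x τ * b y τ) = ∑ x, ∑ y, -(K x y * (a x τ * b y τ)) := by
      rw [← Equiv.sum_comp θ]
      refine Finset.sum_congr rfl fun x _ => ?_
      rw [← Equiv.sum_comp θ]
      refine Finset.sum_congr rfl fun y _ => ?_
      rw [hKθ, haa, hba]; ring
    simp only [Finset.sum_neg_distrib] at h
    linarith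
  have hcross' : ∀ τ, ∑ x, ∑ y, K x y * (b x τ * a y τ) = 0 := by
    intro τ
    have h : ∑ x, ∑ y, K x y * (b x τ * a y τ) = ∑ x, ∑ y, -(K x y * (b x τ * a y τ)) := by
      rw [← Equiv.sum_comp θ]
      refine Finset.sum_congr rfl fun x _ => ?_
      rw [← Equiv.sum_comp θ]
      refine Finset.sum_congr rfl fun y _ => ?_
      rw [hKθ, haa, hba]; ring
    simp only [Finset.sum_neg_distrib] at h
    linarith
  have hsplit : ∀ τ, Real.exp (pairEnergy K τ) = Real.exp (Q τ) * w τ := by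
    intro τ
    rw [hwdef, ← Real.exp_add]
    congr 1
    have h1 : pairEnergy K τ = (∑ x, ∑ y, K x y / 4 * (a x τ * a y τ)) +
        (∑ x, ∑ y, K x y / 4 * (b x τ * b y τ)) +
        1 / 4 * ∑ x, ∑ y, K x y * (a x τ * b y τ) +
        1 / 4 * ∑ x, ∑ y, K x y * (b x τ * a y τ) := by
      simp only [pairEnergy, Finset.mul_sum, ← Finset.sum_add_distrib]
      refine Finset.sum_congr rfl fun x _ => Finset.sum_congr rfl fun y _ => ?_
      simp only [ha, hb]; ring
    have h2 : ∑ x, ∑ y, K x y / 4 * (b x τ * b y τ) =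
        (∑ x, ∑ y, (if y = θ x then 0 else K x y / 4 * (b x τ * b y τ))) +
        -∑ x, K x (θ x) / 4 * b x τ ^ 2 := by
      rw [← Finset.sum_neg_distrib, ← Finset.sum_add_distrib]
      refine Finset.sum_congr rfl fun x _ => ?_
      rw [← Finset.sum_erase_add _ _ (Finset.mem_univ (θ x)),
        ← Finset.sum_erase_add _ (fun y => if y = θ x then 0 else K x y / 4 * (b x τ * b y τ))
          (Finset.mem_univ (θ x))]
      rw [Finset.sum_congr rfl fun y hy => (if_neg (Finset.ne_of_mem_erase hy)).symm, hba]
      simp only [if_true]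
      ring
    rw [h1, hcross, hcross', h2]
    simp only [hQdef]; ring
  have hac : ∀ x, a x ∈ positiveCone (Set.range (reflectionParts θ P)) :=
    fun x => add_mem_reflectionCone hθ hcover x
  have hbc : ∀ x, (P x ∨ θ x = x) → b x ∈ positiveCone (Set.range (reflectionParts θ P)) :=
    fun x hx => sub_mem_reflectionCone hx
  have hQc : Q ∈ positiveCone (Set.range (reflectionParts θ P)) := by
    refine positiveCone_add (positiveCone_sum _ fun x _ => positiveCone_sum _ fun y _ =>
      positiveCone_const_mul (by linarith [hK x y]) (positiveCone_mul (hac x) (hac y)))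
      (positiveCone_sum _ fun x _ => positiveCone_sum _ fun y _ => ?_)
    have hzero : (fun _ : V → ℝ => (0 : ℝ)) ∈ positiveCone (Set.range (reflectionParts θ P)) :=
      const_mem_positiveCone le_rfl
    have hb0 : ∀ z, θ z = z → ∀ τ, b z τ = 0 := fun z hz τ => by simp [hb, hz]
    by_cases hxy : y = θ x
    · simpa [hxy] using hzero
    simp only [if_neg hxy]
    have h4 : 0 ≤ K x y / 4 := by linarith [hK x y]
    rcases hcover x with hx | hx | hx
    · rcases hcover y with hy | hy | hy
      · exact positiveCone_const_mul h4 (positiveCone_mul (hbc x (Or.inl hx)) (hbc y (Or.inl hy)))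
      · simpa [(hKP x y hx hy hxy).1] using hzero
      · simpa [hb0 y hy] using hzero
    · rcases hcover y with hy | hy | hy
      · have : x ≠ θ y := fun h => hxy (by rw [h, hθ])
        simpa [(hKP y x hy hx this).2] using hzero
      · have := positiveCone_const_mul h4
          (positiveCone_mul (hbc (θ x) (Or.inl hx)) (hbc (θ y) (Or.inl hy)))
        simpa [hba] using this
      · simpa [hb0 y hy] using hzero
    · simpa [hb0 x hx] using hzero
  have hbb : ∀ x y, LinearGrowth sqSum fun τ => b x τ * b y τ := by
    intro x y
    have := ((linearGrowth_mul x y).add (linearGrowth_mul (θ x) (θ y))).add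
      (((linearGrowth_mul x (θ y)).add (linearGrowth_mul (θ x) y)).const_mul (-1))
    convert this using 2 with τ
    simp only [hb]; ring
  have hwg : LinearGrowth sqSum fun τ => -∑ x, K x (θ x) / 4 * b x τ ^ 2 := by
    have := (LinearGrowth.sum sqSum_nonneg Finset.univ fun x _ =>
      (hbb x x).const_mul (K x (θ x) / 4)).const_mul (-1)
    convert this using 2 with τ
    simp only [neg_one_mul, sq]
  have hQg : LinearGrowth sqSum Q := by
    have := (linearGrowth_pairEnergy K).add (hwg.const_mul (-1))
    convert this using 2 with τ
    have h := hsplit τ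
    rw [hwdef, ← Real.exp_add, Real.exp_eq_exp] at h
    rw [h]; ring
  have hswap : ∀ x y τ, b y (fun z => τ (Equiv.swap x (θ x) z)) ^ 2 = b y τ ^ 2 := by
    intro x y τ
    simp only [hb]
    by_cases h1 : y = x
    · simp only [h1, Equiv.swap_apply_left, Equiv.swap_apply_right]; ring
    by_cases h2 : y = θ x
    · simp only [h2, hθ, Equiv.swap_apply_left, Equiv.swap_apply_right]; ring
    have h3 : θ y ≠ x := fun h => h2 (by rw [← h, hθ])
    have h4 : θ y ≠ θ x := fun h => h1 (θ.injective h)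
    rw [Equiv.swap_apply_of_ne_of_ne h1 h2, Equiv.swap_apply_of_ne_of_ne h3 h4]
  have hneg : ∀ x y (τ : V → ℝ),
      b y (fun z => (if z = x ∨ z = θ x then -1 else 1) * τ z) ^ 2 = b y τ ^ 2 := by
    intro x y τ
    simp only [hb]
    by_cases h1 : y = x
    · simp [h1]; ring
    by_cases h2 : y = θ x
    · simp [h2, hθ]; ring
    have h3 : θ y ≠ x := fun h => h2 (by rw [← h, hθ])
    have h4 : θ y ≠ θ x := fun h => h1 (θ.injective h)
    simp [h1, h2, h3, h4]
  have hw1 : ∀ x τ, w (fun z => τ (Equiv.swap x (θ x) z)) = w τ := fun x τ => by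
    simp only [hwdef, hswap]
  have hw2 : ∀ x τ, w (fun z => (if z = x ∨ z = θ x then -1 else 1) *
      τ (Equiv.swap x (θ x) z)) = w τ := fun x τ => by
    simp only [hwdef]
    simp_rw [hneg x _ (fun z => τ (Equiv.swap x (θ x) z)), hswap]
  -- Since a_u + b_u = 2τ_u, this is τ_u(τ_v - τ_{θ v}), whose mean is the difference to be shown
  -- nonnegative.
  have hf : (fun τ : V → ℝ => 1 / 2 * ((a u τ + b u τ) * b v τ)) ∈
      positiveCone (Set.range (reflectionParts θ P)) :=
    positiveCone_const_mul (by norm_num)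
      (positiveCone_mul (positiveCone_add (hac u) (hbc u hu)) (hbc v hv))
  have h := reflection_positivity hρ hθ hP hwg.tame_exp (fun τ => (Real.exp_pos _).le) hw1 hw2
    hf hQc hQg
  have e : ∀ τ : V → ℝ, 1 / 2 * ((a u τ + b u τ) * b v τ) * Real.exp (Q τ) *
      Real.exp (-∑ x, K x (θ x) / 4 * b x τ ^ 2) =
      τ u * τ v * Real.exp (pairEnergy K τ) - τ u * τ (θ v) * Real.exp (pairEnergy K τ) := by
    intro τ
    rw [hsplit]
    simp only [hwdef, ha, hb]
    ring
  simp_rw [e] at h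
  have hint : ∀ x y : V, Integrable
      (fun τ : V → ℝ => τ x * τ y * Real.exp (pairEnergy K τ)) (Measure.pi fun _ : V => ρ) :=
    fun x y => ((linearGrowth_mul x y).tame.mul
      (linearGrowth_pairEnergy K).tame_exp).integrable hρ.expGauge
  rw [integral_sub (hint _ _) (hint _ _)] at h
  exact div_le_div_of_nonneg_right (by linarith) (integral_exp_pairEnergy_pos hρ K).le

end FiniteModel

end GSModel

namespace GSModel

/-! ### The Lebowitz inequality -/

/-- Four orthogonal linear forms in four real variables. -/
def quadPart (i : Fin 4) (p : (ℝ × ℝ) × (ℝ × ℝ)) : ℝ :=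
  ![p.1.1 + p.1.2 + p.2.1 + p.2.2, p.1.1 + p.1.2 - p.2.1 - p.2.2,
    p.1.1 - p.1.2 + p.2.1 - p.2.2, -p.1.1 + p.1.2 + p.2.1 - p.2.2] i

/-- The product of four copies of a single-site measure. -/
noncomputable def quadMeasure (ρ : Measure ℝ) : Measure ((ℝ × ℝ) × (ℝ × ℝ)) :=
  (ρ.prod ρ).prod (ρ.prod ρ)

/-- The Ellis-Monroe-Newman positivity condition on a single-site measure. -/
def QuadPositive (ρ : Measure ℝ) : Prop :=
  ∀ k : Fin 4 → ℕ, 0 ≤ ∫ p, ∏ i, quadPart i p ^ k i ∂(quadMeasure ρ)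

/-- The sum of the squares of four copies of the spins. -/
def quadSqSum {V : Type*} [Fintype V] (ω : V → (ℝ × ℝ) × (ℝ × ℝ)) : ℝ :=
  ∑ v, ((ω v).1.1 ^ 2 + (ω v).1.2 ^ 2 + ((ω v).2.1 ^ 2 + (ω v).2.2 ^ 2))

theorem measurable_quadPart (i : Fin 4) : Measurable (quadPart i) := by
  unfold quadPart
  fin_cases i <;> simp <;> fun_prop

section Monomials

variable {V : Type*} [Fintype V]

/-- Under a product measure a monomial factors into single-site monomials. -/
theorem integral_quad_monomial_nonneg {μ : Measure ((ℝ × ℝ) × (ℝ × ℝ))} [SigmaFinite μ]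
    (hμ : ∀ k : Fin 4 → ℕ, 0 ≤ ∫ p, ∏ i, quadPart i p ^ k i ∂μ)
    {m : (V → (ℝ × ℝ) × (ℝ × ℝ)) → ℝ}
    (hm : m ∈ Submonoid.closure (Set.range fun (x : V × Fin 4) (ω : V → (ℝ × ℝ) × (ℝ × ℝ)) =>
      quadPart x.2 (ω x.1))) :
    0 ≤ ∫ ω, m ω ∂(Measure.pi fun _ : V => μ) := by
  classical
  obtain ⟨k, rfl⟩ : ∃ k : V → Fin 4 → ℕ, m = fun ω => ∏ v, ∏ i, quadPart i (ω v) ^ k v i := by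
    induction hm using Submonoid.closure_induction with
    | mem y hy =>
      obtain ⟨x, rfl⟩ := hy
      refine ⟨fun v i => if v = x.1 then if i = x.2 then 1 else 0 else 0, ?_⟩
      ext ω
      rw [Finset.prod_eq_single x.1, Finset.prod_eq_single x.2] <;> simp +contextual
    | one => exact ⟨0, by ext; simp⟩
    | mul y z _ _ hy hz =>
      obtain ⟨k, rfl⟩ := hy
      obtain ⟨l, rfl⟩ := hz
      exact ⟨k + l, by ext ω; simp [pow_add, Finset.prod_mul_distrib]⟩
  rw [integral_fintype_prod_eq_prod (fun v p => ∏ i, quadPart i p ^ k v i)]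
  exact Finset.prod_nonneg fun v _ => hμ (k v)

end Monomials

/-- With a = Aw, b = Bw and c = ABw the integrand is (A₁ - A₂)(B₂ - B₁)w₁w₂. Its positivity is thus
the negative correlation ⟨AB⟩ ≤ ⟨A⟩⟨B⟩. -/
theorem integral_exchange {X : Type*} [MeasurableSpace X] {μ : Measure X} [SFinite μ]
    {a b c w : X → ℝ} (ha : Integrable a μ) (hb : Integrable b μ) (hc : Integrable c μ)
    (hw : Integrable w μ) :
    ∫ p : X × X, (a p.1 * b p.2 + b p.1 * a p.2 - (c p.1 * w p.2 + w p.1 * c p.2)) ∂(μ.prod μ) =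
      2 * ((∫ x, a x ∂μ) * (∫ x, b x ∂μ) - (∫ x, c x ∂μ) * ∫ x, w x ∂μ) := by
  have i1 := ha.mul_prod hb
  have i2 := hb.mul_prod ha
  have i3 := hc.mul_prod hw
  have i4 := hw.mul_prod hc
  have e1 : ∫ p : X × X, (a p.1 * b p.2 + b p.1 * a p.2) ∂(μ.prod μ) =
      ∫ p : X × X, a p.1 * b p.2 ∂(μ.prod μ) + ∫ p : X × X, b p.1 * a p.2 ∂(μ.prod μ) :=
    integral_add i1 i2
  have e2 : ∫ p : X × X, (c p.1 * w p.2 + w p.1 * c p.2) ∂(μ.prod μ) =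
      ∫ p : X × X, c p.1 * w p.2 ∂(μ.prod μ) + ∫ p : X × X, w p.1 * c p.2 ∂(μ.prod μ) :=
    integral_add i3 i4
  refine (integral_sub (i1.add i2) (i3.add i4)).trans ?_
  simp only [Pi.add_apply]
  rw [e1, e2, integral_prod_mul a b, integral_prod_mul b a, integral_prod_mul c w,
    integral_prod_mul w c]
  ring

section Lebowitz

variable {V : Type*} [Fintype V] {ρ : Measure ℝ} [IsProbabilityMeasure ρ]

instance : IsProbabilityMeasure (quadMeasure ρ) := by unfold quadMeasure; infer_instance

theorem EvenSubgaussian.expGauge_quad (hρ : EvenSubgaussian ρ) :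
    ExpGauge (Measure.pi fun _ : V => quadMeasure ρ) quadSqSum := by
  refine ⟨by unfold quadSqSum; fun_prop, fun ω => Finset.sum_nonneg fun _ _ => by positivity,
    fun C => ?_⟩
  have h1 := (hρ.integrable C).mul_prod (hρ.integrable C)
  have h2 := h1.mul_prod h1
  have h := (Integrable.fintype_prod (μ := fun _ : V => quadMeasure ρ) fun _ => h2).const_mul
      (Real.exp C)
  refine h.congr (Eventually.of_forall fun ω => ?_)
  simp only [quadSqSum, ← Real.exp_add]
  rw [← Real.exp_sum, ← Real.exp_add, mul_add, mul_one, Finset.mul_sum]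
  congr 2
  refine Finset.sum_congr rfl fun v _ => ?_
  ring

theorem quad_sq_le_quadSqSum (ω : V → (ℝ × ℝ) × (ℝ × ℝ)) (v : V) :
    (ω v).1.1 ^ 2 + (ω v).1.2 ^ 2 + ((ω v).2.1 ^ 2 + (ω v).2.2 ^ 2) ≤ quadSqSum ω :=
  Finset.single_le_sum
    (f := fun v => (ω v).1.1 ^ 2 + (ω v).1.2 ^ 2 + ((ω v).2.1 ^ 2 + (ω v).2.2 ^ 2))
    (fun _ _ => by positivity) (Finset.mem_univ v)

theorem quadPart_sq_le (i : Fin 4) (ω : V → (ℝ × ℝ) × (ℝ × ℝ)) (v : V) :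
    (1 / 2 * quadPart i (ω v)) ^ 2 ≤ quadSqSum ω := by
  refine le_trans ?_ (quad_sq_le_quadSqSum ω v)
  set a := (ω v).1.1
  set b := (ω v).1.2
  set c := (ω v).2.1
  set d := (ω v).2.2
  have key : ∀ x y z w : ℝ, (1 / 2 * (x + y + z + w)) ^ 2 ≤ x ^ 2 + y ^ 2 + (z ^ 2 + w ^ 2) := by
    intro x y z w
    nlinarith [sq_nonneg (x - y), sq_nonneg (x - z), sq_nonneg (x - w), sq_nonneg (y - z),
      sq_nonneg (y - w), sq_nonneg (z - w)]
  fin_cases i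
  · simpa [quadPart] using key a b c d
  · simpa [quadPart, sub_eq_add_neg] using key a b (-c) (-d)
  · simpa [quadPart, sub_eq_add_neg] using key a (-b) c (-d)
  · simpa [quadPart, sub_eq_add_neg] using key (-a) b c (-d)

/-- The four copies of a configuration. -/
def quadCopies (ω : V → (ℝ × ℝ) × (ℝ × ℝ)) : ((V → ℝ) × (V → ℝ)) × ((V → ℝ) × (V → ℝ)) :=
  ((fun v => (ω v).1.1, fun v => (ω v).1.2), (fun v => (ω v).2.1, fun v => (ω v).2.2))

theorem measurePreserving_quadCopies :
    MeasurePreserving quadCopies (Measure.pi fun _ : V => quadMeasure ρ)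
      (((Measure.pi fun _ : V => ρ).prod (Measure.pi fun _ : V => ρ)).prod
        ((Measure.pi fun _ : V => ρ).prod (Measure.pi fun _ : V => ρ))) := by
  have h1 := measurePreserving_arrowProdEquivProdArrow (ℝ × ℝ) (ℝ × ℝ) V
    (fun _ => ρ.prod ρ) (fun _ => ρ.prod ρ)
  have h2 := measurePreserving_arrowProdEquivProdArrow ℝ ℝ V (fun _ => ρ) (fun _ => ρ)
  exact (h2.prod h2).comp h1

theorem integral_mul_exp_pairEnergy_eq_zero_of_odd (hρ : EvenSubgaussian ρ) (K : V → V → ℝ)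
    {F : (V → ℝ) → ℝ} (hF : Measurable F) (hodd : ∀ τ, F (fun v => -τ v) = -F τ) :
    ∫ τ, F τ * Real.exp (pairEnergy K τ) ∂(Measure.pi fun _ : V => ρ) = 0 := by
  have hmp := measurePreserving_sign_perm (V := V) hρ (fun _ => -1) (fun _ => Or.inr rfl) 1
  have h : ∫ τ, F τ * Real.exp (pairEnergy K τ) ∂(Measure.pi fun _ : V => ρ) =
      ∫ τ : V → ℝ, F (fun v => -τ v) * Real.exp (pairEnergy K (fun v => -τ v))
        ∂(Measure.pi fun _ : V => ρ) := by
    conv_lhs => rw [← hmp.map_eq]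
    rw [integral_map (f := fun τ => F τ * Real.exp (pairEnergy K τ)) hmp.measurable.aemeasurable
      (hF.mul (linearGrowth_pairEnergy K).1.exp).aestronglyMeasurable]
    simp
  have h2 : ∀ τ : V → ℝ, pairEnergy K (fun v => -τ v) = pairEnergy K τ := fun τ => by
    simp [pairEnergy]
  simp_rw [hodd, h2, neg_mul, integral_neg] at h
  linarith

/-- Orthogonality of the four forms q_i makes the energy of four copies equal to ∑ K/4 ∑_i q_i(x)
q_i(y), an element of the cone. The first factor of the observable is (q₀q₁ + q₁q₀)/2 at a, b and
the second is (q₂q₃ + q₃q₂)/2 at c, d, so it lies in the cone as well. -/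
theorem ginibre_quad (hρ : EvenSubgaussian ρ) (hq : QuadPositive ρ) {K : V → V → ℝ}
    (hK : ∀ x y, 0 ≤ K x y) (a b c d : V) :
    0 ≤ ∫ p : ((V → ℝ) × (V → ℝ)) × ((V → ℝ) × (V → ℝ)),
      ((p.1.1 a + p.1.2 a) * (p.1.1 b + p.1.2 b) - (p.2.1 a + p.2.2 a) * (p.2.1 b + p.2.2 b)) *
      ((p.2.1 c - p.2.2 c) * (p.2.1 d - p.2.2 d) - (p.1.1 c - p.1.2 c) * (p.1.1 d - p.1.2 d)) *
      (Real.exp (pairEnergy K p.1.1) * Real.exp (pairEnergy K p.1.2) *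
        (Real.exp (pairEnergy K p.2.1) * Real.exp (pairEnergy K p.2.2)))
      ∂(((Measure.pi fun _ : V => ρ).prod (Measure.pi fun _ : V => ρ)).prod
        ((Measure.pi fun _ : V => ρ).prod (Measure.pi fun _ : V => ρ))) := by
  have hm : ∀ K : V → V → ℝ, Measurable (pairEnergy K) := fun K => (linearGrowth_pairEnergy K).1
  rw [← (measurePreserving_quadCopies (ρ := ρ)).map_eq, integral_map
    (measurePreserving_quadCopies (ρ := ρ)).measurable.aemeasurable
    (Measurable.aestronglyMeasurable (by
      have := hm K
      fun_prop))]
  set S := Set.range fun (x : V × Fin 4) (ω : V → (ℝ × ℝ) × (ℝ × ℝ)) => quadPart x.2 (ω x.1)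
  have hS : ∀ i v, (fun ω : V → (ℝ × ℝ) × (ℝ × ℝ) => quadPart i (ω v)) ∈ positiveCone S :=
    fun i v => mem_positiveCone ⟨(v, i), rfl⟩
  have hg := EvenSubgaussian.expGauge_quad (V := V) hρ
  have hlin : ∀ i v, LinearGrowth quadSqSum
      (fun ω : V → (ℝ × ℝ) × (ℝ × ℝ) => quadPart i (ω v)) := by
    intro i v
    have h := (LinearGrowth.of_sq_le_one (N := quadSqSum)
      (F := fun ω : V → (ℝ × ℝ) × (ℝ × ℝ) => 1 / 2 * quadPart i (ω v))
      (((measurable_quadPart i).comp (measurable_pi_apply v)).const_mul _)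
      fun ω => quadPart_sq_le i ω v).const_mul 2
    convert h using 2
    ring
  have hquad : ∀ i v j u, LinearGrowth quadSqSum
      (fun ω : V → (ℝ × ℝ) × (ℝ × ℝ) => quadPart i (ω v) * quadPart j (ω u)) := by
    intro i v j u
    have h := (LinearGrowth.of_sq_le (N := quadSqSum)
      (F := fun ω : V → (ℝ × ℝ) × (ℝ × ℝ) => 1 / 2 * quadPart i (ω v))
      (G := fun ω : V → (ℝ × ℝ) × (ℝ × ℝ) => 1 / 2 * quadPart j (ω u))
      (((measurable_quadPart i).comp (measurable_pi_apply v)).const_mul _)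
      (((measurable_quadPart j).comp (measurable_pi_apply u)).const_mul _)
      (fun ω => quadPart_sq_le i ω v) fun ω => quadPart_sq_le j ω u).const_mul 4
    convert h using 2
    ring
  have h := integral_mul_exp_nonneg (S := S) hg (w := fun _ => 1) (Tame.const hg.nonneg 1)
    (fun m hmS => ⟨?_, by
      simpa using integral_quad_monomial_nonneg (V := V) (μ := quadMeasure ρ) hq hmS⟩)
    (f := fun ω => 1 / 4 * ((quadPart 0 (ω a) * quadPart 1 (ω b) +
        quadPart 1 (ω a) * quadPart 0 (ω b)) *
      (quadPart 2 (ω c) * quadPart 3 (ω d) + quadPart 3 (ω c) * quadPart 2 (ω d))))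
    (positiveCone_const_mul (by norm_num) (positiveCone_mul
      (positiveCone_add (positiveCone_mul (hS _ _) (hS _ _)) (positiveCone_mul (hS _ _) (hS _ _)))
      (positiveCone_add (positiveCone_mul (hS _ _) (hS _ _))
        (positiveCone_mul (hS _ _) (hS _ _)))))
    (Q := fun ω => ∑ x, ∑ y, ∑ i, K x y / 4 * (quadPart i (ω x) * quadPart i (ω y)))
    (positiveCone_sum _ fun x _ => positiveCone_sum _ fun y _ => positiveCone_sum _ fun i _ =>
      positiveCone_const_mul (by linarith [hK x y]) (positiveCone_mul (hS _ _) (hS _ _)))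
    (LinearGrowth.sum hg.nonneg _ fun x _ => LinearGrowth.sum hg.nonneg _ fun y _ =>
      LinearGrowth.sum hg.nonneg _ fun i _ => (hquad i x i y).const_mul _)
  · refine h.trans_eq (integral_congr_ae (Eventually.of_forall fun ω => ?_))
    have hE : ∑ x, ∑ y, ∑ i, K x y / 4 * (quadPart i (ω x) * quadPart i (ω y)) =
        pairEnergy K (quadCopies ω).1.1 + pairEnergy K (quadCopies ω).1.2 +
        (pairEnergy K (quadCopies ω).2.1 + pairEnergy K (quadCopies ω).2.2) := by
      simp only [pairEnergy, ← Finset.sum_add_distrib]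
      refine Finset.sum_congr rfl fun x _ => Finset.sum_congr rfl fun y _ => ?_
      simp [Fin.sum_univ_four, quadPart, quadCopies]
      ring
    simp only [hE, Real.exp_add]
    simp [quadPart, quadCopies]
    ring
  · induction hmS using Submonoid.closure_induction with
    | mem y hy =>
      obtain ⟨x, rfl⟩ := hy
      exact (hlin x.2 x.1).tame
    | one => exact Tame.const hg.nonneg 1
    | mul y z _ _ hy hz => exact hy.mul hz

/-- This evaluates polynomials in two independent copies, after expansion into terms that separate
the copies. -/
theorem integral_bilinear (hρ : EvenSubgaussian ρ) (K : V → V → ℝ) {ι : Type*} [Fintype ι]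
    (c : ι → ℝ) (F G : ι → (V → ℝ) → ℝ) (hF : ∀ i, Tame sqSum (F i))
    (hG : ∀ i, Tame sqSum (G i)) :
    ∫ p : (V → ℝ) × (V → ℝ), (∑ i, c i * (F i p.1 * G i p.2)) *
        (Real.exp (pairEnergy K p.1) * Real.exp (pairEnergy K p.2))
        ∂((Measure.pi fun _ : V => ρ).prod (Measure.pi fun _ : V => ρ)) =
      ∑ i, c i * ((∫ τ, F i τ * Real.exp (pairEnergy K τ) ∂(Measure.pi fun _ : V => ρ)) *
        ∫ τ, G i τ * Real.exp (pairEnergy K τ) ∂(Measure.pi fun _ : V => ρ)) ∧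
    Integrable (fun p : (V → ℝ) × (V → ℝ) => (∑ i, c i * (F i p.1 * G i p.2)) *
        (Real.exp (pairEnergy K p.1) * Real.exp (pairEnergy K p.2)))
        ((Measure.pi fun _ : V => ρ).prod (Measure.pi fun _ : V => ρ)) := by
  have hint : ∀ {F : (V → ℝ) → ℝ}, Tame sqSum F →
      Integrable (fun τ => F τ * Real.exp (pairEnergy K τ)) (Measure.pi fun _ : V => ρ) :=
    fun h => (h.mul (linearGrowth_pairEnergy K).tame_exp).integrable hρ.expGauge
  have e : ∀ p : (V → ℝ) × (V → ℝ), (∑ i, c i * (F i p.1 * G i p.2)) *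
        (Real.exp (pairEnergy K p.1) * Real.exp (pairEnergy K p.2)) =
      ∑ i, c i * ((F i p.1 * Real.exp (pairEnergy K p.1)) *
        (G i p.2 * Real.exp (pairEnergy K p.2))) := by
    intro p
    rw [Finset.sum_mul]
    exact Finset.sum_congr rfl fun i _ => by ring
  have hi : ∀ i, Integrable (fun p : (V → ℝ) × (V → ℝ) =>
      c i * ((F i p.1 * Real.exp (pairEnergy K p.1)) * (G i p.2 * Real.exp (pairEnergy K p.2))))
      ((Measure.pi fun _ : V => ρ).prod (Measure.pi fun _ : V => ρ)) := fun i =>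
    ((hint (hF i)).mul_prod (hint (hG i))).const_mul (c i)
  simp_rw [e]
  refine ⟨?_, integrable_finsetSum _ fun i _ => hi i⟩
  rw [integral_finsetSum _ fun i _ => hi i]
  refine Finset.sum_congr rfl fun i _ => ?_
  rw [integral_const_mul, integral_prod_mul (fun τ => F i τ * Real.exp (pairEnergy K τ))
    (fun τ => G i τ * Real.exp (pairEnergy K τ))]

/-- The Lebowitz inequality. -/
theorem lebowitz (hρ : EvenSubgaussian ρ) (hq : QuadPositive ρ) {K : V → V → ℝ}
    (hK : ∀ x y, 0 ≤ K x y) (a b c d : V) :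
    gibbsMean ρ K (fun τ => τ a * τ b * (τ c * τ d)) ≤
      gibbsMean ρ K (fun τ => τ a * τ b) * gibbsMean ρ K (fun τ => τ c * τ d) +
      (gibbsMean ρ K (fun τ => τ a * τ c) * gibbsMean ρ K (fun τ => τ b * τ d) +
      gibbsMean ρ K (fun τ => τ a * τ d) * gibbsMean ρ K (fun τ => τ b * τ c)) := by
  have h := ginibre_quad hρ hq hK a b c d
  set π := Measure.pi fun _ : V => ρ with hπ
  set m : ((V → ℝ) → ℝ) → ℝ := fun F => ∫ τ, F τ * Real.exp (pairEnergy K τ) ∂π with hm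
  set A : (V → ℝ) × (V → ℝ) → ℝ := fun p => (p.1 a + p.2 a) * (p.1 b + p.2 b) with hA
  set B : (V → ℝ) × (V → ℝ) → ℝ := fun p => (p.1 c - p.2 c) * (p.1 d - p.2 d) with hB
  set W : (V → ℝ) × (V → ℝ) → ℝ := fun p =>
    Real.exp (pairEnergy K p.1) * Real.exp (pairEnergy K p.2) with hW
  have hodd1 : ∀ x, m (fun τ => τ x) = 0 := fun x =>
    integral_mul_exp_pairEnergy_eq_zero_of_odd hρ K (measurable_pi_apply x) fun τ => rfl
  have hsel : ∀ (s : Bool) (x : V), Tame sqSum fun τ : V → ℝ => if s then τ x else 1 := by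
    intro s x
    cases s
    · simpa using Tame.const sqSum_nonneg 1
    · simpa using (linearGrowth_coord x).tame
  have h1 := integral_bilinear hρ K (ι := Unit) (fun _ => 1) (fun _ _ => 1) (fun _ _ => 1)
    (fun _ => Tame.const sqSum_nonneg 1) (fun _ => Tame.const sqSum_nonneg 1)
  -- The index records from which copy each of the four spins is taken; c and d contribute a sign
  -- when taken from the second copy.
  have hAB := integral_bilinear hρ K (ι := (Bool × Bool) × (Bool × Bool))
    (fun s => (if s.2.1 then 1 else -1) * (if s.2.2 then 1 else -1))
    (fun s τ => (if s.1.1 then τ a else 1) * (if s.1.2 then τ b else 1) *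
      ((if s.2.1 then τ c else 1) * (if s.2.2 then τ d else 1)))
    (fun s τ => (if !s.1.1 then τ a else 1) * (if !s.1.2 then τ b else 1) *
      ((if !s.2.1 then τ c else 1) * (if !s.2.2 then τ d else 1)))
    (fun s => ((hsel _ _).mul (hsel _ _)).mul ((hsel _ _).mul (hsel _ _)))
    (fun s => ((hsel _ _).mul (hsel _ _)).mul ((hsel _ _).mul (hsel _ _)))
  have hAi := integral_bilinear hρ K (ι := Bool × Bool) (fun _ => 1)
    (fun s τ => (if s.1 then τ a else 1) * (if s.2 then τ b else 1))
    (fun s τ => (if !s.1 then τ a else 1) * (if !s.2 then τ b else 1))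
    (fun s => (hsel _ _).mul (hsel _ _)) (fun s => (hsel _ _).mul (hsel _ _))
  have hBi := integral_bilinear hρ K (ι := Bool × Bool)
    (fun s => (if s.1 then 1 else -1) * (if s.2 then 1 else -1))
    (fun s τ => (if s.1 then τ c else 1) * (if s.2 then τ d else 1))
    (fun s τ => (if !s.1 then τ c else 1) * (if !s.2 then τ d else 1))
    (fun s => (hsel _ _).mul (hsel _ _)) (fun s => (hsel _ _).mul (hsel _ _))
  have eAB : ∀ p : (V → ℝ) × (V → ℝ), ∑ s : (Bool × Bool) × (Bool × Bool),
      ((if s.2.1 then 1 else -1) * (if s.2.2 then 1 else -1) : ℝ) *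
      (((if s.1.1 then p.1 a else 1) * (if s.1.2 then p.1 b else 1) *
        ((if s.2.1 then p.1 c else 1) * (if s.2.2 then p.1 d else 1))) *
      ((if !s.1.1 then p.2 a else 1) * (if !s.1.2 then p.2 b else 1) *
        ((if !s.2.1 then p.2 c else 1) * (if !s.2.2 then p.2 d else 1)))) = A p * B p := by
    intro p
    simp [Fintype.sum_prod_type, hA, hB]
    ring
  have eA : ∀ p : (V → ℝ) × (V → ℝ), ∑ s : Bool × Bool, (1 : ℝ) *
      (((if s.1 then p.1 a else 1) * (if s.2 then p.1 b else 1)) *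
      ((if !s.1 then p.2 a else 1) * (if !s.2 then p.2 b else 1))) = A p := by
    intro p
    simp [Fintype.sum_prod_type, hA]
    ring
  have eB : ∀ p : (V → ℝ) × (V → ℝ), ∑ s : Bool × Bool,
      ((if s.1 then 1 else -1) * (if s.2 then 1 else -1) : ℝ) *
      (((if s.1 then p.1 c else 1) * (if s.2 then p.1 d else 1)) *
      ((if !s.1 then p.2 c else 1) * (if !s.2 then p.2 d else 1))) = B p := by
    intro p
    simp [Fintype.sum_prod_type, hB]
    ring
  simp only [eAB] at hAB
  simp only [eA] at hAi
  simp only [eB] at hBi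
  simp only [Finset.univ_unique, Finset.sum_const, Finset.card_singleton, one_smul, one_mul,
    mul_one] at h1
  obtain ⟨h1, h1i⟩ := h1
  obtain ⟨hAB, hABi⟩ := hAB
  obtain ⟨hAi, hAii⟩ := hAi
  obtain ⟨hBi, hBii⟩ := hBi
  set Z := ∫ τ, Real.exp (pairEnergy K τ) ∂π with hZ
  have hZpos : 0 < Z := integral_exp_pairEnergy_pos hρ K
  have e4 : ∀ p : ((V → ℝ) × (V → ℝ)) × ((V → ℝ) × (V → ℝ)),
      ((p.1.1 a + p.1.2 a) * (p.1.1 b + p.1.2 b) - (p.2.1 a + p.2.2 a) * (p.2.1 b + p.2.2 b)) *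
      ((p.2.1 c - p.2.2 c) * (p.2.1 d - p.2.2 d) - (p.1.1 c - p.1.2 c) * (p.1.1 d - p.1.2 d)) *
      (Real.exp (pairEnergy K p.1.1) * Real.exp (pairEnergy K p.1.2) *
        (Real.exp (pairEnergy K p.2.1) * Real.exp (pairEnergy K p.2.2))) =
      (A p.1 * W p.1) * (B p.2 * W p.2) + (B p.1 * W p.1) * (A p.2 * W p.2) -
      ((A p.1 * B p.1 * W p.1) * W p.2 + W p.1 * (A p.2 * B p.2 * W p.2)) := by
    intro p
    simp only [hA, hB, hW]
    ring
  simp_rw [e4] at h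
  -- In two independent copies this is ⟨AB⟩ ≤ ⟨A⟩⟨B⟩, where A is built from sums of the copies and B
  -- from differences.
  replace h := h.trans_eq (integral_exchange hAii hBii hABi h1i)
  have rA : ∫ p, A p * W p ∂(π.prod π) = 2 * Z * m (fun τ => τ a * τ b) := by
    have hh := hodd1
    simp only [hm, hπ] at hh
    rw [hAi]
    simp [Fintype.sum_prod_type, hm, hZ, hπ, hh]
    ring
  have rB : ∫ p, B p * W p ∂(π.prod π) = 2 * Z * m (fun τ => τ c * τ d) := by
    have hh := hodd1
    simp only [hm, hπ] at hh
    rw [hBi]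
    simp [Fintype.sum_prod_type, hm, hZ, hπ, hh]
    ring
  -- Terms with one spin in one copy and three in the other vanish by oddness. Of the pairings,
  -- those separating c from d carry the minus sign.
  have rAB : ∫ p, A p * B p * W p ∂(π.prod π) = 2 * Z * m (fun τ => τ a * τ b * (τ c * τ d)) +
      2 * (m (fun τ => τ a * τ b) * m (fun τ => τ c * τ d)) -
      2 * (m (fun τ => τ a * τ c) * m (fun τ => τ b * τ d)) -
      2 * (m (fun τ => τ a * τ d) * m (fun τ => τ b * τ c)) := by
    have hh := hodd1
    simp only [hm, hπ] at hh
    rw [hAB]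
    simp [Fintype.sum_prod_type, hm, hZ, hπ, hh]
    ring
  have r1 : ∫ p, W p ∂(π.prod π) = Z * Z := h1
  change 0 ≤ 2 * ((∫ p, A p * W p ∂(π.prod π)) * (∫ p, B p * W p ∂(π.prod π)) -
    (∫ p, A p * B p * W p ∂(π.prod π)) * ∫ p, W p ∂(π.prod π)) at h
  rw [rA, rB, rAB, r1] at h
  have key : m (fun τ => τ a * τ b * (τ c * τ d)) * Z ≤
      m (fun τ => τ a * τ b) * m (fun τ => τ c * τ d) +
      (m (fun τ => τ a * τ c) * m (fun τ => τ b * τ d) +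
      m (fun τ => τ a * τ d) * m (fun τ => τ b * τ c)) := by
    have hZ2 : 0 < 4 * (Z * Z) := by positivity
    refine le_of_mul_le_mul_left ?_ hZ2
    linarith
  change m _ / Z ≤ m _ / Z * (m _ / Z) + (m _ / Z * (m _ / Z) + m _ / Z * (m _ / Z))
  rw [div_mul_div_comm, div_mul_div_comm, div_mul_div_comm, ← add_div, ← add_div,
    div_le_div_iff₀ hZpos (by positivity)]
  nlinarith

end Lebowitz

end GSModel

namespace GSModel

/-! ### The Simon inequality -/

theorem hasDerivAt_integral_mul_exp {Ω : Type*} [MeasurableSpace Ω] {μ : Measure Ω}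
    {N F E Q : Ω → ℝ} (hN : ExpGauge μ N) (hF : Tame N F) (hE : LinearGrowth N E)
    (hQ : LinearGrowth N Q) (t : ℝ) :
    HasDerivAt (fun s : ℝ => ∫ ω, F ω * Real.exp (E ω + s * Q ω) ∂μ)
      (∫ ω, F ω * Q ω * Real.exp (E ω + t * Q ω) ∂μ) t := by
  have hexp : ∀ s : ℝ, Tame N fun ω => Real.exp (E ω + s * Q ω) := fun s =>
    (hE.add (hQ.const_mul s)).tame_exp
  refine (hasDerivAt_integral_of_dominated_loc_of_deriv_le (Metric.ball_mem_nhds t one_pos)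
    (F' := fun s ω => F ω * Q ω * Real.exp (E ω + s * Q ω))
    (bound := fun ω => |F ω| * |Q ω| * Real.exp (|E ω| + (|t| + 1) * |Q ω|))
    (Eventually.of_forall fun s => (hF.mul (hexp s)).1.aestronglyMeasurable)
    ((hF.mul (hexp t)).integrable hN)
    ((hF.mul hQ.tame).mul (hexp t)).1.aestronglyMeasurable ?_
    (((hF.abs.mul hQ.abs.tame).mul
      (hE.abs.add (hQ.abs.const_mul (|t| + 1))).tame_exp).integrable hN) ?_).2
  · refine Eventually.of_forall fun ω s hs => ?_
    rw [Real.norm_eq_abs, abs_mul, abs_mul, abs_of_pos (Real.exp_pos _)]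
    have hs' : |s| ≤ |t| + 1 := by
      rw [Metric.mem_ball, Real.dist_eq] at hs
      have := abs_add_le (s - t) t
      rw [sub_add_cancel] at this
      linarith
    have h1 : s * Q ω ≤ (|t| + 1) * |Q ω| := (le_abs_self _).trans (by rw [abs_mul]; gcongr)
    have h2 := le_abs_self (E ω)
    gcongr
  · refine Eventually.of_forall fun ω s _ => ?_
    have h := (((hasDerivAt_id s).mul_const (Q ω)).const_add (E ω)).exp.const_mul (F ω)
    refine h.congr_deriv ?_
    simp only [id]; ring

section Simon

variable {V : Type*} [Fintype V] {ρ : Measure ℝ} [IsProbabilityMeasure ρ]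

theorem pairEnergy_add_mul (K D : V → V → ℝ) (t : ℝ) (τ : V → ℝ) :
    pairEnergy (fun x y => K x y + t * D x y) τ = pairEnergy K τ + t * pairEnergy D τ := by
  simp only [pairEnergy, Finset.mul_sum, ← Finset.sum_add_distrib]
  refine Finset.sum_congr rfl fun x _ => Finset.sum_congr rfl fun y _ => ?_
  ring

/-- Derivative of a two-point function in the couplings. -/
theorem hasDerivAt_gibbsMean (hρ : EvenSubgaussian ρ) (K D : V → V → ℝ) (u v : V) (t : ℝ) :
    HasDerivAt (fun s : ℝ => gibbsMean ρ (fun x y => K x y + s * D x y) fun τ => τ u * τ v)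
      (∑ x, ∑ y, D x y *
        (gibbsMean ρ (fun x y => K x y + t * D x y) (fun τ => τ u * τ v * (τ x * τ y)) -
          gibbsMean ρ (fun x y => K x y + t * D x y) (fun τ => τ u * τ v) *
            gibbsMean ρ (fun x y => K x y + t * D x y) (fun τ => τ x * τ y))) t := by
  have hK := linearGrowth_pairEnergy K
  have hD := linearGrowth_pairEnergy D
  have hZ : (∫ τ, Real.exp (pairEnergy K τ + t * pairEnergy D τ) ∂(Measure.pi fun _ : V => ρ)) ≠ 0 := by
    have := integral_exp_pairEnergy_pos hρ (fun x y => K x y + t * D x y)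
    simp_rw [pairEnergy_add_mul] at this
    exact this.ne'
  have h1 := hasDerivAt_integral_mul_exp hρ.expGauge (linearGrowth_mul u v).tame hK hD t
  have h2 := hasDerivAt_integral_mul_exp hρ.expGauge (Tame.const sqSum_nonneg 1) hK hD t
  simp only [one_mul] at h2
  have h := h1.div h2 hZ
  have hint : ∀ {F : (V → ℝ) → ℝ}, Tame sqSum F →
      Integrable (fun τ => F τ * Real.exp (pairEnergy K τ + t * pairEnergy D τ))
        (Measure.pi fun _ : V => ρ) :=
    fun h => (h.mul (hK.add (hD.const_mul t)).tame_exp).integrable hρ.expGauge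
  have hexpand : ∀ {F : (V → ℝ) → ℝ}, Tame sqSum F →
      ∫ τ, F τ * pairEnergy D τ * Real.exp (pairEnergy K τ + t * pairEnergy D τ)
        ∂(Measure.pi fun _ : V => ρ) =
      ∑ x, ∑ y, D x y * ∫ τ, F τ * (τ x * τ y) *
        Real.exp (pairEnergy K τ + t * pairEnergy D τ) ∂(Measure.pi fun _ : V => ρ) := by
    intro F hF
    have e : ∀ τ : V → ℝ, F τ * pairEnergy D τ * Real.exp (pairEnergy K τ + t * pairEnergy D τ) =
        ∑ x, ∑ y, D x y * (F τ * (τ x * τ y) *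
          Real.exp (pairEnergy K τ + t * pairEnergy D τ)) := by
      intro τ
      generalize Real.exp (pairEnergy K τ + t * pairEnergy D τ) = r
      simp only [pairEnergy, Finset.mul_sum, Finset.sum_mul]
      refine Finset.sum_congr rfl fun x _ => Finset.sum_congr rfl fun y _ => ?_
      ring
    have hi : ∀ x y, Integrable (fun τ : V → ℝ => D x y * (F τ * (τ x * τ y) *
        Real.exp (pairEnergy K τ + t * pairEnergy D τ))) (Measure.pi fun _ : V => ρ) :=
      fun x y => (hint (hF.mul (linearGrowth_mul x y).tame)).const_mul _
    simp_rw [e]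
    rw [integral_finsetSum _ fun x _ => integrable_finsetSum _ fun y _ => hi x y]
    refine Finset.sum_congr rfl fun x _ => ?_
    rw [integral_finsetSum _ fun y _ => hi x y]
    exact Finset.sum_congr rfl fun y _ => integral_const_mul _ _
  have e1 := hexpand (linearGrowth_mul u v).tame
  have e2 := hexpand (F := fun _ => 1) (Tame.const sqSum_nonneg 1)
  simp only [one_mul] at e2
  rw [e1, e2] at h
  unfold gibbsMean
  simp_rw [pairEnergy_add_mul]
  refine h.congr_deriv ?_
  rw [div_eq_iff (pow_ne_zero 2 hZ)]
  simp only [Finset.sum_mul, Finset.mul_sum, ← Finset.sum_sub_distrib]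
  refine Finset.sum_congr rfl fun x _ => Finset.sum_congr rfl fun y _ => ?_
  field_simp

/-- Increasing the couplings by `D` increases two-point functions by at most the sum over `D` of
products of two-point functions. -/
theorem gibbsMean_add_le (hρ : EvenSubgaussian ρ) (hq : QuadPositive ρ) {K D : V → V → ℝ}
    (hK : ∀ x y, 0 ≤ K x y) (hD : ∀ x y, 0 ≤ D x y) (u v : V) :
    gibbsMean ρ (fun x y => K x y + D x y) (fun τ => τ u * τ v) ≤
      gibbsMean ρ K (fun τ => τ u * τ v) + ∑ x, ∑ y, D x y *
        (gibbsMean ρ (fun x y => K x y + D x y) (fun τ => τ u * τ x) *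
          gibbsMean ρ (fun x y => K x y + D x y) (fun τ => τ v * τ y) +
        gibbsMean ρ (fun x y => K x y + D x y) (fun τ => τ u * τ y) *
          gibbsMean ρ (fun x y => K x y + D x y) (fun τ => τ v * τ x)) := by
  -- Interpolation K + tD for t in [0, 1]. By the Lebowitz inequality the truncated four-point
  -- function in the derivative is at most ⟨ux⟩⟨vy⟩ + ⟨uy⟩⟨vx⟩, and by the second Griffiths
  -- inequality these factors are largest at t = 1. The mean value inequality concludes.
  set f : ℝ → ℝ := fun s => gibbsMean ρ (fun x y => K x y + s * D x y) fun τ => τ u * τ v with hf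
  have hderiv := hasDerivAt_gibbsMean hρ K D u v
  have hmain := Convex.image_sub_le_mul_sub_of_deriv_le (convex_Icc (0 : ℝ) 1) (f := f)
    (fun t _ => (hderiv t).continuousAt.continuousWithinAt)
    (fun t _ => (hderiv t).differentiableAt.differentiableWithinAt)
    (C := ∑ x, ∑ y, D x y *
        (gibbsMean ρ (fun x y => K x y + D x y) (fun τ => τ u * τ x) *
          gibbsMean ρ (fun x y => K x y + D x y) (fun τ => τ v * τ y) +
        gibbsMean ρ (fun x y => K x y + D x y) (fun τ => τ u * τ y) *
          gibbsMean ρ (fun x y => K x y + D x y) (fun τ => τ v * τ x))) ?_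
    0 (by simp) 1 (by simp) zero_le_one
  · simp only [hf, zero_mul, add_zero, one_mul, sub_zero, mul_one] at hmain
    linarith
  · intro t ht
    rw [interior_Icc] at ht
    rw [(hderiv t).deriv]
    refine Finset.sum_le_sum fun x _ => Finset.sum_le_sum fun y _ =>
      mul_le_mul_of_nonneg_left ?_ (hD x y)
    have hKt : ∀ x y, 0 ≤ K x y + t * D x y := fun x y =>
      add_nonneg (hK x y) (mul_nonneg ht.1.le (hD x y))
    have hmono : ∀ a b : V, gibbsMean ρ (fun x y => K x y + t * D x y) (fun τ => τ a * τ b) ≤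
        gibbsMean ρ (fun x y => K x y + D x y) (fun τ => τ a * τ b) := fun a b =>
      gibbsMean_mul_mono hρ hKt
        (fun x y => by nlinarith [hD x y, ht.2]) a b
    have hnn : ∀ a b : V, 0 ≤ gibbsMean ρ (fun x y => K x y + t * D x y) (fun τ => τ a * τ b) :=
      fun a b => gibbsMean_mul_nonneg hρ hKt a b
    have hleb := lebowitz hρ hq hKt u v x y
    have h1 := mul_le_mul (hmono u x) (hmono v y) (hnn v y) ((hnn u x).trans (hmono u x))
    have h2 := mul_le_mul (hmono u y) (hmono v x) (hnn v x) ((hnn u y).trans (hmono u y))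
    linarith

/-- Flipping all spins in P preserves the Gibbs weight and negates τ_u τ_v. -/
theorem gibbsMean_eq_zero_of_decoupled (hρ : EvenSubgaussian ρ) {K : V → V → ℝ} {P : V → Prop}
    (hK : ∀ x y, P x → ¬ P y → K x y = 0 ∧ K y x = 0) {u v : V} (hu : P u) (hv : ¬ P v) :
    gibbsMean ρ K (fun τ => τ u * τ v) = 0 := by
  classical
  have hmp := measurePreserving_sign_perm (V := V) hρ (fun x => if P x then -1 else 1)
    (fun x => by split_ifs <;> simp) 1
  have h : ∫ τ, τ u * τ v * Real.exp (pairEnergy K τ) ∂(Measure.pi fun _ : V => ρ) =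
      ∫ τ : V → ℝ, -(τ u * τ v * Real.exp (pairEnergy K τ)) ∂(Measure.pi fun _ : V => ρ) := by
    conv_lhs => rw [← hmp.map_eq]
    rw [integral_map (f := fun τ : V → ℝ => τ u * τ v * Real.exp (pairEnergy K τ))
      hmp.measurable.aemeasurable
      ((linearGrowth_mul u v).1.mul (linearGrowth_pairEnergy K).1.exp).aestronglyMeasurable]
    congr 1
    funext τ
    have hE : pairEnergy K (fun x => (if P x then -1 else 1) * τ x) = pairEnergy K τ := by
      unfold pairEnergy
      refine Finset.sum_congr rfl fun x _ => Finset.sum_congr rfl fun y _ => ?_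
      by_cases hx : P x <;> by_cases hy : P y
      · simp [hx, hy]
      · simp [(hK x y hx hy).1]
      · simp [(hK y x hy hx).2]
      · simp [hx, hy]
    simp only [Equiv.Perm.coe_one, id, hE]
    simp [hu, hv]
  rw [integral_neg] at h
  rw [gibbsMean, div_eq_zero_iff]
  left
  linarith

end Simon

end GSModel

namespace GSModel

/-! ### Moments of single-site measures -/

theorem ExpGauge.prod {X Y : Type*} [MeasurableSpace X] [MeasurableSpace Y] {μ : Measure X}
    {ν : Measure Y} [SFinite μ] [SFinite ν] {N : X → ℝ} {N' : Y → ℝ} (h : ExpGauge μ N)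
    (h' : ExpGauge ν N') : ExpGauge (μ.prod ν) fun p => N p.1 + N' p.2 := by
  refine ⟨(h.measurable.comp measurable_fst).add (h'.measurable.comp measurable_snd),
    fun p => add_nonneg (h.nonneg _) (h'.nonneg _), fun C => ?_⟩
  have := ((h.integrable C).mul_prod (h'.integrable C)).const_mul (Real.exp (-C))
  refine this.congr (Eventually.of_forall fun p => ?_)
  simp only [← Real.exp_add]
  ring_nf

theorem EvenSubgaussian.expGauge_sq {ρ : Measure ℝ} (hρ : EvenSubgaussian ρ) :
    ExpGauge ρ fun x => x ^ 2 := by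
  refine ⟨by fun_prop, fun x => sq_nonneg x, fun C => ?_⟩
  refine ((hρ.integrable C).const_mul (Real.exp C)).congr (Eventually.of_forall fun x => ?_)
  simp only [← Real.exp_add]
  ring_nf

section Moments

variable {ρ : Measure ℝ} [IsProbabilityMeasure ρ]

theorem EvenSubgaussian.integrable_pow (hρ : EvenSubgaussian ρ) (n : ℕ) :
    Integrable (fun x => x ^ n) ρ :=
  ((LinearGrowth.of_sq_le_one (N := fun x : ℝ => x ^ 2) measurable_id fun _ => le_rfl).tame.pow
    (fun x => sq_nonneg x) n).integrable hρ.expGauge_sq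

theorem EvenSubgaussian.expGauge_pair (hρ : EvenSubgaussian ρ) :
    ExpGauge (ρ.prod ρ) fun p => p.1 ^ 2 + p.2 ^ 2 := hρ.expGauge_sq.prod hρ.expGauge_sq

theorem EvenSubgaussian.expGauge_quadMeasure (hρ : EvenSubgaussian ρ) :
    ExpGauge (quadMeasure ρ) fun p => p.1.1 ^ 2 + p.1.2 ^ 2 + (p.2.1 ^ 2 + p.2.2 ^ 2) :=
  hρ.expGauge_pair.prod hρ.expGauge_pair

theorem tame_quadPart (i : Fin 4) :
    Tame (fun p : (ℝ × ℝ) × (ℝ × ℝ) => p.1.1 ^ 2 + p.1.2 ^ 2 + (p.2.1 ^ 2 + p.2.2 ^ 2))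
      (quadPart i) := by
  have h := (LinearGrowth.of_sq_le_one
    (N := fun p : (ℝ × ℝ) × (ℝ × ℝ) => p.1.1 ^ 2 + p.1.2 ^ 2 + (p.2.1 ^ 2 + p.2.2 ^ 2))
    ((measurable_quadPart i).const_mul (1 / 2)) fun p => ?_).const_mul 2
  · have h2 := h.tame
    convert h2 using 2
    ring
  · simpa [quadSqSum] using quadPart_sq_le (V := Unit) i (fun _ => p) ()

theorem QuadPositive.integral_nonneg (hρ : EvenSubgaussian ρ) (hq : QuadPositive ρ)
    {f : (ℝ × ℝ) × (ℝ × ℝ) → ℝ} (hf : f ∈ positiveCone (Set.range quadPart)) :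
    0 ≤ ∫ p, f p ∂(quadMeasure ρ) := by
  have hg := hρ.expGauge_quadMeasure
  have := (tame_and_integral_nonneg_of_mem_positiveCone hg (w := fun _ => 1)
    (Tame.const hg.nonneg 1) (fun m hm => ?_) hf).2
  · simpa using this
  · obtain ⟨k, rfl⟩ : ∃ k : Fin 4 → ℕ, m = fun p => ∏ i, quadPart i p ^ k i := by
      induction hm using Submonoid.closure_induction with
      | mem y hy =>
        obtain ⟨i, rfl⟩ := hy
        refine ⟨fun j => if j = i then 1 else 0, ?_⟩
        ext p
        rw [Finset.prod_eq_single i] <;> simp +contextual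
      | one => exact ⟨0, by ext; simp⟩
      | mul y z _ _ hy hz =>
        obtain ⟨k, rfl⟩ := hy
        obtain ⟨l, rfl⟩ := hz
        exact ⟨k + l, by ext p; simp [pow_add, Finset.prod_mul_distrib]⟩
    refine ⟨Tame.prod hg.nonneg _ fun i _ => (tame_quadPart i).pow hg.nonneg _, ?_⟩
    simpa using hq k

/-- Both expansions have nonnegative coefficients in x and y. The induction needs the two together
because each recursion step mixes them. -/
theorem add_pow_sub_sub_pow_mem_positiveCone {Ω : Type*} {S : Set (Ω → ℝ)} {x y : Ω → ℝ}
    (hx : x ∈ positiveCone S) (hy : y ∈ positiveCone S) (n : ℕ) :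
    (fun ω => (x ω + y ω) ^ n - (x ω - y ω) ^ n) ∈ positiveCone S ∧
      (fun ω => (x ω + y ω) ^ n + (x ω - y ω) ^ n) ∈ positiveCone S := by
  induction n with
  | zero =>
    refine ⟨by simpa using const_mem_positiveCone (S := S) le_rfl, ?_⟩
    simpa using const_mem_positiveCone (S := S) (c := 1 + 1) (by norm_num)
  | succ n ih =>
    constructor
    · have := positiveCone_add (positiveCone_mul hx ih.1) (positiveCone_mul hy ih.2)
      convert this using 2
      ring
    · have := positiveCone_add (positiveCone_mul hx ih.2) (positiveCone_mul hy ih.1)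
      convert this using 2
      ring

theorem sub_pow_le_four_pow (x y : ℝ) (n : ℕ) :
    (x - y) ^ (2 * n) ≤ 4 ^ n * (x ^ (2 * n) + y ^ (2 * n)) := by
  have h1 : (x - y) ^ 2 ≤ 4 * max (x ^ 2) (y ^ 2) := by
    rcases le_total (x ^ 2) (y ^ 2) with h | h
    · rw [max_eq_right h]; nlinarith [sq_nonneg (x + y)]
    · rw [max_eq_left h]; nlinarith [sq_nonneg (x + y)]
  have h2 : max (x ^ 2) (y ^ 2) ^ n ≤ x ^ (2 * n) + y ^ (2 * n) := by
    have hx : 0 ≤ x ^ (2 * n) := by rw [pow_mul]; positivity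
    have hy : 0 ≤ y ^ (2 * n) := by rw [pow_mul]; positivity
    rcases le_total (x ^ 2) (y ^ 2) with h | h
    · rw [max_eq_right h, ← pow_mul]; linarith
    · rw [max_eq_left h, ← pow_mul]; linarith
  calc (x - y) ^ (2 * n) = ((x - y) ^ 2) ^ n := pow_mul _ _ _
    _ ≤ (4 * max (x ^ 2) (y ^ 2)) ^ n := by gcongr
    _ = 4 ^ n * max (x ^ 2) (y ^ 2) ^ n := mul_pow _ _ _
    _ ≤ _ := by gcongr

theorem pow_le_sub_pow_add_add_pow (x y : ℝ) (n : ℕ) :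
    x ^ (2 * n) ≤ (x - y) ^ (2 * n) + (x + y) ^ (2 * n) := by
  have h1 : 0 ≤ (x - y) ^ (2 * n) := by rw [pow_mul]; positivity
  have h2 : 0 ≤ (x + y) ^ (2 * n) := by rw [pow_mul]; positivity
  rcases le_total 0 (x * y) with h | h
  · have : x ^ (2 * n) ≤ (x + y) ^ (2 * n) := by
      rw [pow_mul, pow_mul]
      gcongr ?_ ^ n
      nlinarith [sq_nonneg y]
    linarith
  · have : x ^ (2 * n) ≤ (x - y) ^ (2 * n) := by
      rw [pow_mul, pow_mul]
      gcongr ?_ ^ n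
      nlinarith [sq_nonneg y]
    linarith

/-- The exchange argument again, now for a single site: (A₁ - A₂)(B₂ - B₁) with A = (x+y)² and B =
(x-y)^n. The first factor is q₀q₁, and the second is 2^{-n}((q₂+q₃)^n - (q₂-q₃)^n), which has
nonnegative coefficients. -/
theorem integral_sq_mul_pow_le (hρ : EvenSubgaussian ρ) (hq : QuadPositive ρ) (n : ℕ) :
    ∫ p : ℝ × ℝ, (p.1 + p.2) ^ 2 * (p.1 - p.2) ^ n ∂(ρ.prod ρ) ≤
      (∫ p : ℝ × ℝ, (p.1 + p.2) ^ 2 ∂(ρ.prod ρ)) * ∫ p : ℝ × ℝ, (p.1 - p.2) ^ n ∂(ρ.prod ρ) := by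
  have hg := hρ.expGauge_pair
  have t1 : Tame (fun p : ℝ × ℝ => p.1 ^ 2 + p.2 ^ 2) fun p => p.1 :=
    (LinearGrowth.of_sq_le_one (by fun_prop) fun p => by nlinarith [sq_nonneg p.2]).tame
  have t2 : Tame (fun p : ℝ × ℝ => p.1 ^ 2 + p.2 ^ 2) fun p => p.2 :=
    (LinearGrowth.of_sq_le_one (by fun_prop) fun p => by nlinarith [sq_nonneg p.1]).tame
  have tA := (t1.add hg.nonneg t2).pow hg.nonneg 2
  have tB := (t1.sub hg.nonneg t2).pow hg.nonneg n
  have hc : ∀ i, quadPart i ∈ positiveCone (Set.range quadPart) := fun i =>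
    mem_positiveCone ⟨i, rfl⟩
  have h := hq.integral_nonneg hρ (positiveCone_const_mul (c := (1 / 2) ^ n) (by positivity)
    (positiveCone_mul (positiveCone_mul (hc 0) (hc 1))
      (add_pow_sub_sub_pow_mem_positiveCone (hc 2) (hc 3) n).1))
  have e : ∀ p : (ℝ × ℝ) × (ℝ × ℝ), (1 / 2) ^ n * (quadPart 0 p * quadPart 1 p *
      ((quadPart 2 p + quadPart 3 p) ^ n - (quadPart 2 p - quadPart 3 p) ^ n)) =
      (p.1.1 + p.1.2) ^ 2 * (p.2.1 - p.2.2) ^ n + (p.1.1 - p.1.2) ^ n * (p.2.1 + p.2.2) ^ 2 -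
      ((p.1.1 + p.1.2) ^ 2 * (p.1.1 - p.1.2) ^ n * 1 +
        1 * ((p.2.1 + p.2.2) ^ 2 * (p.2.1 - p.2.2) ^ n)) := by
    intro p
    have e1 : quadPart 2 p + quadPart 3 p = 2 * (p.2.1 - p.2.2) := by simp [quadPart]; ring
    have e2 : quadPart 2 p - quadPart 3 p = 2 * (p.1.1 - p.1.2) := by simp [quadPart]; ring
    have e3 : quadPart 0 p * quadPart 1 p = (p.1.1 + p.1.2) ^ 2 - (p.2.1 + p.2.2) ^ 2 := by
      simp [quadPart]; ring
    have e4 : (1 / 2 : ℝ) ^ n * 2 ^ n = 1 := by rw [← mul_pow]; norm_num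
    rw [e1, e2, e3, mul_pow, mul_pow]
    linear_combination ((p.1.1 + p.1.2) ^ 2 - (p.2.1 + p.2.2) ^ 2) *
      ((p.2.1 - p.2.2) ^ n - (p.1.1 - p.1.2) ^ n) * e4
  simp_rw [e] at h
  have h' := h.trans_eq (integral_exchange (tA.integrable hg) (tB.integrable hg)
    ((tA.mul tB).integrable hg) (integrable_const (1 : ℝ)))
  simp only [integral_const, probReal_univ, smul_eq_mul, mul_one] at h'
  linarith

/-- A moment hierarchy extracted from the positivity condition; it makes the moments along a weakly
convergent sequence bounded. In the constant, 16 · 4^(n+1) is 4 · (2 · 4^(n+1)) from `hA` and `hB`,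
doubled by the symmetrisation y ↦ -y, and 2 comes from the cross term in `hlow`. -/
theorem moment_succ_le (hρ : EvenSubgaussian ρ) (hq : QuadPositive ρ) (n : ℕ) :
    ∫ x, x ^ (2 * (n + 2)) ∂ρ ≤
      (2 + 16 * 4 ^ (n + 1)) * ((∫ x, x ^ 2 ∂ρ) * ∫ x, x ^ (2 * (n + 1)) ∂ρ) := by
  have hg := hρ.expGauge_pair
  have t1 : Tame (fun p : ℝ × ℝ => p.1 ^ 2 + p.2 ^ 2) fun p => p.1 :=
    (LinearGrowth.of_sq_le_one (by fun_prop) fun p => by nlinarith [sq_nonneg p.2]).tame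
  have t2 : Tame (fun p : ℝ × ℝ => p.1 ^ 2 + p.2 ^ 2) fun p => p.2 :=
    (LinearGrowth.of_sq_le_one (by fun_prop) fun p => by nlinarith [sq_nonneg p.1]).tame
  have tsum := t1.add hg.nonneg t2
  have tsub := t1.sub hg.nonneg t2
  have hm1 : ∀ k : ℕ, ∫ p : ℝ × ℝ, p.1 ^ k ∂(ρ.prod ρ) = ∫ x, x ^ k ∂ρ := fun k => by
    simpa using integral_prod_mul (μ := ρ) (ν := ρ) (fun x : ℝ => x ^ k) fun _ => (1 : ℝ)
  have hm2 : ∀ k : ℕ, ∫ p : ℝ × ℝ, p.2 ^ k ∂(ρ.prod ρ) = ∫ x, x ^ k ∂ρ := fun k => by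
    simpa using integral_prod_mul (μ := ρ) (ν := ρ) (fun _ => (1 : ℝ)) fun x : ℝ => x ^ k
  have hi1 : ∀ k : ℕ, Integrable (fun p : ℝ × ℝ => p.1 ^ k) (ρ.prod ρ) := fun k =>
    (t1.pow hg.nonneg k).integrable hg
  have hi2 : ∀ k : ℕ, Integrable (fun p : ℝ × ℝ => p.2 ^ k) (ρ.prod ρ) := fun k =>
    (t2.pow hg.nonneg k).integrable hg
  have hm0 : ∀ k : ℕ, 0 ≤ ∫ x, x ^ (2 * k) ∂ρ := fun k =>
    MeasureTheory.integral_nonneg fun x => by simp only [Pi.zero_apply]; rw [pow_mul]; positivity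
  have hA : ∫ p : ℝ × ℝ, (p.1 + p.2) ^ 2 ∂(ρ.prod ρ) ≤ 4 * ∫ x, x ^ 2 ∂ρ := by
    have : ∫ p : ℝ × ℝ, (p.1 + p.2) ^ 2 ∂(ρ.prod ρ) ≤
        ∫ p : ℝ × ℝ, (2 * p.1 ^ 2 + 2 * p.2 ^ 2) ∂(ρ.prod ρ) :=
      integral_mono ((tsum.pow hg.nonneg 2).integrable hg)
        (((hi1 2).const_mul 2).add ((hi2 2).const_mul 2))
        fun p => by dsimp only; nlinarith [sq_nonneg (p.1 - p.2)]
    rw [integral_add ((hi1 2).const_mul 2) ((hi2 2).const_mul 2), integral_const_mul,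
      integral_const_mul, hm1, hm2] at this
    linarith
  have hB : ∫ p : ℝ × ℝ, (p.1 - p.2) ^ (2 * (n + 1)) ∂(ρ.prod ρ) ≤
      2 * 4 ^ (n + 1) * ∫ x, x ^ (2 * (n + 1)) ∂ρ := by
    have : ∫ p : ℝ × ℝ, (p.1 - p.2) ^ (2 * (n + 1)) ∂(ρ.prod ρ) ≤
        ∫ p : ℝ × ℝ, 4 ^ (n + 1) * (p.1 ^ (2 * (n + 1)) + p.2 ^ (2 * (n + 1))) ∂(ρ.prod ρ) :=
      integral_mono ((tsub.pow hg.nonneg _).integrable hg)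
        (((hi1 _).add (hi2 _)).const_mul _) fun p => sub_pow_le_four_pow p.1 p.2 (n + 1)
    rw [integral_const_mul, integral_add (hi1 _) (hi2 _), hm1, hm2] at this
    linarith
  have hA0 : 0 ≤ ∫ p : ℝ × ℝ, (p.1 + p.2) ^ 2 ∂(ρ.prod ρ) :=
    MeasureTheory.integral_nonneg fun p => sq_nonneg _
  have hneg : MeasurePreserving (fun p : ℝ × ℝ => (p.1, -p.2)) (ρ.prod ρ) (ρ.prod ρ) :=
    (MeasurePreserving.id ρ).prod ⟨measurable_neg, hρ.even⟩
  have tL := (tsum.pow hg.nonneg 2).mul (tsub.pow hg.nonneg (2 * (n + 1)))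
  have tL' := (tsub.pow hg.nonneg 2).mul (tsum.pow hg.nonneg (2 * (n + 1)))
  have hflip : ∫ p : ℝ × ℝ, (p.1 + p.2) ^ 2 * (p.1 - p.2) ^ (2 * (n + 1)) ∂(ρ.prod ρ) =
      ∫ p : ℝ × ℝ, (p.1 - p.2) ^ 2 * (p.1 + p.2) ^ (2 * (n + 1)) ∂(ρ.prod ρ) := by
    conv_lhs => rw [← hneg.map_eq]
    rw [integral_map hneg.measurable.aemeasurable tL.1.aestronglyMeasurable]
    simp [sub_eq_add_neg]
  -- The symmetrised integrand is (x²-y²)²((x-y)^{2n} + (x+y)^{2n}) ≥ (x²-y²)² x^{2n}, and dropping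
  -- y⁴x^{2n} leaves x^{2n+4} - 2x^{2n+2}y².
  have hlow : ∫ p : ℝ × ℝ, (p.1 ^ (2 * (n + 2)) - 2 * (p.1 ^ (2 * (n + 1)) * p.2 ^ 2))
      ∂(ρ.prod ρ) ≤
      ∫ p : ℝ × ℝ, ((p.1 + p.2) ^ 2 * (p.1 - p.2) ^ (2 * (n + 1)) +
        (p.1 - p.2) ^ 2 * (p.1 + p.2) ^ (2 * (n + 1))) ∂(ρ.prod ρ) := by
    refine integral_mono ((hi1 _).sub
      ((((t1.pow hg.nonneg _).mul (t2.pow hg.nonneg 2)).integrable hg).const_mul 2))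
      ((tL.integrable hg).add (tL'.integrable hg)) fun p => ?_
    have h1 := mul_le_mul_of_nonneg_left (pow_le_sub_pow_add_add_pow p.1 p.2 n)
      (sq_nonneg (p.1 ^ 2 - p.2 ^ 2))
    have h2 : 0 ≤ p.1 ^ (2 * n) := by rw [pow_mul]; positivity
    have h3 : 0 ≤ (p.2 ^ 2) ^ 2 * p.1 ^ (2 * n) := by positivity
    dsimp only
    have e1 : (p.1 + p.2) ^ 2 * (p.1 - p.2) ^ (2 * (n + 1)) +
        (p.1 - p.2) ^ 2 * (p.1 + p.2) ^ (2 * (n + 1)) =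
        (p.1 ^ 2 - p.2 ^ 2) ^ 2 * ((p.1 - p.2) ^ (2 * n) + (p.1 + p.2) ^ (2 * n)) := by
      ring
    have e2 : p.1 ^ (2 * (n + 2)) - 2 * (p.1 ^ (2 * (n + 1)) * p.2 ^ 2) =
        (p.1 ^ 2 - p.2 ^ 2) ^ 2 * p.1 ^ (2 * n) - (p.2 ^ 2) ^ 2 * p.1 ^ (2 * n) := by
      ring
    rw [e1, e2]
    linarith
  rw [integral_add (tL.integrable hg) (tL'.integrable hg), ← hflip,
    integral_sub (hi1 _) ((((t1.pow hg.nonneg _).mul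
      (t2.pow hg.nonneg 2)).integrable hg).const_mul 2), integral_const_mul, hm1,
    integral_prod_mul (fun x : ℝ => x ^ (2 * (n + 1))) fun x : ℝ => x ^ 2] at hlow
  have hmain := integral_sq_mul_pow_le hρ hq (2 * (n + 1))
  have hm0' := hm0 1
  have hprod := mul_le_mul hA hB (MeasureTheory.integral_nonneg fun p => by
    simp only [Pi.zero_apply]; rw [pow_mul]; positivity) (by positivity)
  nlinarith

end Moments

end GSModel

namespace GSModel

/-! ### Weak limits -/

section WeakLimit

variable {ρs : ℕ → ProbabilityMeasure ℝ} {ρ : ProbabilityMeasure ℝ}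

theorem tendsto_integral_of_bounded (hlim : Tendsto ρs atTop (𝓝 ρ)) {f : ℝ → ℝ}
    (hf : Continuous f) {C : ℝ} (hC : ∀ x, |f x| ≤ C) :
    Tendsto (fun k => ∫ x, f x ∂(ρs k : Measure ℝ)) atTop (𝓝 (∫ x, f x ∂(ρ : Measure ℝ))) :=
  (ProbabilityMeasure.tendsto_iff_forall_integral_tendsto.1 hlim)
    (BoundedContinuousFunction.ofNormedAddCommGroup f hf C hC)

/-- Weak convergence alone does not bound second moments. But the fourth moment is at most C M², M
being the second moment, so x² cannot owe most of its mean to a set of small probability; tightness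
then bounds M. -/
theorem exists_eventually_second_moment_le (hs : ∀ k, EvenSubgaussian (ρs k : Measure ℝ))
    (hq : ∀ k, QuadPositive (ρs k : Measure ℝ)) (hρ : EvenSubgaussian (ρ : Measure ℝ))
    (hlim : Tendsto ρs atTop (𝓝 ρ)) :
    ∃ B : ℝ, ∀ᶠ k in atTop, ∫ x, x ^ 2 ∂(ρs k : Measure ℝ) ≤ B := by
  set C : ℝ := 2 + 16 * 4 ^ (0 + 1) with hCdef
  have hC : 0 < C := by positivity
  set m := ∫ x, x ^ 2 ∂(ρ : Measure ℝ) with hm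
  have hm0 : 0 ≤ m := integral_nonneg fun x => sq_nonneg x
  -- `R2` plays the role of a squared radius, so large that the cut-off function h has ρ-mean below
  -- 1/(4C), hence eventually also ρ_k-mean below 1/(4C).
  obtain ⟨R2, hR2, hR2pos⟩ : ∃ r : ℝ, m / r < 1 / (4 * C) ∧ 0 < r := by
    refine ⟨4 * C * (m + 1), ?_, by positivity⟩
    rw [div_lt_div_iff₀ (by positivity) (by positivity)]
    nlinarith
  set h : ℝ → ℝ := fun x => min 1 (x ^ 2 / R2) with hh
  have hhc : Continuous h := by fun_prop
  have hh0 : ∀ x, 0 ≤ h x := fun x => le_min zero_le_one (by positivity)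
  have hh1 : ∀ x, h x ≤ 1 := fun x => min_le_left _ _
  have hhb : ∀ x, |h x| ≤ 1 := fun x => by rw [abs_of_nonneg (hh0 x)]; exact hh1 x
  have hhi : ∀ μ : ProbabilityMeasure ℝ, Integrable h (μ : Measure ℝ) := fun μ =>
    (integrable_const (1 : ℝ)).mono' hhc.aestronglyMeasurable (Eventually.of_forall hhb)
  have hρh : ∫ x, h x ∂(ρ : Measure ℝ) < 1 / (4 * C) := by
    refine lt_of_le_of_lt ?_ hR2
    rw [hm, ← integral_div]
    exact integral_mono (hhi ρ) ((hρ.integrable_pow 2).div_const _) fun x => min_le_right _ _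
  refine ⟨2 * R2, ?_⟩
  filter_upwards [(tendsto_integral_of_bounded hlim hhc hhb).eventually (gt_mem_nhds hρh)]
    with k hk
  set M := ∫ x, x ^ 2 ∂(ρs k : Measure ℝ) with hM
  have hM0 : 0 ≤ M := integral_nonneg fun x => sq_nonneg x
  have h4 : ∫ x, x ^ 4 ∂(ρs k : Measure ℝ) ≤ C * (M * M) := moment_succ_le (hs k) (hq k) 0
  rcases hM0.eq_or_lt with h0 | hMpos
  · rw [← h0]; positivity
  set a : ℝ := 1 / (4 * C * M) with ha
  have hapos : 0 < a := by positivity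
  -- Beyond the radius h = 1, and x² ≤ a x⁴ + 1/(4a) with 1/(4a) = C M. The choice of a makes each
  -- of the last two terms integrate to at most M/4.
  have hpt : ∀ x : ℝ, x ^ 2 ≤ R2 + a * x ^ 4 + C * M * h x := by
    intro x
    have e : C * M = 1 / (4 * a) := by rw [ha]; field_simp
    rcases le_total (x ^ 2) R2 with hx | hx
    · have : 0 ≤ C * M * h x := mul_nonneg (by positivity) (hh0 x)
      have : 0 ≤ a * x ^ 4 := by positivity
      linarith
    · have hx1 : h x = 1 := min_eq_left ((one_le_div hR2pos).2 hx)
      rw [hx1, e, mul_one]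
      have : 0 ≤ a * (x ^ 2 - 1 / (2 * a)) ^ 2 := by positivity
      have e2 : a * (x ^ 2 - 1 / (2 * a)) ^ 2 = a * x ^ 4 - x ^ 2 + 1 / (4 * a) := by
        field_simp; ring
      linarith
  have hint : _ ≤ ∫ x, (R2 + a * x ^ 4 + C * M * h x) ∂(ρs k : Measure ℝ) :=
    integral_mono ((hs k).integrable_pow 2)
    (((integrable_const R2).add (((hs k).integrable_pow 4).const_mul a)).add
      ((hhi (ρs k)).const_mul (C * M))) hpt
  have hsum : ∫ x, (R2 + a * x ^ 4 + C * M * h x) ∂(ρs k : Measure ℝ) =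
      ∫ x, (R2 + a * x ^ 4) ∂(ρs k : Measure ℝ) + ∫ x, C * M * h x ∂(ρs k : Measure ℝ) :=
    integral_add ((integrable_const R2).add (((hs k).integrable_pow 4).const_mul a))
      ((hhi (ρs k)).const_mul (C * M))
  rw [hsum, integral_add (integrable_const R2)
    (((hs k).integrable_pow 4).const_mul a), integral_const_mul, integral_const_mul] at hint
  simp only [integral_const, probReal_univ, smul_eq_mul, one_mul] at hint
  have h5 : a * ∫ x, x ^ 4 ∂(ρs k : Measure ℝ) ≤ M / 4 := by
    calc a * ∫ x, x ^ 4 ∂(ρs k : Measure ℝ) ≤ a * (C * (M * M)) := by gcongr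
      _ = M / 4 := by rw [ha]; field_simp
  have h6 : C * M * ∫ x, h x ∂(ρs k : Measure ℝ) ≤ M / 4 := by
    calc C * M * ∫ x, h x ∂(ρs k : Measure ℝ) ≤ C * M * (1 / (4 * C)) := by gcongr
      _ = M / 4 := by field_simp
  have h7 : M ≤ R2 + M / 4 + M / 4 := hint.trans (add_le_add (add_le_add le_rfl h5) h6)
  linarith

theorem exists_eventually_even_moment_le (hs : ∀ k, EvenSubgaussian (ρs k : Measure ℝ))
    (hq : ∀ k, QuadPositive (ρs k : Measure ℝ)) (hρ : EvenSubgaussian (ρ : Measure ℝ))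
    (hlim : Tendsto ρs atTop (𝓝 ρ)) (n : ℕ) :
    ∃ B : ℝ, ∀ᶠ k in atTop, ∫ x, x ^ (2 * (n + 1)) ∂(ρs k : Measure ℝ) ≤ B := by
  obtain ⟨B, hB⟩ := exists_eventually_second_moment_le hs hq hρ hlim
  induction n with
  | zero => exact ⟨B, hB⟩
  | succ n ih =>
    obtain ⟨B', hB'⟩ := ih
    refine ⟨(2 + 16 * 4 ^ (n + 1)) * (B * B'), ?_⟩
    filter_upwards [hB, hB'] with k h1 h2
    refine (moment_succ_le (hs k) (hq k) n).trans ?_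
    have h3 : 0 ≤ ∫ x, x ^ 2 ∂(ρs k : Measure ℝ) := integral_nonneg fun x => sq_nonneg x
    have h4 : 0 ≤ ∫ x, x ^ (2 * (n + 1)) ∂(ρs k : Measure ℝ) := integral_nonneg fun x => by
      simp only [Pi.zero_apply]; rw [pow_mul]; positivity
    have h5 := h3.trans h1
    gcongr

/-- Clipping at level R gives a bounded continuous function. The error is O(1/R) uniformly in k, by
the bound on a higher even moment. -/
theorem tendsto_moment (hs : ∀ k, EvenSubgaussian (ρs k : Measure ℝ))
    (hq : ∀ k, QuadPositive (ρs k : Measure ℝ)) (hρ : EvenSubgaussian (ρ : Measure ℝ))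
    (hlim : Tendsto ρs atTop (𝓝 ρ)) (n : ℕ) :
    Tendsto (fun k => ∫ x, x ^ n ∂(ρs k : Measure ℝ)) atTop
      (𝓝 (∫ x, x ^ n ∂(ρ : Measure ℝ))) := by
  obtain ⟨B, hB⟩ := exists_eventually_even_moment_le hs hq hρ hlim n
  set m := ∫ x, x ^ (2 * (n + 1)) ∂(ρ : Measure ℝ) with hm
  have hclip : ∀ R : ℝ, 1 ≤ R → ∀ μ : ProbabilityMeasure ℝ, EvenSubgaussian (μ : Measure ℝ) →
      |(∫ x, x ^ n ∂(μ : Measure ℝ)) - ∫ x, (max (-R) (min x R)) ^ n ∂(μ : Measure ℝ)| ≤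
        2 / R * ∫ x, x ^ (2 * (n + 1)) ∂(μ : Measure ℝ) := by
    intro R hR μ hμ
    have hc : ∀ x : ℝ, |max (-R) (min x R)| ≤ R := fun x => abs_le.2
      ⟨le_max_left _ _, max_le (by linarith) (min_le_right _ _)⟩
    have hint : Integrable (fun x : ℝ => (max (-R) (min x R)) ^ n) (μ : Measure ℝ) :=
      (integrable_const (R ^ n)).mono' (by fun_prop) (Eventually.of_forall fun x => by
        rw [Real.norm_eq_abs, abs_pow]
        exact pow_le_pow_left₀ (abs_nonneg _) (hc x) n)
    rw [← integral_sub (hμ.integrable_pow n) hint, ← integral_const_mul, ← Real.norm_eq_abs]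
    refine norm_integral_le_of_norm_le ((hμ.integrable_pow _).const_mul _)
      (Eventually.of_forall fun x => ?_)
    rw [Real.norm_eq_abs]
    have hx2 : (0 : ℝ) ≤ x ^ (2 * (n + 1)) := by rw [pow_mul]; positivity
    rcases le_or_gt |x| R with hx | hx
    · have : max (-R) (min x R) = x := by
        rw [min_eq_left (abs_le.1 hx).2, max_eq_right (abs_le.1 hx).1]
      rw [this, sub_self, abs_zero]
      positivity
    · have h1 : |x ^ n - (max (-R) (min x R)) ^ n| ≤ 2 * |x| ^ n := by
        refine (abs_sub _ _).trans ?_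
        rw [abs_pow, abs_pow]
        have := pow_le_pow_left₀ (abs_nonneg _) ((hc x).trans hx.le) n
        linarith
      refine h1.trans ?_
      rw [div_mul_eq_mul_div, le_div_iff₀ (by linarith)]
      have h2 : |x| ^ n * R ≤ x ^ (2 * (n + 1)) := by
        have hx1 : 1 ≤ |x| := hR.trans hx.le
        calc |x| ^ n * R ≤ |x| ^ n * |x| := by gcongr
          _ = |x| ^ (n + 1) := (pow_succ _ _).symm
          _ ≤ |x| ^ (2 * (n + 1)) := pow_le_pow_right₀ hx1 (by omega)
          _ = x ^ (2 * (n + 1)) := by rw [pow_mul, sq_abs, ← pow_mul]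
      linarith
  rw [Metric.tendsto_atTop']
  intro ε hε
  -- One third of ε for each of the clipping errors of ρ_k and of ρ; the last third is for weak
  -- convergence of the clipped moment.
  obtain ⟨R, hR1, hRB, hRm⟩ : ∃ R : ℝ, 1 ≤ R ∧ 2 / R * |B| < ε / 3 ∧ 2 / R * |m| < ε / 3 := by
    refine ⟨max 1 (6 * (|B| + |m| + 1) / ε), le_max_left _ _, ?_, ?_⟩ <;>
    · rw [div_mul_eq_mul_div, div_lt_iff₀ (by positivity)]
      have h1 := le_max_right 1 (6 * (|B| + |m| + 1) / ε)
      have h2 : ε / 3 * (6 * (|B| + |m| + 1) / ε) = 2 * (|B| + |m| + 1) := by field_simp; ring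
      have h3 := mul_le_mul_of_nonneg_left h1 (show 0 ≤ ε / 3 by positivity)
      have := abs_nonneg B
      have := abs_nonneg m
      linarith
  have hlimR := tendsto_integral_of_bounded hlim
    (f := fun x => (max (-R) (min x R)) ^ n) (by fun_prop) (C := R ^ n) fun x => by
      rw [abs_pow]
      exact pow_le_pow_left₀ (abs_nonneg _) (abs_le.2
        ⟨le_max_left _ _, max_le (by linarith) (min_le_right _ _)⟩) n
  have hev := (Metric.tendsto_nhds.1 hlimR) (ε / 3) (by positivity)
  obtain ⟨K, hK⟩ := eventually_atTop.1 (hev.and hB)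
  refine ⟨K, fun k hk => ?_⟩
  obtain ⟨h1, h2⟩ := hK k hk.le
  have h3 := hclip R hR1 (ρs k) (hs k)
  have h4 := hclip R hR1 ρ hρ
  have h5 : 2 / R * ∫ x, x ^ (2 * (n + 1)) ∂(ρs k : Measure ℝ) < ε / 3 :=
    lt_of_le_of_lt (mul_le_mul_of_nonneg_left (h2.trans (le_abs_self B)) (by positivity)) hRB
  have h6 : 2 / R * m < ε / 3 :=
    lt_of_le_of_lt (mul_le_mul_of_nonneg_left (le_abs_self m) (by positivity)) hRm
  rw [Real.dist_eq] at h1 ⊢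
  rw [abs_lt] at h1 ⊢
  rw [abs_le] at h3 h4
  constructor <;> linarith [h1.1, h1.2, h3.1, h3.2, h4.1, h4.2]

/-- The algebra of polynomial functions in four variables. -/
def quadPolynomials : Subalgebra ℝ ((ℝ × ℝ) × (ℝ × ℝ) → ℝ) :=
  Algebra.adjoin ℝ {fun p => p.1.1, fun p => p.1.2, fun p => p.2.1, fun p => p.2.2}

theorem quadPart_mem_quadPolynomials (i : Fin 4) : quadPart i ∈ quadPolynomials := by
  have h1 : (fun p : (ℝ × ℝ) × (ℝ × ℝ) => p.1.1) ∈ quadPolynomials :=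
    Algebra.subset_adjoin (by simp)
  have h2 : (fun p : (ℝ × ℝ) × (ℝ × ℝ) => p.1.2) ∈ quadPolynomials :=
    Algebra.subset_adjoin (by simp)
  have h3 : (fun p : (ℝ × ℝ) × (ℝ × ℝ) => p.2.1) ∈ quadPolynomials :=
    Algebra.subset_adjoin (by simp)
  have h4 : (fun p : (ℝ × ℝ) × (ℝ × ℝ) => p.2.2) ∈ quadPolynomials :=
    Algebra.subset_adjoin (by simp)
  fin_cases i
  · exact add_mem (add_mem (add_mem h1 h2) h3) h4
  · exact sub_mem (sub_mem (add_mem h1 h2) h3) h4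
  · exact sub_mem (add_mem (sub_mem h1 h2) h3) h4
  · exact sub_mem (add_mem (add_mem (neg_mem h1) h2) h3) h4

/-- On monomials the integral over four copies is a product of moments of ρ; the rest is linearity.
-/
theorem tendsto_integral_quadPolynomial (hs : ∀ k, EvenSubgaussian (ρs k : Measure ℝ))
    (hq : ∀ k, QuadPositive (ρs k : Measure ℝ)) (hρ : EvenSubgaussian (ρ : Measure ℝ))
    (hlim : Tendsto ρs atTop (𝓝 ρ)) {f : (ℝ × ℝ) × (ℝ × ℝ) → ℝ} (hf : f ∈ quadPolynomials) :
    Tendsto (fun k => ∫ p, f p ∂(quadMeasure (ρs k : Measure ℝ))) atTop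
      (𝓝 (∫ p, f p ∂(quadMeasure (ρ : Measure ℝ)))) := by
  suffices h : (∀ μ : ProbabilityMeasure ℝ, EvenSubgaussian (μ : Measure ℝ) →
      Integrable f (quadMeasure (μ : Measure ℝ))) ∧
      Tendsto (fun k => ∫ p, f p ∂(quadMeasure (ρs k : Measure ℝ))) atTop
        (𝓝 (∫ p, f p ∂(quadMeasure (ρ : Measure ℝ)))) from h.2
  rw [quadPolynomials, ← Subalgebra.mem_toSubmodule, Algebra.adjoin_eq_span] at hf
  induction hf using Submodule.span_induction with
  | mem x hx =>
    obtain ⟨a, b, c, d, rfl⟩ : ∃ a b c d : ℕ, x = fun p : (ℝ × ℝ) × (ℝ × ℝ) =>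
        (p.1.1 ^ a * p.1.2 ^ b) * (p.2.1 ^ c * p.2.2 ^ d) := by
      induction hx using Submonoid.closure_induction with
      | mem y hy =>
        rcases hy with rfl | rfl | rfl | rfl
        · exact ⟨1, 0, 0, 0, by ext; simp⟩
        · exact ⟨0, 1, 0, 0, by ext; simp⟩
        · exact ⟨0, 0, 1, 0, by ext; simp⟩
        · exact ⟨0, 0, 0, 1, by ext; simp⟩
      | one => exact ⟨0, 0, 0, 0, by ext; simp⟩
      | mul y z _ _ hy hz =>
        obtain ⟨a, b, c, d, rfl⟩ := hy
        obtain ⟨a', b', c', d', rfl⟩ := hz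
        exact ⟨a + a', b + b', c + c', d + d', by ext; simp only [Pi.mul_apply]; ring⟩
    have e : ∀ μ : ProbabilityMeasure ℝ, ∫ p : (ℝ × ℝ) × (ℝ × ℝ),
        (p.1.1 ^ a * p.1.2 ^ b) * (p.2.1 ^ c * p.2.2 ^ d) ∂(quadMeasure (μ : Measure ℝ)) =
        ((∫ x, x ^ a ∂(μ : Measure ℝ)) * ∫ x, x ^ b ∂(μ : Measure ℝ)) *
        ((∫ x, x ^ c ∂(μ : Measure ℝ)) * ∫ x, x ^ d ∂(μ : Measure ℝ)) := by
      intro μ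
      rw [quadMeasure, integral_prod_mul (fun q : ℝ × ℝ => q.1 ^ a * q.2 ^ b)
        fun q : ℝ × ℝ => q.1 ^ c * q.2 ^ d, integral_prod_mul (fun x : ℝ => x ^ a) fun x => x ^ b,
        integral_prod_mul (fun x : ℝ => x ^ c) fun x => x ^ d]
    refine ⟨fun μ hμ => ?_, ?_⟩
    · exact ((hμ.integrable_pow a).mul_prod (hμ.integrable_pow b)).mul_prod
        ((hμ.integrable_pow c).mul_prod (hμ.integrable_pow d))
    · simp_rw [e]
      have hm := tendsto_moment hs hq hρ hlim
      exact ((hm a).mul (hm b)).mul ((hm c).mul (hm d))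
  | zero => exact ⟨fun μ _ => integrable_zero _ _ _, by simp⟩
  | add x y _ _ hx hy =>
    refine ⟨fun μ hμ => (hx.1 μ hμ).add (hy.1 μ hμ), ?_⟩
    simp_rw [Pi.add_apply]
    rw [integral_add (hx.1 ρ hρ) (hy.1 ρ hρ)]
    simp_rw [fun k => integral_add (hx.1 (ρs k) (hs k)) (hy.1 (ρs k) (hs k))]
    exact hx.2.add hy.2
  | smul c x _ hx =>
    refine ⟨fun μ hμ => (hx.1 μ hμ).smul c, ?_⟩
    simp_rw [Pi.smul_apply, integral_smul]
    exact hx.2.const_smul c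

theorem quadPositive_of_tendsto (hs : ∀ k, EvenSubgaussian (ρs k : Measure ℝ))
    (hq : ∀ k, QuadPositive (ρs k : Measure ℝ)) (hρ : EvenSubgaussian (ρ : Measure ℝ))
    (hlim : Tendsto ρs atTop (𝓝 ρ)) : QuadPositive (ρ : Measure ℝ) := by
  intro k
  have hmem : (fun p => ∏ i, quadPart i p ^ k i) ∈ quadPolynomials := by
    have : (fun p => ∏ i, quadPart i p ^ k i) = ∏ i, quadPart i ^ k i := by
      ext; simp
    rw [this]
    exact prod_mem fun i _ => pow_mem (quadPart_mem_quadPolynomials i) _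
  exact ge_of_tendsto' (tendsto_integral_quadPolynomial hs hq hρ hlim hmem) fun n => hq n k

theorem map_neg_eq_of_tendsto (hs : ∀ k, (ρs k : Measure ℝ).map (fun x => -x) = ρs k)
    (hlim : Tendsto ρs atTop (𝓝 ρ)) : (ρ : Measure ℝ).map (fun x => -x) = ρ := by
  have h := ProbabilityMeasure.tendsto_map_of_tendsto_of_continuous ρs ρ hlim
    (f := fun x => -x) continuous_neg
  have e : (fun k => (ρs k).map (f := fun x : ℝ => -x) continuous_neg.measurable.aemeasurable) =
      ρs := by
    funext k
    exact Subtype.ext (hs k)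
  rw [e] at h
  exact congrArg (fun μ : ProbabilityMeasure ℝ => (μ : Measure ℝ)) (tendsto_nhds_unique h hlim)

end WeakLimit

theorem HasSubgaussianGrowth.integrable_exp_sq {ρ : ProbabilityMeasure ℝ}
    (hρ : HasSubgaussianGrowth ρ) (C : ℝ) :
    Integrable (fun x => Real.exp (C * x ^ 2)) (ρ : Measure ℝ) := by
  obtain ⟨α, hα, hint⟩ := hρ
  -- The radius beyond which |C|x² ≤ |x|^α; inside it the gaussian factor is bounded.
  set R : ℝ := |C| ^ (1 / (α - 2)) with hR
  have hR0 : 0 ≤ R := by positivity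
  refine (hint.const_mul (Real.exp (|C| * R ^ 2))).mono' (by fun_prop)
    (Eventually.of_forall fun x => ?_)
  rw [Real.norm_eq_abs, abs_of_pos (Real.exp_pos _), ← Real.exp_add]
  apply Real.exp_le_exp.2
  have hx0 : 0 ≤ |x| ^ α := by positivity
  have h1 : C * x ^ 2 ≤ |C| * |x| ^ 2 := by
    rw [sq_abs]; exact mul_le_mul_of_nonneg_right (le_abs_self C) (sq_nonneg x)
  rcases le_total |x| R with h | h
  · have : |C| * |x| ^ 2 ≤ |C| * R ^ 2 := by gcongr
    linarith
  · have h2 : |C| ≤ |x| ^ (α - 2) := by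
      calc |C| = R ^ (α - 2) := by
            rw [hR, ← Real.rpow_mul (abs_nonneg C), one_div, inv_mul_cancel₀ (by linarith),
              Real.rpow_one]
        _ ≤ |x| ^ (α - 2) := Real.rpow_le_rpow hR0 h (by linarith)
    have h3 : |C| * |x| ^ 2 ≤ |x| ^ α := by
      rcases (abs_nonneg x).eq_or_lt with h0 | h0
      · rw [← h0]; simp; positivity
      · calc |C| * |x| ^ 2 ≤ |x| ^ (α - 2) * |x| ^ 2 := by gcongr
          _ = |x| ^ α := by
            rw [← Real.rpow_natCast |x| 2, ← Real.rpow_add h0]; norm_num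
    have : 0 ≤ |C| * R ^ 2 := by positivity
    linarith

end GSModel

namespace GSModel

/-! ### Ising blocks -/

/-! ### Finite combinations of point masses -/

section Atomic

variable {X Y ι κ : Type*} [MeasurableSpace X] [MeasurableSpace Y] [Fintype ι] [Fintype κ]

theorem integral_sum_smul_dirac [MeasurableSingletonClass X] {c : ι → ℝ≥0∞}
    (hc : ∀ i, c i ≠ ⊤) (x : ι → X) (f : X → ℝ) :
    ∫ a, f a ∂(∑ i, c i • Measure.dirac (x i)) = ∑ i, (c i).toReal * f (x i) := by
  rw [integral_finsetSum_measure fun i _ =>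
    (integrable_dirac (by simp)).smul_measure (hc i)]
  simp [integral_smul_measure]

theorem integrable_sum_smul_dirac [MeasurableSingletonClass X] {c : ι → ℝ≥0∞}
    (hc : ∀ i, c i ≠ ⊤) (x : ι → X) (f : X → ℝ) :
    Integrable f (∑ i, c i • Measure.dirac (x i)) :=
  integrable_finsetSum_measure.2 fun i _ => (integrable_dirac (by simp)).smul_measure (hc i)

theorem isFiniteMeasure_sum_smul_dirac {c : ι → ℝ≥0∞} (hc : ∀ i, c i ≠ ⊤) (x : ι → X) :
    IsFiniteMeasure (∑ i, c i • Measure.dirac (x i)) :=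
  ⟨by simpa [Measure.finsetSum_apply, ENNReal.sum_lt_top] using fun i => (hc i).lt_top⟩

theorem prod_sum_smul_dirac {c : ι → ℝ≥0∞} (hc : ∀ i, c i ≠ ⊤) (x : ι → X) {e : κ → ℝ≥0∞}
    (he : ∀ i, e i ≠ ⊤) (y : κ → Y) :
    (∑ i, c i • Measure.dirac (x i)).prod (∑ j, e j • Measure.dirac (y j)) =
      ∑ p : ι × κ, (c p.1 * e p.2) • Measure.dirac (x p.1, y p.2) := by
  have := isFiniteMeasure_sum_smul_dirac hc x
  have := isFiniteMeasure_sum_smul_dirac he y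
  refine Measure.prod_eq fun s t hs ht => ?_
  simp only [Measure.finsetSum_apply, Measure.smul_apply, smul_eq_mul, Finset.sum_mul_sum,
    Fintype.sum_prod_type, Measure.dirac_apply' _ hs, Measure.dirac_apply' _ ht,
    Measure.dirac_apply' _ (hs.prod ht)]
  refine Finset.sum_congr rfl fun i _ => Finset.sum_congr rfl fun j _ => ?_
  by_cases h1 : x i ∈ s <;> by_cases h2 : y j ∈ t <;> simp [h1, h2]

/-- Ginibre's principle for counting measure; on a finite set every function is bounded, so the zero
gauge suffices. -/
theorem sum_mul_exp_nonneg {Ω : Type*} [Fintype Ω] {S : Set (Ω → ℝ)}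
    (h : ∀ m ∈ Submonoid.closure S, 0 ≤ ∑ ω, m ω) {f Q : Ω → ℝ} (hf : f ∈ positiveCone S)
    (hQ : Q ∈ positiveCone S) : 0 ≤ ∑ ω, f ω * Real.exp (Q ω) := by
  let _ : MeasurableSpace Ω := ⊤
  have hlin : ∀ g : Ω → ℝ, LinearGrowth (fun _ => 0) g := fun g =>
    ⟨measurable_from_top, ∑ ω, |g ω|, Finset.sum_nonneg fun _ _ => abs_nonneg _, fun ω => by
      simpa using Finset.single_le_sum (f := fun ω => |g ω|) (fun _ _ => abs_nonneg _)
        (Finset.mem_univ ω)⟩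
  have hN : ExpGauge (Measure.count : Measure Ω) fun _ => 0 :=
    ⟨measurable_const, fun _ => le_rfl, fun C => integrable_const _⟩
  have := integral_mul_exp_nonneg hN (w := fun _ => 1) (hlin _).tame
    (fun m hm => ⟨(hlin m).tame, by simpa using h m hm⟩) hf hQ (hlin Q)
  simpa using this

end Atomic

/-! ### Ellis-Monroe-Newman positivity for signs and their block sums -/

section Signs

/-- Four signs as real numbers. -/
def quadSigns (s : (ℤˣ × ℤˣ) × (ℤˣ × ℤˣ)) : (ℝ × ℝ) × (ℝ × ℝ) :=
  ((((s.1.1 : ℤ) : ℝ), ((s.1.2 : ℤ) : ℝ)), (((s.2.1 : ℤ) : ℝ), ((s.2.2 : ℤ) : ℝ)))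

/-- With an even number of minus signs at least one of the forms vanishes; with an odd number all
forms are ±2, with an even number of negative values. -/
theorem prod_quadPart_quadSigns_nonneg (s : (ℤˣ × ℤˣ) × (ℤˣ × ℤˣ)) :
    0 ≤ ∏ i, quadPart i (quadSigns s) := by
  obtain ⟨⟨a, b⟩, ⟨c, d⟩⟩ := s
  rcases Int.units_eq_one_or a with rfl | rfl <;> rcases Int.units_eq_one_or b with rfl | rfl <;>
  rcases Int.units_eq_one_or c with rfl | rfl <;> rcases Int.units_eq_one_or d with rfl | rfl <;>
  · simp [Fin.prod_univ_four, quadPart, quadSigns]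
    try norm_num

/-- Three symmetries (exchange inside both pairs, exchange of the pairs, global sign change) make
the sum vanish unless all four exponents have the same parity. If they are even every term is
nonnegative; if they are odd every term is the product of the four forms times a square. -/
theorem sum_quadSigns_nonneg (k : Fin 4 → ℕ) :
    0 ≤ ∑ s, ∏ i, quadPart i (quadSigns s) ^ k i := by
  set A := ∑ s, ∏ i, quadPart i (quadSigns s) ^ k i with hA
  have h1 : A = (-1) ^ (k 2 + k 3) * A := by
    conv_lhs => rw [hA, ← Equiv.sum_comp (Equiv.prodCongr (Equiv.prodComm ℤˣ ℤˣ)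
      (Equiv.prodComm ℤˣ ℤˣ))]
    rw [hA, Finset.mul_sum]
    refine Finset.sum_congr rfl fun s _ => ?_
    have e0 : quadPart 0 (quadSigns ((Equiv.prodCongr (Equiv.prodComm ℤˣ ℤˣ)
      (Equiv.prodComm ℤˣ ℤˣ)) s)) = quadPart 0 (quadSigns s) := by
      simp [quadPart, quadSigns]; ring
    have e1 : quadPart 1 (quadSigns ((Equiv.prodCongr (Equiv.prodComm ℤˣ ℤˣ)
      (Equiv.prodComm ℤˣ ℤˣ)) s)) = quadPart 1 (quadSigns s) := by
      simp [quadPart, quadSigns]; ring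
    have e2 : quadPart 2 (quadSigns ((Equiv.prodCongr (Equiv.prodComm ℤˣ ℤˣ)
      (Equiv.prodComm ℤˣ ℤˣ)) s)) = -1 * quadPart 2 (quadSigns s) := by
      simp [quadPart, quadSigns]; ring
    have e3 : quadPart 3 (quadSigns ((Equiv.prodCongr (Equiv.prodComm ℤˣ ℤˣ)
      (Equiv.prodComm ℤˣ ℤˣ)) s)) = -1 * quadPart 3 (quadSigns s) := by
      simp [quadPart, quadSigns]; ring
    rw [Fin.prod_univ_four, Fin.prod_univ_four, e0, e1, e2, e3, mul_pow, mul_pow]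
    ring
  have h2 : A = (-1) ^ (k 1 + k 3) * A := by
    conv_lhs => rw [hA, ← Equiv.sum_comp (Equiv.prodComm (ℤˣ × ℤˣ) (ℤˣ × ℤˣ))]
    rw [hA, Finset.mul_sum]
    refine Finset.sum_congr rfl fun s _ => ?_
    have e0 : quadPart 0 (quadSigns ((Equiv.prodComm (ℤˣ × ℤˣ) (ℤˣ × ℤˣ)) s)) =
        quadPart 0 (quadSigns s) := by
      simp [quadPart, quadSigns]; ring
    have e1 : quadPart 1 (quadSigns ((Equiv.prodComm (ℤˣ × ℤˣ) (ℤˣ × ℤˣ)) s)) =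
        -1 * quadPart 1 (quadSigns s) := by
      simp [quadPart, quadSigns]; ring
    have e2 : quadPart 2 (quadSigns ((Equiv.prodComm (ℤˣ × ℤˣ) (ℤˣ × ℤˣ)) s)) =
        quadPart 2 (quadSigns s) := by
      simp [quadPart, quadSigns]; ring
    have e3 : quadPart 3 (quadSigns ((Equiv.prodComm (ℤˣ × ℤˣ) (ℤˣ × ℤˣ)) s)) =
        -1 * quadPart 3 (quadSigns s) := by
      simp [quadPart, quadSigns]; ring
    rw [Fin.prod_univ_four, Fin.prod_univ_four, e0, e1, e2, e3, mul_pow, mul_pow]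
    ring
  have h3 : A = (-1) ^ (k 0 + k 1 + (k 2 + k 3)) * A := by
    conv_lhs => rw [hA, ← Equiv.sum_comp (Equiv.neg ((ℤˣ × ℤˣ) × (ℤˣ × ℤˣ)))]
    rw [hA, Finset.mul_sum]
    refine Finset.sum_congr rfl fun s _ => ?_
    have e : ∀ i, quadPart i (quadSigns (Equiv.neg ((ℤˣ × ℤˣ) × (ℤˣ × ℤˣ)) s)) =
        -1 * quadPart i (quadSigns s) := by
      intro i
      fin_cases i <;> simp [quadPart, quadSigns] <;> ring
    simp only [Fin.prod_univ_four, e, mul_pow]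
    ring
  have hzero : ∀ n : ℕ, Odd n → A = (-1) ^ n * A → A = 0 := fun n hn h => by
    rw [hn.neg_one_pow] at h; linarith
  by_cases p1 : Odd (k 2 + k 3)
  · exact (hzero _ p1 h1).ge
  by_cases p2 : Odd (k 1 + k 3)
  · exact (hzero _ p2 h2).ge
  by_cases p3 : Odd (k 0 + k 1 + (k 2 + k 3))
  · exact (hzero _ p3 h3).ge
  refine Finset.sum_nonneg fun s _ => ?_
  rw [Nat.not_odd_iff_even] at p1 p2 p3
  rcases Nat.even_or_odd (k 3) with hk | hk
  · refine Finset.prod_nonneg fun i _ => Even.pow_nonneg ?_ _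
    fin_cases i <;> simp only [Fin.zero_eta, Fin.mk_one, Fin.reduceFinMk] <;> grind
  · have hodd : ∀ i, Odd (k i) := by
      intro i
      fin_cases i <;> simp only [Fin.zero_eta, Fin.mk_one, Fin.reduceFinMk] <;> grind
    choose l hl using hodd
    have e : ∏ i, quadPart i (quadSigns s) ^ k i =
        (∏ i, quadPart i (quadSigns s)) * ∏ i, (quadPart i (quadSigns s) ^ l i) ^ 2 := by
      rw [← Finset.prod_mul_distrib]
      refine Finset.prod_congr rfl fun i _ => ?_
      rw [hl i]; ring
    rw [e]
    exact mul_nonneg (prod_quadPart_quadSigns_nonneg s)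
      (Finset.prod_nonneg fun i _ => sq_nonneg _)

/-- The four forms are linear, so on block sums they are nonnegative combinations of the forms at
single sites. Observable and energy are therefore in the cone generated by the latter. -/
theorem sum_block_nonneg {V : Type*} [Fintype V] [DecidableEq V] {K : V → V → ℝ} (hK : ∀ x y, 0 ≤ K x y)
    {b : V → ℝ} (hb : ∀ v, 0 ≤ b v) (k : Fin 4 → ℕ) :
    0 ≤ ∑ ω : V → (ℤˣ × ℤˣ) × (ℤˣ × ℤˣ),
      (∏ i, (∑ v, b v * quadPart i (quadSigns (ω v))) ^ k i) *
      Real.exp (∑ x, ∑ y, ∑ i,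
        K x y / 4 * (quadPart i (quadSigns (ω x)) * quadPart i (quadSigns (ω y)))) := by
  set S := Set.range fun (x : V × Fin 4) (ω : V → (ℤˣ × ℤˣ) × (ℤˣ × ℤˣ)) =>
    quadPart x.2 (quadSigns (ω x.1)) with hS
  have hmem : ∀ v i, (fun ω : V → (ℤˣ × ℤˣ) × (ℤˣ × ℤˣ) => quadPart i (quadSigns (ω v))) ∈
      positiveCone S := fun v i => mem_positiveCone ⟨(v, i), rfl⟩
  refine sum_mul_exp_nonneg (S := S) (fun m hm => ?_) ?_
    (positiveCone_sum _ fun x _ => positiveCone_sum _ fun y _ => positiveCone_sum _ fun i _ =>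
      positiveCone_const_mul (by linarith [hK x y]) (positiveCone_mul (hmem _ _) (hmem _ _)))
  · obtain ⟨l, rfl⟩ : ∃ l : V → Fin 4 → ℕ, m = fun ω =>
        ∏ v, ∏ i, quadPart i (quadSigns (ω v)) ^ l v i := by
      induction hm using Submonoid.closure_induction with
      | mem y hy =>
        obtain ⟨x, rfl⟩ := hy
        refine ⟨fun v i => if v = x.1 then if i = x.2 then 1 else 0 else 0, ?_⟩
        ext ω
        rw [Finset.prod_eq_single x.1, Finset.prod_eq_single x.2] <;> simp +contextual
      | one => exact ⟨0, by ext; simp⟩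
      | mul y z _ _ hy hz =>
        obtain ⟨k, rfl⟩ := hy
        obtain ⟨l, rfl⟩ := hz
        exact ⟨k + l, by ext ω; simp [pow_add, Finset.prod_mul_distrib]⟩
    have h := Finset.prod_univ_sum (fun _ : V => (Finset.univ : Finset ((ℤˣ × ℤˣ) × (ℤˣ × ℤˣ))))
      fun v s => ∏ i, quadPart i (quadSigns s) ^ l v i
    rw [Fintype.piFinset_univ] at h
    rw [← h]
    exact Finset.prod_nonneg fun v _ => sum_quadSigns_nonneg (l v)
  · have : (fun ω : V → (ℤˣ × ℤˣ) × (ℤˣ × ℤˣ) =>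
        ∏ i, (∑ v, b v * quadPart i (quadSigns (ω v))) ^ k i) =
        ∏ i, (fun ω => ∑ v, b v * quadPart i (quadSigns (ω v))) ^ k i := by
      ext; simp
    rw [this]
    exact prod_mem fun i _ => pow_mem
      (positiveCone_sum _ fun v _ => positiveCone_const_mul (hb v) (hmem v i)) _

end Signs

/-! ### From Ising blocks to the Griffiths-Simon class -/

section Block

variable {N : ℕ}

/-- The weight of a configuration of signs. -/
noncomputable def blockWeight (K : Fin N → Fin N → ℝ) (σ : Fin N → ℤˣ) : ℝ :=
  Real.exp (∑ n, ∑ m, K n m * ((σ n : ℤ) : ℝ) * ((σ m : ℤ) : ℝ))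

/-- The value of the block spin. -/
def blockValue (α : ℝ) (b : Fin N → ℝ) (σ : Fin N → ℤˣ) : ℝ := α * ∑ n, b n * ((σ n : ℤ) : ℝ)

theorem blockLaw_eq (α : ℝ) (b : Fin N → ℝ) (K : Fin N → Fin N → ℝ) :
    blockLaw α b K =
      ∑ σ, ENNReal.ofReal (blockWeight K σ) • Measure.dirac (blockValue α b σ) := rfl

theorem blockWeight_neg (K : Fin N → Fin N → ℝ) (σ : Fin N → ℤˣ) :
    blockWeight K (-σ) = blockWeight K σ := by simp [blockWeight]

theorem blockValue_neg (α : ℝ) (b : Fin N → ℝ) (σ : Fin N → ℤˣ) :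
    blockValue α b (-σ) = -blockValue α b σ := by simp [blockValue]

theorem blockLaw_map_neg (α : ℝ) (b : Fin N → ℝ) (K : Fin N → Fin N → ℝ) :
    (blockLaw α b K).map (fun x => -x) = blockLaw α b K := by
  rw [blockLaw_eq, Measure.map_finset_sum (by fun_prop)]
  conv_rhs => rw [← Equiv.sum_comp (Equiv.neg (Fin N → ℤˣ))]
  refine Finset.sum_congr rfl fun σ _ => ?_
  rw [Measure.map_smul, Measure.map_dirac' (by fun_prop), Equiv.neg_apply, blockWeight_neg,
    blockValue_neg]

theorem blockLaw_neg (α : ℝ) (b : Fin N → ℝ) (K : Fin N → Fin N → ℝ) :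
    blockLaw (-α) b K = blockLaw α b K := by
  rw [blockLaw_eq, blockLaw_eq, ← Equiv.sum_comp (Equiv.neg (Fin N → ℤˣ))]
  refine Finset.sum_congr rfl fun σ _ => ?_
  rw [Equiv.neg_apply, blockWeight_neg, blockValue_neg]
  simp [blockValue]

/-- Four configurations of signs from one configuration of quadruples of signs. -/
def quadConfig (N : ℕ) : (Fin N → (ℤˣ × ℤˣ) × (ℤˣ × ℤˣ)) ≃
    ((Fin N → ℤˣ) × (Fin N → ℤˣ)) × ((Fin N → ℤˣ) × (Fin N → ℤˣ)) :=
  (Equiv.arrowProdEquivProdArrow (Fin N) _ _).trans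
    (Equiv.prodCongr (Equiv.arrowProdEquivProdArrow (Fin N) _ _)
      (Equiv.arrowProdEquivProdArrow (Fin N) _ _))

/-- Global spin flip shows that α and -α give the same law. With α ≥ 0 the coefficients α b_n are
nonnegative, as the cone argument requires. -/
theorem IsIsingBlock.exists_nonneg {ρ : ProbabilityMeasure ℝ} (h : IsIsingBlock ρ) :
    ∃ (N : ℕ) (α : ℝ) (b : Fin N → ℝ) (K : Fin N → Fin N → ℝ) (c : (Fin N → ℤˣ) → ℝ≥0∞) (z : ℝ),
      0 ≤ α ∧ (∀ n, 0 ≤ b n) ∧ (∀ n m, 0 ≤ K n m) ∧ (∀ σ, c σ ≠ ⊤) ∧ 0 ≤ z ∧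
      (∀ σ, (c σ).toReal = z * blockWeight K σ) ∧
      (ρ : Measure ℝ) = ∑ σ, c σ • Measure.dirac (blockValue α b σ) := by
  obtain ⟨N, α, b, K, hb, hK, hρ⟩ := h
  wlog hα : 0 ≤ α generalizing α
  · exact this (-α) (by rw [blockLaw_neg]; exact hρ) (by linarith)
  set Z := blockLaw α b K Set.univ with hZ
  have hZ0 : Z ≠ 0 := by
    rw [hZ, blockLaw_eq]
    simp only [Measure.finsetSum_apply, Measure.smul_apply, measure_univ, smul_eq_mul, mul_one]
    intro h
    have := (Finset.sum_eq_zero_iff.1 h) 1 (Finset.mem_univ _)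
    rw [ENNReal.ofReal_eq_zero] at this
    exact absurd this (not_le.2 (Real.exp_pos _))
  refine ⟨N, α, b, K, fun σ => Z⁻¹ * ENNReal.ofReal (blockWeight K σ), Z⁻¹.toReal, hα, hb, hK,
    fun σ => ENNReal.mul_ne_top (ENNReal.inv_ne_top.2 hZ0) ENNReal.ofReal_ne_top,
    ENNReal.toReal_nonneg, fun σ => ?_, ?_⟩
  · rw [ENNReal.toReal_mul, ENNReal.toReal_ofReal (show 0 ≤ blockWeight K σ from (Real.exp_pos _).le)]
  · rw [hρ, blockLaw_eq, Finset.smul_sum]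
    simp_rw [smul_smul]

theorem IsIsingBlock.evenSubgaussian {ρ : ProbabilityMeasure ℝ} (h : IsIsingBlock ρ) :
    EvenSubgaussian (ρ : Measure ℝ) := by
  constructor
  · obtain ⟨N, α, b, K, -, -, hρ⟩ := h
    rw [hρ, Measure.map_smul, blockLaw_map_neg]
  · obtain ⟨N, α, b, K, c, z, -, -, -, hc, -, -, hρ⟩ := h.exists_nonneg
    intro C
    rw [hρ]
    exact integrable_sum_smul_dirac hc _ _

/-- The fourfold product of the atomic law is a sum over four sign configurations. Regrouped as one
configuration of quadruples it is `sum_block_nonneg`, up to the fourth power of the normalisation.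
-/
theorem IsIsingBlock.quadPositive {ρ : ProbabilityMeasure ℝ} (h : IsIsingBlock ρ) :
    QuadPositive (ρ : Measure ℝ) := by
  obtain ⟨N, α, b, K, c, z, hα, hb, hK, hc, hz, hcz, hρ⟩ := h.exists_nonneg
  intro k
  have hc2 : ∀ p : (Fin N → ℤˣ) × (Fin N → ℤˣ), c p.1 * c p.2 ≠ ⊤ := fun p =>
    ENNReal.mul_ne_top (hc _) (hc _)
  rw [quadMeasure, hρ, prod_sum_smul_dirac hc _ hc, prod_sum_smul_dirac hc2 _ hc2,
    integral_sum_smul_dirac fun p => ENNReal.mul_ne_top (hc2 _) (hc2 _)]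
  have h := mul_nonneg (pow_nonneg hz 4) (sum_block_nonneg hK (b := fun n => α * b n)
    (fun n => mul_nonneg hα (hb n)) k)
  rw [Finset.mul_sum] at h
  rw [← Equiv.sum_comp (quadConfig N)]
  refine h.trans_eq (Finset.sum_congr rfl fun ω _ => ?_)
  have e1 : ∀ i, quadPart i ((blockValue α b (quadConfig N ω).1.1,
      blockValue α b (quadConfig N ω).1.2), (blockValue α b (quadConfig N ω).2.1,
      blockValue α b (quadConfig N ω).2.2)) =
      ∑ v, α * b v * quadPart i (quadSigns (ω v)) := by
    intro i
    have e : ∀ σ : Fin N → ℤˣ, blockValue α b σ = ∑ n, α * b n * ((σ n : ℤ) : ℝ) := fun σ => by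
      simp only [blockValue, Finset.mul_sum, mul_assoc]
    fin_cases i <;>
    · simp only [quadPart, e, quadSigns, quadConfig]
      simp only [Equiv.trans_apply, Equiv.prodCongr_apply, Prod.map, Equiv.arrowProdEquivProdArrow,
        Equiv.coe_fn_mk]
      simp only [Fin.zero_eta, Fin.mk_one, Fin.reduceFinMk, Matrix.cons_val,
        Matrix.cons_val_zero, Matrix.cons_val_one, ← Finset.sum_add_distrib,
        ← Finset.sum_sub_distrib, ← Finset.sum_neg_distrib]
      exact Finset.sum_congr rfl fun v _ => by ring
  have e2 : ∑ x, ∑ y, ∑ i,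
      K x y / 4 * (quadPart i (quadSigns (ω x)) * quadPart i (quadSigns (ω y))) =
      (∑ n, ∑ m, K n m * (((quadConfig N ω).1.1 n : ℤ) : ℝ) * (((quadConfig N ω).1.1 m : ℤ) : ℝ)) +
      (∑ n, ∑ m, K n m * (((quadConfig N ω).1.2 n : ℤ) : ℝ) * (((quadConfig N ω).1.2 m : ℤ) : ℝ)) +
      ((∑ n, ∑ m, K n m * (((quadConfig N ω).2.1 n : ℤ) : ℝ) *
        (((quadConfig N ω).2.1 m : ℤ) : ℝ)) +
      (∑ n, ∑ m, K n m * (((quadConfig N ω).2.2 n : ℤ) : ℝ) *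
        (((quadConfig N ω).2.2 m : ℤ) : ℝ))) := by
    simp only [← Finset.sum_add_distrib]
    refine Finset.sum_congr rfl fun x _ => Finset.sum_congr rfl fun y _ => ?_
    simp [Fin.sum_univ_four, quadPart, quadSigns, quadConfig, Equiv.arrowProdEquivProdArrow]
    ring
  simp only [e1, e2, Real.exp_add, ENNReal.toReal_mul, hcz, blockWeight]
  ring

end Block

theorem IsGriffithsSimon.evenSubgaussian {ρ : ProbabilityMeasure ℝ} (h : IsGriffithsSimon ρ) :
    EvenSubgaussian (ρ : Measure ℝ) := by
  rcases h with h | ⟨⟨ρs, hs, hlim⟩, hgrowth⟩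
  · exact h.evenSubgaussian
  · exact ⟨map_neg_eq_of_tendsto (fun k => (hs k).evenSubgaussian.even) hlim,
      hgrowth.integrable_exp_sq⟩

theorem IsGriffithsSimon.quadPositive {ρ : ProbabilityMeasure ℝ} (h : IsGriffithsSimon ρ) :
    QuadPositive (ρ : Measure ℝ) := by
  have hρ := h.evenSubgaussian
  rcases h with h | ⟨⟨ρs, hs, hlim⟩, hgrowth⟩
  · exact h.quadPositive
  · exact quadPositive_of_tendsto (fun k => (hs k).evenSubgaussian) (fun k => (hs k).quadPositive)
      hρ hlim

end GSModel

namespace GSModel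

/-! ### Bounds and symmetries in finite volume -/

section FiniteVolume

variable {V W : Type*} [Fintype V] [Fintype W] {ρ : Measure ℝ} [IsProbabilityMeasure ρ]

theorem gibbsMean_equiv (e : V ≃ W) (K : W → W → ℝ) (a b : V) :
    gibbsMean ρ K (fun τ => τ (e a) * τ (e b)) =
      gibbsMean ρ (fun x y => K (e x) (e y)) (fun τ => τ a * τ b) := by
  have hmp := measurePreserving_piCongrLeft (fun _ : W => ρ) e
  have hval : ∀ (τ : V → ℝ) x, MeasurableEquiv.piCongrLeft (fun _ : W => ℝ) e τ (e x) = τ x :=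
    fun τ x => Equiv.piCongrLeft_apply_apply (fun _ : W => ℝ) e τ x
  have hE : ∀ τ : V → ℝ, pairEnergy K (MeasurableEquiv.piCongrLeft (fun _ : W => ℝ) e τ) =
      pairEnergy (fun x y => K (e x) (e y)) τ := by
    intro τ
    unfold pairEnergy
    rw [← Equiv.sum_comp e]
    refine Finset.sum_congr rfl fun x _ => ?_
    rw [← Equiv.sum_comp e]
    simp only [hval]
  unfold gibbsMean
  rw [← hmp.integral_comp', ← hmp.integral_comp']
  simp only [hE, hval]

theorem pairEnergy_le {K : V → V → ℝ} (hK : ∀ x y, 0 ≤ K x y) {k : ℝ}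
    (h1 : ∀ x, ∑ y, K x y ≤ k) (h2 : ∀ y, ∑ x, K x y ≤ k) (τ : V → ℝ) :
    pairEnergy K τ ≤ k * sqSum τ := by
  have e1 : ∑ x, ∑ y, K x y * (τ x ^ 2 / 2) ≤ ∑ x, k * (τ x ^ 2 / 2) :=
    Finset.sum_le_sum fun x _ => by
      rw [← Finset.sum_mul]
      exact mul_le_mul_of_nonneg_right (h1 x) (by positivity)
  have e2 : ∑ x, ∑ y, K x y * (τ y ^ 2 / 2) ≤ ∑ y, k * (τ y ^ 2 / 2) := by
    rw [Finset.sum_comm]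
    exact Finset.sum_le_sum fun y _ => by
      rw [← Finset.sum_mul]
      exact mul_le_mul_of_nonneg_right (h2 y) (by positivity)
  have e3 : pairEnergy K τ ≤ ∑ x, ∑ y, (K x y * (τ x ^ 2 / 2) + K x y * (τ y ^ 2 / 2)) :=
    Finset.sum_le_sum fun x _ => Finset.sum_le_sum fun y _ => by
      nlinarith [mul_nonneg (hK x y) (sq_nonneg (τ x - τ y))]
  simp only [Finset.sum_add_distrib] at e3
  rw [← Finset.mul_sum, ← Finset.sum_div] at e1 e2
  unfold sqSum
  linarith

/-- From e^E ≥ 1 + E, since the mean of E under the product measure is nonnegative by the first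
Griffiths inequality with zero couplings. -/
theorem one_le_integral_exp_pairEnergy (hρ : EvenSubgaussian ρ) {K : V → V → ℝ}
    (hK : ∀ x y, 0 ≤ K x y) :
    1 ≤ ∫ τ, Real.exp (pairEnergy K τ) ∂(Measure.pi fun _ : V => ρ) := by
  have hnn : ∀ x y : V, 0 ≤ ∫ τ : V → ℝ, τ x * τ y ∂(Measure.pi fun _ : V => ρ) := by
    intro x y
    have := gibbsMean_mul_nonneg hρ (K := fun _ _ : V => 0) (fun _ _ => le_rfl) x y
    simpa [gibbsMean, pairEnergy] using this
  have hint : ∀ x y : V, Integrable (fun τ : V → ℝ => K x y * τ x * τ y)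
      (Measure.pi fun _ : V => ρ) := fun x y => by
    simpa only [mul_assoc] using
      ((linearGrowth_mul x y).const_mul (K x y)).tame.integrable hρ.expGauge
  have hH : 0 ≤ ∫ τ, pairEnergy K τ ∂(Measure.pi fun _ : V => ρ) := by
    unfold pairEnergy
    rw [integral_finsetSum _ fun x _ => integrable_finsetSum _ fun y _ => hint x y]
    refine Finset.sum_nonneg fun x _ => ?_
    rw [integral_finsetSum _ fun y _ => hint x y]
    refine Finset.sum_nonneg fun y _ => ?_
    simp_rw [mul_assoc]
    rw [integral_const_mul]
    exact mul_nonneg (hK x y) (hnn x y)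
  have hHi := (linearGrowth_pairEnergy K).tame.integrable hρ.expGauge
  have h := integral_mono (hHi.add (integrable_const 1))
    ((linearGrowth_pairEnergy K).tame_exp.integrable hρ.expGauge)
    fun τ => Real.add_one_le_exp (pairEnergy K τ)
  simp only [Pi.add_apply] at h
  rw [integral_add hHi (integrable_const 1)] at h
  simp only [integral_const, probReal_univ, smul_eq_mul, one_mul] at h
  linarith

/-- The average second moment is bounded in terms of the total coupling of a site. -/
theorem sum_gibbsMean_sq_le (hρ : EvenSubgaussian ρ) {K : V → V → ℝ} (hK : ∀ x y, 0 ≤ K x y)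
    {k : ℝ} (h1 : ∀ x, ∑ y, K x y ≤ k) (h2 : ∀ y, ∑ x, K x y ≤ k) :
    ∑ x, gibbsMean ρ K (fun τ => τ x * τ x) ≤
      Fintype.card V * Real.log (∫ x, Real.exp ((k + 1) * x ^ 2) ∂ρ) := by
  set C := ∫ x, Real.exp ((k + 1) * x ^ 2) ∂ρ with hC
  have hCpos : 0 < C := integral_exp_pos (hρ.integrable (k + 1))
  set Z := ∫ τ, Real.exp (pairEnergy K τ) ∂(Measure.pi fun _ : V => ρ) with hZ
  have hZ1 : 1 ≤ Z := one_le_integral_exp_pairEnergy hρ hK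
  -- L is the logarithm of the integral of exp((k+1)∑τ²). From ∑τ² - L + 1 ≤ exp(∑τ² - L) and energy
  -- ≤ k∑τ², integration gives Z⟨∑τ²⟩ + (1 - L)Z ≤ e^{-L}e^{L} = 1 ≤ Z.
  set L : ℝ := Fintype.card V * Real.log C with hL
  have hexp := (linearGrowth_pairEnergy K).tame_exp
  have hi : ∀ x : V, Integrable (fun τ : V → ℝ => τ x * τ x * Real.exp (pairEnergy K τ))
      (Measure.pi fun _ : V => ρ) := fun x =>
    ((linearGrowth_mul x x).tame.mul hexp).integrable hρ.expGauge
  have hZi : Integrable (fun τ : V → ℝ => Real.exp (pairEnergy K τ))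
      (Measure.pi fun _ : V => ρ) := hexp.integrable hρ.expGauge
  have hbig : ∫ τ : V → ℝ, ∏ v, Real.exp ((k + 1) * τ v ^ 2) ∂(Measure.pi fun _ : V => ρ) =
      C ^ Fintype.card V := by
    rw [integral_fintype_prod_eq_prod (fun _ x => Real.exp ((k + 1) * x ^ 2))]
    simp [hC]
  have hbigi : Integrable (fun τ : V → ℝ => ∏ v, Real.exp ((k + 1) * τ v ^ 2))
      (Measure.pi fun _ : V => ρ) := Integrable.fintype_prod fun _ => hρ.integrable (k + 1)
  have hpt : ∀ τ : V → ℝ, (∑ x, τ x * τ x * Real.exp (pairEnergy K τ)) +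
      (1 - L) * Real.exp (pairEnergy K τ) ≤
      Real.exp (-L) * ∏ v, Real.exp ((k + 1) * τ v ^ 2) := by
    intro τ
    rw [← Finset.sum_mul, ← add_mul, ← Real.exp_sum, ← Finset.mul_sum, ← Real.exp_add]
    have e1 : ∑ x, τ x * τ x = sqSum τ := Finset.sum_congr rfl fun x _ => (sq _).symm
    change _ ≤ Real.exp (-L + (k + 1) * sqSum τ)
    rw [e1]
    have e2 := Real.add_one_le_exp (sqSum τ - L)
    calc (sqSum τ + (1 - L)) * Real.exp (pairEnergy K τ)
        ≤ Real.exp (sqSum τ - L) * Real.exp (pairEnergy K τ) := by gcongr; linarith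
      _ = Real.exp (sqSum τ - L + pairEnergy K τ) := (Real.exp_add _ _).symm
      _ ≤ _ := Real.exp_le_exp.2 (by linarith [pairEnergy_le hK h1 h2 τ])
  have h := integral_mono ((integrable_finsetSum _ fun x _ => hi x).add (hZi.const_mul (1 - L)))
    (hbigi.const_mul _) hpt
  rw [integral_const_mul, hbig] at h
  have hsum : ∫ τ : V → ℝ, ((∑ x, τ x * τ x * Real.exp (pairEnergy K τ)) +
      (1 - L) * Real.exp (pairEnergy K τ)) ∂(Measure.pi fun _ : V => ρ) =
      (∑ x, ∫ τ : V → ℝ, τ x * τ x * Real.exp (pairEnergy K τ) ∂(Measure.pi fun _ : V => ρ)) +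
      (1 - L) * Z := by
    rw [integral_add (integrable_finsetSum _ fun x _ => hi x) (hZi.const_mul (1 - L)),
      integral_finsetSum _ fun x _ => hi x, integral_const_mul]
  have hone : Real.exp (-L) * C ^ Fintype.card V = 1 := by
    rw [hL, Real.exp_neg, mul_comm (Fintype.card V : ℝ), Real.exp_mul, Real.exp_log hCpos,
      Real.rpow_natCast, inv_mul_cancel₀ (by positivity)]
  have h' := hsum.symm.le.trans h
  rw [hone] at h'
  have e : ∑ x, gibbsMean ρ K (fun τ => τ x * τ x) =
      (∑ x, ∫ τ : V → ℝ, τ x * τ x * Real.exp (pairEnergy K τ)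
        ∂(Measure.pi fun _ : V => ρ)) / Z := by
    rw [Finset.sum_div]; rfl
  rw [e, div_le_iff₀ (by linarith)]
  linarith

theorem gibbsMean_mul_le_half (hρ : EvenSubgaussian ρ) (K : V → V → ℝ) (u v : V) :
    gibbsMean ρ K (fun τ => τ u * τ v) ≤
      (gibbsMean ρ K (fun τ => τ u * τ u) + gibbsMean ρ K (fun τ => τ v * τ v)) / 2 := by
  have hi : ∀ x y : V, Integrable (fun τ : V → ℝ => τ x * τ y * Real.exp (pairEnergy K τ))
      (Measure.pi fun _ : V => ρ) := fun x y =>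
    ((linearGrowth_mul x y).tame.mul (linearGrowth_pairEnergy K).tame_exp).integrable hρ.expGauge
  have h := integral_mono (hi u v) (((hi u u).add (hi v v)).div_const 2) fun τ => by
    have := mul_nonneg (sq_nonneg (τ u - τ v)) (Real.exp_pos (pairEnergy K τ)).le
    simp only [Pi.add_apply]
    nlinarith
  simp only [Pi.add_apply] at h
  rw [integral_div, integral_add (hi u u) (hi v v)] at h
  unfold gibbsMean
  rw [← add_div, div_div, mul_comm _ (2 : ℝ), ← div_div]
  exact div_le_div_of_nonneg_right h (integral_exp_pairEnergy_pos hρ K).le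

end FiniteVolume

/-! ### Monotonicity in the volume -/

section Restrict

variable {ι : Type*} {ρ : Measure ℝ} [IsProbabilityMeasure ρ]

/-- Correlations of the model in a finite set increase with that set. -/
theorem gibbsMean_restrict_le (hρ : EvenSubgaussian ρ) {K : ι → ι → ℝ} (hK : ∀ x y, 0 ≤ K x y)
    {Λ Λ' : Finset ι} (h : Λ ⊆ Λ') (u v : Λ) :
    gibbsMean ρ (fun x y : Λ => K x y) (fun τ => τ u * τ v) ≤
      gibbsMean ρ (fun x y : Λ' => K x y)
        (fun τ => τ ⟨u, h u.2⟩ * τ ⟨v, h v.2⟩) := by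
  classical
  have hmap : Measure.pi (fun _ : Λ => ρ) =
      (Measure.pi fun _ : Λ' => ρ).map (Finset.restrict₂ (π := fun _ => ℝ) h) :=
    isProjectiveMeasureFamily_pi (fun _ : ι => ρ) Λ' Λ h
  -- The model in Λ is the model in Λ' with the couplings not internal to Λ switched off, since the
  -- remaining spins integrate to one. Restoring them increases correlations.
  set K₀ : Λ' → Λ' → ℝ := fun x y => if (x : ι) ∈ Λ ∧ (y : ι) ∈ Λ then K x y else 0 with hK₀
  have hE : ∀ τ : Λ' → ℝ, pairEnergy (fun x y : Λ => K x y)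
      (Finset.restrict₂ (π := fun _ => ℝ) h τ) = pairEnergy K₀ τ := by
    intro τ
    set t : ι → ℝ := fun x => if hx : x ∈ Λ' then τ ⟨x, hx⟩ else 0 with ht
    have ht' : ∀ x : Λ', τ x = t x := fun x => by simp [ht]
    have ht'' : ∀ x : Λ, Finset.restrict₂ (π := fun _ => ℝ) h τ x = t x := fun x => by
      simp [ht, Finset.restrict₂, h x.2]
    simp only [pairEnergy, ht', ht'']
    have e1 : ∑ x : Λ, ∑ y : Λ, K x y * t x * t y = ∑ x ∈ Λ, ∑ y ∈ Λ, K x y * t x * t y := by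
      rw [← Finset.sum_coe_sort Λ]
      exact Finset.sum_congr rfl fun x _ => Finset.sum_coe_sort Λ fun y => K x y * t x * t y
    have e2 : ∑ x : Λ', ∑ y : Λ', K₀ x y * t x * t y =
        ∑ x ∈ Λ', ∑ y ∈ Λ', (if x ∈ Λ ∧ y ∈ Λ then K x y else 0) * t x * t y := by
      rw [← Finset.sum_coe_sort Λ']
      exact Finset.sum_congr rfl fun x _ => Finset.sum_coe_sort Λ' fun y =>
        (if (x : ι) ∈ Λ ∧ y ∈ Λ then K x y else 0) * t x * t y
    rw [e1, e2, ← Finset.sum_subset h fun x _ hx => Finset.sum_eq_zero fun y _ => by simp [hx]]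
    refine Finset.sum_congr rfl fun x hx => ?_
    rw [← Finset.sum_subset h fun y _ hy => by simp [hy]]
    exact Finset.sum_congr rfl fun y hy => by simp [hx, hy]
  have hmeas : Measurable (Finset.restrict₂ (π := fun _ : ι => ℝ) h) :=
    Finset.measurable_restrict₂ h
  have heq : gibbsMean ρ (fun x y : Λ => K x y) (fun τ => τ u * τ v) =
      gibbsMean ρ K₀ (fun τ => τ ⟨u, h u.2⟩ * τ ⟨v, h v.2⟩) := by
    unfold gibbsMean
    have hEm := (linearGrowth_pairEnergy fun x y : Λ => K x y).1.exp
    rw [hmap, integral_map hmeas.aemeasurable hEm.aestronglyMeasurable,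
      integral_map (f := fun τ : Λ → ℝ => τ u * τ v *
        Real.exp (pairEnergy (fun x y : Λ => K x y) τ)) hmeas.aemeasurable
        ((linearGrowth_mul u v).1.mul hEm).aestronglyMeasurable]
    simp only [hE]
    rfl
  rw [heq]
  refine gibbsMean_mul_mono hρ (fun x y => ?_) (fun x y => ?_) _ _
  · simp only [hK₀]; split_ifs
    · exact hK _ _
    · exact le_rfl
  · simp only [hK₀]; split_ifs
    · exact le_rfl
    · exact hK _ _

end Restrict

end GSModel

namespace GSModel

/-! ### The two-point function on the lattice -/

section Lattice

variable {d : ℕ} {J β : ℝ} {ρ : ProbabilityMeasure ℝ}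

theorem nnCoupling_nonneg (hJ : 0 ≤ J) (x y : Site d) : 0 ≤ nnCoupling J x y := by
  unfold nnCoupling; split_ifs <;> simp [hJ]

theorem nnCoupling_comm (x y : Site d) : nnCoupling J x y = nnCoupling J y x := by
  simp only [nnCoupling, abs_sub_comm]

theorem twoPointIn_eq {Λ : Finset (Site d)} {x y : Site d} (hx : x ∈ Λ) (hy : y ∈ Λ) :
    twoPointIn J ρ β Λ x y = gibbsMean (ρ : Measure ℝ)
      (fun a b : Λ => β / 2 * nnCoupling J (a : Site d) b) (fun τ => τ ⟨x, hx⟩ * τ ⟨y, hy⟩) := by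
  have h : ∀ τ : Λ → ℝ, -β * hamiltonian J 0 Λ τ =
      pairEnergy (fun a b : Λ => β / 2 * nnCoupling J (a : Site d) b) τ := by
    intro τ
    simp only [hamiltonian, pairEnergy, mul_assoc, ← Finset.mul_sum]
    ring
  simp only [twoPointIn, gibbsExpectation, gibbsMean, h, spin, hx, hy, dif_pos]

theorem twoPointIn_eq_zero {Λ : Finset (Site d)} {x y : Site d} (h : ¬ (x ∈ Λ ∧ y ∈ Λ)) :
    twoPointIn J ρ β Λ x y = 0 := by
  have h' : ∀ τ : Λ → ℝ, spin Λ x τ * spin Λ y τ = 0 := by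
    intro τ
    by_cases hx : x ∈ Λ
    · have hy : y ∉ Λ := fun hy => h ⟨hx, hy⟩
      simp [spin, hy]
    · simp [spin, hx]
  simp [twoPointIn, gibbsExpectation, h']

theorem twoPointIn_nonneg (hρ : EvenSubgaussian (ρ : Measure ℝ)) (hJ : 0 ≤ J) (hβ : 0 ≤ β)
    (Λ : Finset (Site d)) (x y : Site d) : 0 ≤ twoPointIn J ρ β Λ x y := by
  by_cases h : x ∈ Λ ∧ y ∈ Λ
  · rw [twoPointIn_eq h.1 h.2]
    exact gibbsMean_mul_nonneg hρ
      (fun a b => mul_nonneg (by positivity) (nnCoupling_nonneg hJ _ _)) _ _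
  · rw [twoPointIn_eq_zero h]

theorem twoPointIn_mono (hρ : EvenSubgaussian (ρ : Measure ℝ)) (hJ : 0 ≤ J) (hβ : 0 ≤ β)
    {Λ Λ' : Finset (Site d)} (hΛ : Λ ⊆ Λ') (x y : Site d) :
    twoPointIn J ρ β Λ x y ≤ twoPointIn J ρ β Λ' x y := by
  by_cases h : x ∈ Λ ∧ y ∈ Λ
  · rw [twoPointIn_eq h.1 h.2, twoPointIn_eq (hΛ h.1) (hΛ h.2)]
    exact gibbsMean_restrict_le hρ (K := fun a b => β / 2 * nnCoupling J a b)
      (fun a b => mul_nonneg (by positivity) (nnCoupling_nonneg hJ _ _)) hΛ ⟨x, h.1⟩ ⟨y, h.2⟩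
  · rw [twoPointIn_eq_zero h]
    exact twoPointIn_nonneg hρ hJ hβ _ _ _

/-- Bijections of the lattice that preserve the `ℓ¹` distance. -/
def IsLatticeIso (g : Equiv.Perm (Site d)) : Prop :=
  ∀ a b, ∑ i, |g a i - g b i| = ∑ i, |a i - b i|

theorem isLatticeIso_of_perm {g : Equiv.Perm (Site d)} (σ : Equiv.Perm (Fin d))
    (h : ∀ a b i, |g a i - g b i| = |a (σ i) - b (σ i)|) : IsLatticeIso g := fun a b => by
  simp only [h]
  exact Equiv.sum_comp σ fun i => |a i - b i|

theorem isLatticeIso_addRight (y : Site d) : IsLatticeIso (Equiv.addRight y) := fun a b => by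
  simp

theorem IsLatticeIso.nnCoupling {g : Equiv.Perm (Site d)} (hg : IsLatticeIso g) (a b : Site d) :
    nnCoupling J (g a) (g b) = nnCoupling J a b := by
  simp only [GSModel.nnCoupling, hg a b]

theorem IsLatticeIso.twoPointIn_map {g : Equiv.Perm (Site d)} (hg : IsLatticeIso g)
    (Λ : Finset (Site d)) (u v : Site d) :
    twoPointIn J ρ β (Λ.map g.toEmbedding) (g u) (g v) = twoPointIn J ρ β Λ u v := by
  by_cases h : u ∈ Λ ∧ v ∈ Λ
  · have hm : ∀ x, x ∈ Λ ↔ g x ∈ Λ.map g.toEmbedding := fun x => by simp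
    rw [twoPointIn_eq ((hm _).1 h.1) ((hm _).1 h.2), twoPointIn_eq h.1 h.2]
    have key := gibbsMean_equiv (ρ := (ρ : Measure ℝ)) (g.subtypeEquiv hm)
      (fun a b => β / 2 * GSModel.nnCoupling J (a : Site d) b) ⟨u, h.1⟩ ⟨v, h.2⟩
    simpa only [Equiv.subtypeEquiv_apply, hg.nnCoupling] using key
  · rw [twoPointIn_eq_zero h, twoPointIn_eq_zero]
    simpa using h

/-- The box `{-m, …, m}^d`. -/
noncomputable def box (d m : ℕ) : Finset (Site d) := Fintype.piFinset fun _ => Finset.Icc (-(m : ℤ)) m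

theorem mem_box {m : ℕ} {x : Site d} : x ∈ box d m ↔ ∀ i, |x i| ≤ m := by
  simp [box, abs_le]

theorem card_box (d m : ℕ) : (box d m).card = (2 * m + 1) ^ d := by
  simp only [box, Fintype.card_piFinset, Int.card_Icc, Finset.prod_const, Finset.card_univ,
    Fintype.card_fin]
  congr 1
  omega

theorem exists_subset_box (Λ : Finset (Site d)) : ∃ m, Λ ⊆ box d m := by
  refine ⟨∑ x ∈ Λ, ∑ i, (x i).natAbs, fun x hx => mem_box.2 fun i => ?_⟩
  have h1 : (x i).natAbs ≤ ∑ i, (x i).natAbs :=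
    Finset.single_le_sum (f := fun i => (x i).natAbs) (fun _ _ => Nat.zero_le _)
      (Finset.mem_univ i)
  have h2 : ∑ i, (x i).natAbs ≤ ∑ x ∈ Λ, ∑ i, (x i).natAbs :=
    Finset.single_le_sum (f := fun x : Site d => ∑ i, (x i).natAbs) (fun _ _ => Nat.zero_le _) hx
  rw [Int.abs_eq_natAbs]
  exact_mod_cast h1.trans h2

theorem abs_sub_le_one_of_adj {x y : Site d} (h : ∑ i, |x i - y i| = 1) (i : Fin d) :
    |x i - y i| ≤ 1 := by
  rw [← h]
  exact Finset.single_le_sum (f := fun i => |x i - y i|) (fun _ _ => abs_nonneg _)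
    (Finset.mem_univ i)

theorem summable_nnCoupling (x : Site d) : Summable (nnCoupling J x) := by
  refine summable_of_ne_finset_zero (s := (box d 1).map (addRightEmbedding x)) fun y hy => ?_
  unfold nnCoupling
  refine if_neg fun h => hy ?_
  refine Finset.mem_map.2 ⟨y - x, mem_box.2 fun i => ?_, by simp⟩
  rw [Pi.sub_apply, abs_sub_comm]
  simpa using abs_sub_le_one_of_adj h i

theorem tsum_nnCoupling (x : Site d) : ∑' y, nnCoupling J x y = totalCoupling d J := by
  unfold totalCoupling
  rw [← (Equiv.addRight x).tsum_eq (nnCoupling J x)]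
  refine tsum_congr fun y => ?_
  have := (isLatticeIso_addRight x).nnCoupling (J := J) 0 y
  simpa using this

theorem sum_nnCoupling_le (hJ : 0 ≤ J) (Λ : Finset (Site d)) (x : Site d) :
    ∑ y ∈ Λ, nnCoupling J x y ≤ totalCoupling d J := by
  rw [← tsum_nnCoupling x]
  exact (summable_nnCoupling x).sum_le_tsum _ fun y _ => nnCoupling_nonneg hJ x y

theorem totalCoupling_nonneg (hJ : 0 ≤ J) : 0 ≤ totalCoupling d J :=
  tsum_nonneg fun y => nnCoupling_nonneg hJ 0 y

theorem sum_twoPointIn_self_le (hρ : EvenSubgaussian (ρ : Measure ℝ)) (hJ : 0 ≤ J) (hβ : 0 ≤ β)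
    (Λ : Finset (Site d)) :
    ∑ x ∈ Λ, twoPointIn J ρ β Λ x x ≤ Λ.card *
      Real.log (∫ t, Real.exp ((β / 2 * totalCoupling d J + 1) * t ^ 2) ∂(ρ : Measure ℝ)) := by
  have h1 : ∀ x : Site d, ∑ y : Λ, β / 2 * nnCoupling J x y ≤ β / 2 * totalCoupling d J := by
    intro x
    rw [← Finset.mul_sum, Finset.sum_coe_sort Λ fun y => nnCoupling J x y]
    exact mul_le_mul_of_nonneg_left (sum_nnCoupling_le hJ Λ x) (by positivity)
  have h := sum_gibbsMean_sq_le hρ (K := fun a b : Λ => β / 2 * nnCoupling J (a : Site d) b)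
    (fun a b => mul_nonneg (by positivity) (nnCoupling_nonneg hJ _ _)) (fun x => h1 x)
    (fun y => by simpa only [nnCoupling_comm _ (y : Site d)] using h1 y)
  rw [Fintype.card_coe] at h
  refine le_trans (le_of_eq ?_) h
  rw [← Finset.sum_coe_sort Λ]
  exact Finset.sum_congr rfl fun x _ => twoPointIn_eq x.2 x.2

/-- Only the average of second moments over a volume is controlled directly. Volume monotonicity
turns this into a bound at one site: with Λ inside the box of radius m, its (2m+1)^d translates by
that box all fit into the box of radius 2m, of cardinality at most 2^d times larger. Off-diagonal
values follow from 2|τ_x τ_y| ≤ τ_x² + τ_y². -/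
theorem exists_twoPointIn_le (hρ : EvenSubgaussian (ρ : Measure ℝ)) (hJ : 0 ≤ J) (hβ : 0 ≤ β) :
    ∃ B : ℝ, ∀ (Λ : Finset (Site d)) (x y : Site d), twoPointIn J ρ β Λ x y ≤ B := by
  set b := Real.log (∫ t, Real.exp ((β / 2 * totalCoupling d J + 1) * t ^ 2) ∂(ρ : Measure ℝ))
    with hb
  have hnn := twoPointIn_nonneg (d := d) hρ hJ hβ
  have hb0 : 0 ≤ b := by
    have := (hnn {0} 0 0).trans
      (by simpa using sum_twoPointIn_self_le (d := d) hρ hJ hβ {0})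
    exact this
  have h0 : ∀ Λ : Finset (Site d), twoPointIn J ρ β Λ 0 0 ≤ 2 ^ d * b := by
    intro Λ
    obtain ⟨m, hm⟩ := exists_subset_box Λ
    have hsub : ∀ y ∈ box d m, Λ.map (Equiv.addRight y).toEmbedding ⊆ box d (2 * m) := by
      intro y hy x hx
      obtain ⟨z, hz, rfl⟩ := Finset.mem_map.1 hx
      refine mem_box.2 fun i => ?_
      have h1 := mem_box.1 (hm hz) i
      have h2 := mem_box.1 hy i
      have h3 := abs_add_le (z i) (y i)
      simp only [Equiv.coe_toEmbedding, Equiv.coe_addRight, Pi.add_apply]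
      push_cast
      linarith
    have h1 : ∑ _y ∈ box d m, twoPointIn J ρ β Λ 0 0 ≤
        ∑ y ∈ box d (2 * m), twoPointIn J ρ β (box d (2 * m)) y y := by
      refine (Finset.sum_le_sum fun y hy => ?_).trans
        (Finset.sum_le_sum_of_subset_of_nonneg (s := box d m) (fun x hx => mem_box.2 fun i => ?_)
          fun y _ _ => hnn _ y y)
      · rw [← (isLatticeIso_addRight y).twoPointIn_map]
        simpa using twoPointIn_mono hρ hJ hβ (hsub y hy) y y
      · have := mem_box.1 hx i
        push_cast
        linarith [abs_nonneg (x i)]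
    have h2 := h1.trans (sum_twoPointIn_self_le hρ hJ hβ _)
    rw [Finset.sum_const, card_box, card_box, nsmul_eq_mul, ← hb] at h2
    push_cast at h2
    have h3 : (2 * (2 * (m : ℝ)) + 1) ^ d ≤ (2 * m + 1) ^ d * 2 ^ d := by
      rw [← mul_pow]
      gcongr
      linarith
    have h4 : (0 : ℝ) < (2 * m + 1) ^ d := by positivity
    refine le_of_mul_le_mul_left (h2.trans ?_) h4
    calc _ ≤ (2 * (m : ℝ) + 1) ^ d * 2 ^ d * b := mul_le_mul_of_nonneg_right h3 hb0
      _ = _ := mul_assoc _ _ _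
  have hs : ∀ (Λ : Finset (Site d)) (x : Site d), twoPointIn J ρ β Λ x x ≤ 2 ^ d * b := by
    intro Λ x
    rw [← (isLatticeIso_addRight (-x)).twoPointIn_map]
    simpa using h0 _
  refine ⟨2 ^ d * b, fun Λ x y => ?_⟩
  by_cases h : x ∈ Λ ∧ y ∈ Λ
  · have h1 := hs Λ x
    have h2 := hs Λ y
    rw [twoPointIn_eq h.1 h.1] at h1
    rw [twoPointIn_eq h.2 h.2] at h2
    rw [twoPointIn_eq h.1 h.2]
    exact (gibbsMean_mul_le_half hρ _ _ _).trans (by linarith)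
  · rw [twoPointIn_eq_zero h]
    positivity

theorem tendsto_twoPoint (hρ : EvenSubgaussian (ρ : Measure ℝ)) (hJ : 0 ≤ J) (hβ : 0 ≤ β)
    (x : Site d) :
    Tendsto (fun Λ => twoPointIn J ρ β Λ 0 x) atTop (𝓝 (twoPoint J ρ β x)) := by
  obtain ⟨B, hB⟩ := exists_twoPointIn_le (d := d) hρ hJ hβ
  have h := tendsto_atTop_ciSup (f := fun Λ => twoPointIn J ρ β Λ 0 x)
    (fun Λ Λ' h => twoPointIn_mono hρ hJ hβ h 0 x)
    ⟨B, by rintro _ ⟨Λ, rfl⟩; exact hB Λ 0 x⟩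
  rw [twoPoint, h.limUnder_eq]
  exact h

theorem twoPointIn_zero_le (hρ : EvenSubgaussian (ρ : Measure ℝ)) (hJ : 0 ≤ J) (hβ : 0 ≤ β)
    (Λ : Finset (Site d)) (x : Site d) : twoPointIn J ρ β Λ 0 x ≤ twoPoint J ρ β x :=
  Monotone.ge_of_tendsto (fun _ _ h => twoPointIn_mono hρ hJ hβ h 0 x)
    (tendsto_twoPoint hρ hJ hβ x) Λ

theorem twoPoint_nonneg (hρ : EvenSubgaussian (ρ : Measure ℝ)) (hJ : 0 ≤ J) (hβ : 0 ≤ β)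
    (x : Site d) : 0 ≤ twoPoint J ρ β x :=
  (twoPointIn_nonneg hρ hJ hβ ∅ 0 x).trans (twoPointIn_zero_le hρ hJ hβ ∅ x)

theorem twoPoint_le_of_forall (hρ : EvenSubgaussian (ρ : Measure ℝ)) (hJ : 0 ≤ J) (hβ : 0 ≤ β)
    {x : Site d} {B : ℝ} (h : ∀ Λ, twoPointIn J ρ β Λ 0 x ≤ B) : twoPoint J ρ β x ≤ B :=
  le_of_tendsto' (tendsto_twoPoint hρ hJ hβ x) h

theorem twoPointIn_le (hρ : EvenSubgaussian (ρ : Measure ℝ)) (hJ : 0 ≤ J) (hβ : 0 ≤ β)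
    (Λ : Finset (Site d)) (x y : Site d) : twoPointIn J ρ β Λ x y ≤ twoPoint J ρ β (y - x) := by
  rw [← (isLatticeIso_addRight (-x)).twoPointIn_map]
  simpa [sub_eq_add_neg] using twoPointIn_zero_le hρ hJ hβ
    (Λ.map (Equiv.addRight (-x)).toEmbedding) (y - x)

theorem exists_twoPoint_le (hρ : EvenSubgaussian (ρ : Measure ℝ)) (hJ : 0 ≤ J) (hβ : 0 ≤ β) :
    ∃ B : ℝ, ∀ x : Site d, twoPoint J ρ β x ≤ B := by
  obtain ⟨B, hB⟩ := exists_twoPointIn_le (d := d) hρ hJ hβ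
  exact ⟨B, fun x => twoPoint_le_of_forall hρ hJ hβ fun Λ => hB Λ 0 x⟩

theorem IsLatticeIso.twoPoint_le (hρ : EvenSubgaussian (ρ : Measure ℝ)) (hJ : 0 ≤ J) (hβ : 0 ≤ β)
    {g : Equiv.Perm (Site d)} (hg : IsLatticeIso g) (h0 : g 0 = 0) (x : Site d) :
    twoPoint J ρ β x ≤ twoPoint J ρ β (g x) :=
  twoPoint_le_of_forall hρ hJ hβ fun Λ => by
    rw [← hg.twoPointIn_map, h0]
    exact twoPointIn_zero_le hρ hJ hβ _ _

/-- The Messager-Miracle-Sole inequality for a reflection of the lattice. -/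
theorem twoPoint_reflection_le (hρ : EvenSubgaussian (ρ : Measure ℝ)) (hJ : 0 ≤ J) (hβ : 0 ≤ β)
    {θ : Equiv.Perm (Site d)} (hθ : ∀ x, θ (θ x) = x) (hiso : IsLatticeIso θ)
    {P : Site d → Prop} (hP : ∀ x, P x → ¬ P (θ x)) (hcover : ∀ x, P x ∨ P (θ x) ∨ θ x = x)
    (hadj : ∀ x y, P x → P (θ y) → ∑ i, |x i - y i| = 1 → y = θ x)
    (h0 : P 0 ∨ θ 0 = 0) {x : Site d} (hx : P x ∨ θ x = x) :
    twoPoint J ρ β (θ x) ≤ twoPoint J ρ β x := by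
  refine twoPoint_le_of_forall hρ hJ hβ fun Λ => ?_
  -- Free boundary conditions in Λ break the reflection symmetry; enlarging Λ to a θ-invariant set
  -- only increases the left-hand side.
  set Λ' := Λ ∪ Λ.map θ.toEmbedding
  have hm : ∀ y, y ∈ Λ' ↔ θ y ∈ Λ' := by
    have : ∀ y, y ∈ Λ' → θ y ∈ Λ' := by
      intro y hy
      rcases Finset.mem_union.1 hy with h | h
      · exact Finset.mem_union_right _ (by simpa using h)
      · obtain ⟨z, hz, rfl⟩ := Finset.mem_map.1 h
        exact Finset.mem_union_left _ (by simpa [hθ] using hz)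
    exact fun y => ⟨this y, fun h => by simpa [hθ] using this _ h⟩
  have hsub : Λ ⊆ Λ' := Finset.subset_union_left
  refine (twoPointIn_mono hρ hJ hβ hsub 0 (θ x)).trans ?_
  by_cases h : 0 ∈ Λ' ∧ θ x ∈ Λ'
  · have hx' : x ∈ Λ' := (hm x).2 h.2
    refine le_trans ?_ (twoPointIn_zero_le hρ hJ hβ Λ' x)
    rw [twoPointIn_eq h.1 h.2, twoPointIn_eq h.1 hx']
    refine gibbsMean_mul_reflection_le hρ (θ := θ.subtypeEquiv hm) (P := fun y => P y)
      (fun a b => mul_nonneg (by positivity) (nnCoupling_nonneg hJ _ _))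
      (fun v => Subtype.ext (hθ v)) (fun v => hP v)
      (fun v => by simpa [Subtype.ext_iff] using hcover v)
      (fun a b => by simp [hiso.nnCoupling]) (fun a b ha hb hab => ?_)
      (u := ⟨0, h.1⟩) (v := ⟨x, hx'⟩) (by simpa [Subtype.ext_iff] using h0)
      (by simpa [Subtype.ext_iff] using hx)
    have hz : nnCoupling J (a : Site d) b = 0 :=
      if_neg fun hs => hab (Subtype.ext (hadj a b ha hb hs))
    rw [nnCoupling_comm (b : Site d), hz]
    simp
  · rw [twoPointIn_eq_zero h]
    exact twoPoint_nonneg hρ hJ hβ x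

end Lattice

end GSModel

namespace GSModel

/-! ### Monotonicity of the two-point function -/

section Monotonicity

variable {d : ℕ} {J β : ℝ} {ρ : ProbabilityMeasure ℝ}

/-- The reflection `x_i ↦ m - x_i`. -/
def planeReflection (i : Fin d) (m : ℤ) : Equiv.Perm (Site d) :=
  Function.Involutive.toPerm (fun x => Function.update x i (m - x i)) fun x => by simp

@[simp] theorem planeReflection_apply (i : Fin d) (m : ℤ) (x : Site d) :
    planeReflection i m x = Function.update x i (m - x i) := rfl

theorem isLatticeIso_planeReflection (i : Fin d) (m : ℤ) :
    IsLatticeIso (planeReflection i m) :=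
  isLatticeIso_of_perm (Equiv.refl _) fun a b k => by
    rcases eq_or_ne k i with rfl | hk
    · simp [abs_sub_comm]
    · simp [hk]

/-- The reflection `x_i ↦ x_j + m`, `x_j ↦ x_i - m`. -/
def diagonalReflection (i j : Fin d) (m : ℤ) : Equiv.Perm (Site d) :=
  Function.Involutive.toPerm
    (fun x k => x (Equiv.swap i j k) + (if k = i then m else 0) - (if k = j then m else 0))
    fun x => by
      ext k
      have h1 : Equiv.swap i j k = i ↔ k = j := by
        rw [Equiv.swap_apply_eq_iff, Equiv.swap_apply_left]
      have h2 : Equiv.swap i j k = j ↔ k = i := by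
        rw [Equiv.swap_apply_eq_iff, Equiv.swap_apply_right]
      simp only [Equiv.swap_apply_self, h1, h2]
      ring

theorem diagonalReflection_apply (i j : Fin d) (m : ℤ) (x : Site d) (k : Fin d) :
    diagonalReflection i j m x k =
      x (Equiv.swap i j k) + (if k = i then m else 0) - (if k = j then m else 0) := rfl

theorem isLatticeIso_diagonalReflection (i j : Fin d) (m : ℤ) :
    IsLatticeIso (diagonalReflection i j m) :=
  isLatticeIso_of_perm (Equiv.swap i j) fun a b k => by
    simp [diagonalReflection_apply]

theorem diagonalReflection_left {i j : Fin d} (hij : i ≠ j) (m : ℤ) (x : Site d) :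
    diagonalReflection i j m x i = x j + m := by
  simp [diagonalReflection_apply, hij]

theorem diagonalReflection_right {i j : Fin d} (hij : i ≠ j) (m : ℤ) (x : Site d) :
    diagonalReflection i j m x j = x i - m := by
  simp [diagonalReflection_apply, hij.symm]

theorem diagonalReflection_of_ne {i j k : Fin d} (hi : k ≠ i) (hj : k ≠ j) (m : ℤ)
    (x : Site d) : diagonalReflection i j m x k = x k := by
  simp [diagonalReflection_apply, hi, hj, Equiv.swap_apply_of_ne_of_ne]

theorem abs_add_abs_le_sum {i j : Fin d} (hij : i ≠ j) (x : Site d) :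
    |x i| + |x j| ≤ ∑ k, |x k| := by
  rw [← Finset.sum_pair (f := fun k => |x k|) hij]
  exact Finset.sum_le_sum_of_subset_of_nonneg (Finset.subset_univ _) fun _ _ _ => abs_nonneg _

/-- Reflection in the plane y_i = x_i + 1/2 between lattice sites: it has no fixed points, and a
nearest-neighbour edge crossing it joins mirror images. -/
theorem twoPoint_update_add_one_le (hρ : EvenSubgaussian (ρ : Measure ℝ)) (hJ : 0 ≤ J)
    (hβ : 0 ≤ β) (i : Fin d) {x : Site d} (hx : 0 ≤ x i) :
    twoPoint J ρ β (Function.update x i (x i + 1)) ≤ twoPoint J ρ β x := by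
  have h := twoPoint_reflection_le hρ hJ hβ (θ := planeReflection i (2 * x i + 1))
    (P := fun y => 2 * y i < 2 * x i + 1) (x := x) (fun y => by simp)
    (isLatticeIso_planeReflection i _) (fun y hy => by simp; omega)
    (fun y => by simp; omega) (fun a b ha hb hab => ?_) (Or.inl (by simp; omega))
    (Or.inl (by simp))
  · refine le_trans (le_of_eq ?_) h
    rw [planeReflection_apply]
    congr 2
    ring
  · simp only [planeReflection_apply, Function.update_self] at hb
    have h1 := abs_le.1 (abs_sub_le_one_of_adj hab i)
    ext k
    rcases eq_or_ne k i with rfl | hk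
    · simp; omega
    · have h2 := abs_add_abs_le_sum hk (a - b)
      simp only [Pi.sub_apply, hab] at h2
      have h3 : 1 ≤ |a i - b i| := Int.one_le_abs (by omega)
      have h4 : a k - b k = 0 := abs_nonpos_iff.1 (by omega)
      simp [hk]; omega

theorem twoPoint_update_neg (hρ : EvenSubgaussian (ρ : Measure ℝ)) (hJ : 0 ≤ J)
    (hβ : 0 ≤ β) (i : Fin d) (x : Site d) :
    twoPoint J ρ β x ≤ twoPoint J ρ β (Function.update x i (-x i)) := by
  have h := (isLatticeIso_planeReflection i 0).twoPoint_le hρ hJ hβ (J := J)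
    (by ext k; simp [Function.update_apply]) x
  simpa using h

theorem twoPoint_update_le (hρ : EvenSubgaussian (ρ : Measure ℝ)) (hJ : 0 ≤ J)
    (hβ : 0 ≤ β) (i : Fin d) (x : Site d) {s t : ℤ} (h : |s| ≤ |t|) :
    twoPoint J ρ β (Function.update x i t) ≤ twoPoint J ρ β (Function.update x i s) := by
  have habs : ∀ r : ℤ, twoPoint J ρ β (Function.update x i r) =
      twoPoint J ρ β (Function.update x i |r|) := by
    have hneg : ∀ r : ℤ, twoPoint J ρ β (Function.update x i r) ≤
        twoPoint J ρ β (Function.update x i (-r)) := fun r => by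
      simpa using twoPoint_update_neg hρ hJ hβ i (Function.update x i r)
    intro r
    rcases abs_choice r with hr | hr <;> rw [hr]
    exact le_antisymm (hneg r) (by simpa using hneg (-r))
  rw [habs s, habs t]
  obtain ⟨n, hn⟩ := Int.le.dest h
  rw [← hn]
  clear hn
  induction n with
  | zero => simp
  | succ n ih =>
    refine le_trans ?_ ih
    have := twoPoint_update_add_one_le hρ hJ hβ i (x := Function.update x i (|s| + n))
      (by simp; positivity)
    simpa [add_assoc] using this

/-- The two-point function decreases in the absolute value of each coordinate. -/
theorem twoPoint_le_of_abs_le (hρ : EvenSubgaussian (ρ : Measure ℝ)) (hJ : 0 ≤ J)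
    (hβ : 0 ≤ β) {x y : Site d} (h : ∀ i, |x i| ≤ |y i|) :
    twoPoint J ρ β y ≤ twoPoint J ρ β x := by
  have key : ∀ s : Finset (Fin d),
      twoPoint J ρ β y ≤ twoPoint J ρ β (fun i => if i ∈ s then x i else y i) := by
    intro s
    induction s using Finset.induction_on with
    | empty => simp
    | insert i s hi ih =>
      refine ih.trans ?_
      have h1 := twoPoint_update_le (J := J) hρ hJ hβ i
        (fun k => if k ∈ s then x k else y k) (h i)
      have e1 : Function.update (fun k => if k ∈ s then x k else y k) i (y i) =
          fun k => if k ∈ s then x k else y k :=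
        Function.update_eq_self_iff.2 (by simp [hi])
      have e2 : Function.update (fun k => if k ∈ s then x k else y k) i (x i) =
          fun k => if k ∈ insert i s then x k else y k := by
        ext k
        rcases eq_or_ne k i with rfl | hk
        · simp
        · simp [hk]
      rwa [e1, e2] at h1
  simpa using key Finset.univ

/-- The mirror y_i - y_j = x_i sends (x_i, x_j) to (x_i + x_j, 0). No edge crosses it, because a
step changes y_i - y_j by at most one and sites strictly on opposite sides differ by at least two.
The signs of x_i and x_j put 0 and x on the same closed side. -/
theorem twoPoint_diagonalReflection_le (hρ : EvenSubgaussian (ρ : Measure ℝ)) (hJ : 0 ≤ J)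
    (hβ : 0 ≤ β) {i j : Fin d} (hij : i ≠ j) {x : Site d} (hi : 0 ≤ x i) (hj : 0 ≤ x j) :
    twoPoint J ρ β (diagonalReflection i j (x i) x) ≤ twoPoint J ρ β x := by
  have hfix : ∀ (m : ℤ) (y : Site d), y i - y j = m → diagonalReflection i j m y = y := by
    intro m y hy
    ext k
    rcases eq_or_ne k i with rfl | hki
    · rw [diagonalReflection_left hij]; omega
    rcases eq_or_ne k j with rfl | hkj
    · rw [diagonalReflection_right hij]; omega
    · exact diagonalReflection_of_ne hki hkj m y
  refine twoPoint_reflection_le hρ hJ hβ (θ := diagonalReflection i j (x i))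
    (P := fun y => y i - y j < x i) (Function.Involutive.toPerm_involutive _)
    (isLatticeIso_diagonalReflection i j _) (fun y hy => ?_)
    (fun y => ?_) (fun a b ha hb hab => ?_) ?_ ?_
  · rw [diagonalReflection_left hij, diagonalReflection_right hij]; omega
  · rw [diagonalReflection_left hij, diagonalReflection_right hij]
    rcases lt_trichotomy (y i - y j) (x i) with h | h | h
    · exact Or.inl h
    · exact Or.inr (Or.inr (hfix _ _ h))
    · exact Or.inr (Or.inl (by omega))
  · exfalso
    simp only [diagonalReflection_left hij, diagonalReflection_right hij] at hb
    have h2 := abs_add_abs_le_sum hij (a - b)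
    simp only [Pi.sub_apply, hab] at h2
    have h3 := neg_abs_le (a i - b i)
    have h4 := le_abs_self (a j - b j)
    omega
  · rcases hi.eq_or_lt with h | h
    · exact Or.inr (hfix _ _ (by simpa using h))
    · exact Or.inl (by simpa using h)
  · rcases hj.eq_or_lt with h | h
    · exact Or.inr (hfix _ _ (by omega))
    · exact Or.inl (by omega)

/-- The mass of a site can be moved onto one coordinate axis. -/
theorem twoPoint_single_sum_le (hρ : EvenSubgaussian (ρ : Measure ℝ)) (hJ : 0 ≤ J)
    (hβ : 0 ≤ β) (i : Fin d) {x : Site d} (hx : ∀ k, 0 ≤ x k) :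
    twoPoint J ρ β (Pi.single i (∑ k, x k)) ≤ twoPoint J ρ β x := by
  have key : ∀ s : Finset (Fin d), i ∉ s → twoPoint J ρ β
      (fun k => if k = i then x i + ∑ l ∈ s, x l else if k ∈ s then 0 else x k) ≤
        twoPoint J ρ β x := by
    intro s
    induction s using Finset.induction_on with
    | empty =>
      intro _
      refine le_of_eq (congrArg _ ?_)
      ext k
      by_cases h : k = i <;> simp [h]
    | insert j s hj ih =>
      intro hi
      rw [Finset.mem_insert, not_or] at hi
      refine le_trans ?_ (ih hi.2)
      set y : Site d := fun k => if k = i then x i + ∑ l ∈ s, x l else if k ∈ s then 0 else x k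
        with hy
      have hyi : y i = x i + ∑ l ∈ s, x l := by simp [hy]
      have hyj : y j = x j := by simp [hy, Ne.symm hi.1, hj]
      refine le_trans (le_of_eq (congrArg _ ?_))
        (twoPoint_diagonalReflection_le hρ hJ hβ (x := y) hi.1
          (hyi ▸ add_nonneg (hx i) (Finset.sum_nonneg fun k _ => hx k)) (hyj ▸ hx j))
      ext k
      rcases eq_or_ne k i with rfl | hki
      · rw [diagonalReflection_left hi.1, hyi, hyj, if_pos rfl, Finset.sum_insert hj]; ring
      rcases eq_or_ne k j with rfl | hkj
      · rw [diagonalReflection_right hi.1]; simp [hki]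
      · rw [diagonalReflection_of_ne hki hkj]; simp [hy, hki, hkj]
  refine le_trans (le_of_eq (congrArg _ ?_)) (key (Finset.univ.erase i) (by simp))
  ext k
  rcases eq_or_ne k i with rfl | hk
  · simp
  · simp [hk]

theorem axisPoint_eq_single (i : Fin d) (hi : (i : ℕ) = 0) (n : ℕ) :
    axisPoint d n = Pi.single i (n : ℤ) := by
  ext k
  rcases eq_or_ne k i with rfl | hk
  · simp [axisPoint, hi]
  · have : (k : ℕ) ≠ 0 := fun h => hk (Fin.ext (h.trans hi.symm))
    simp [axisPoint, this, hk]

/-- All coordinates but the i-th are set to zero and the i-th is lowered to n, which only increases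
S; an exchange of coordinates then brings axis i to the first axis. -/
theorem twoPoint_le_axisPoint (hρ : EvenSubgaussian (ρ : Measure ℝ)) (hJ : 0 ≤ J)
    (hβ : 0 ≤ β) {x : Site d} {i : Fin d} {n : ℕ} (hx : (n : ℤ) ≤ |x i|) :
    twoPoint J ρ β x ≤ twoPoint J ρ β (axisPoint d n) := by
  set o : Fin d := ⟨0, i.pos⟩ with ho
  refine (twoPoint_le_of_abs_le hρ hJ hβ (x := Pi.single i (n : ℤ)) fun k => ?_).trans ?_
  · rcases eq_or_ne k i with rfl | hk
    · simpa using hx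
    · simp [hk]
  · refine ((isLatticeIso_diagonalReflection i o 0).twoPoint_le hρ hJ hβ
      (by ext k; simp [diagonalReflection_apply]) _).trans (le_of_eq (congrArg _ ?_))
    rw [axisPoint_eq_single o rfl]
    ext k
    simp [diagonalReflection_apply, Pi.single_apply, Equiv.swap_apply_eq_iff]

/-- S(x) is compared with its value at the corner (n, …, n), whose mass d·n is then collected on the
first axis. -/
theorem axisPoint_le_twoPoint (hd : 1 ≤ d) (hρ : EvenSubgaussian (ρ : Measure ℝ)) (hJ : 0 ≤ J)
    (hβ : 0 ≤ β) {x : Site d} {n : ℕ} (hx : ∀ i, |x i| ≤ n) :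
    twoPoint J ρ β (axisPoint d (d * n)) ≤ twoPoint J ρ β x := by
  refine le_trans (le_of_eq ?_) ((twoPoint_single_sum_le hρ hJ hβ (⟨0, hd⟩ : Fin d)
    (x := fun _ => (n : ℤ)) fun _ => by positivity).trans
      (twoPoint_le_of_abs_le hρ hJ hβ fun i => by simpa using hx i))
  rw [axisPoint_eq_single ⟨0, hd⟩ rfl]
  simp

end Monotonicity

end GSModel

namespace GSModel

/-! ### Exponential decay from a finite-volume criterion -/

section Decay

variable {d : ℕ} {J β : ℝ} {ρ : ProbabilityMeasure ℝ}

/-- The sites of the box `{-n, …, n}^d` with sup norm `n`. -/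
noncomputable def boxBoundary (d n : ℕ) : Finset (Site d) :=
  (box d n).filter fun x => ∃ i, |x i| = n

theorem card_boxBoundary_le (d n : ℕ) :
    (boxBoundary d n).card ≤ d * (2 * (2 * n + 1) ^ (d - 1)) := by
  classical
  set F : Fin d → Finset (Site d) := fun i => Fintype.piFinset fun k =>
    if k = i then {(n : ℤ), -(n : ℤ)} else Finset.Icc (-(n : ℤ)) n with hF
  have hsub : boxBoundary d n ⊆ Finset.univ.biUnion F := by
    intro x hx
    obtain ⟨hx, i, hi⟩ := Finset.mem_filter.1 hx
    refine Finset.mem_biUnion.2 ⟨i, Finset.mem_univ i, Fintype.mem_piFinset.2 fun k => ?_⟩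
    rcases eq_or_ne k i with rfl | hk
    · simpa using eq_or_eq_neg_of_abs_eq hi
    · simpa [hk, abs_le] using mem_box.1 hx k
  have hcard : ∀ i ∈ Finset.univ, (F i).card ≤ 2 * (2 * n + 1) ^ (d - 1) := by
    intro i _
    rw [hF, Fintype.card_piFinset, ← Finset.mul_prod_erase _ _ (Finset.mem_univ i)]
    refine Nat.mul_le_mul (by simpa using Finset.card_le_two) (le_of_eq ?_)
    rw [Finset.prod_congr rfl (g := fun _ => 2 * n + 1) fun k hk => ?_]
    · simp
    · rw [if_neg (Finset.ne_of_mem_erase hk), Int.card_Icc]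
      omega
  calc _ ≤ (Finset.univ.biUnion F).card := Finset.card_le_card hsub
    _ ≤ (Finset.univ : Finset (Fin d)).card * _ := Finset.card_biUnion_le_card_mul _ _ _ hcard
    _ = _ := by simp

theorem mem_boxBoundary_of_adj {n : ℕ} {x y : Site d} (hx : x ∈ box d n) (hy : y ∉ box d n)
    (h : ∑ i, |x i - y i| = 1) :
    x ∈ boxBoundary d n ∧ (∃ k, (n : ℤ) ≤ |x k| ∧ (n : ℤ) ≤ |y k|) ∧
      (∀ k, |x k| ≤ n + 1) ∧ ∀ k, |y k| ≤ n + 1 := by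
  have hx' := mem_box.1 hx
  have h1 : ∀ k, |y k| ≤ |x k| + 1 := fun k => by
    have h2 := abs_sub_le_one_of_adj h k
    have h3 := abs_sub_abs_le_abs_sub (y k) (x k)
    rw [abs_sub_comm] at h3
    omega
  obtain ⟨k, hk⟩ : ∃ k, ¬ |y k| ≤ (n : ℤ) := by
    by_contra hc
    exact hy (mem_box.2 fun k => not_not.1 fun hk => hc ⟨k, hk⟩)
  have hk1 := h1 k
  have hk2 := hx' k
  exact ⟨Finset.mem_filter.2 ⟨hx, k, by omega⟩, ⟨k, by omega, by omega⟩,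
    fun k => by have := hx' k; omega, fun k => by have := hx' k; have := h1 k; omega⟩

/-- The Simon-Lieb inequality for a box, with a bound `A` for the two-point function beyond it. -/
theorem twoPoint_le_mul_of_box (hρ : EvenSubgaussian (ρ : Measure ℝ))
    (hq : QuadPositive (ρ : Measure ℝ)) (hJ : 0 ≤ J) (hβ : 0 ≤ β) {n : ℕ} {z : Site d}
    {i : Fin d} (hz : (n : ℤ) < |z i|) {A : ℝ}
    (hA : ∀ w : Site d, |z i| - (n + 1) ≤ |w i| → twoPoint J ρ β w ≤ A) :
    twoPoint J ρ β z ≤ 2 * β * totalCoupling d J * (boxBoundary d n).card *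
      twoPoint J ρ β (axisPoint d n) * A := by
  classical
  set s := twoPoint J ρ β (axisPoint d n) with hs
  set T := totalCoupling d J
  have hs0 : 0 ≤ s := twoPoint_nonneg hρ hJ hβ _
  have hA0 : 0 ≤ A := (twoPoint_nonneg hρ hJ hβ z).trans (hA z (by omega))
  have hT : 0 ≤ T := totalCoupling_nonneg hJ
  refine twoPoint_le_of_forall hρ hJ hβ fun Λ => ?_
  by_cases h : 0 ∈ Λ ∧ z ∈ Λ
  swap
  · rw [twoPointIn_eq_zero h]; positivity
  rw [twoPointIn_eq h.1 h.2]
  have hc : ∀ a b : Site d, 0 ≤ β / 2 * nnCoupling J a b := fun a b =>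
    mul_nonneg (by positivity) (nnCoupling_nonneg hJ _ _)
  -- K keeps the couplings that do not cross the boundary of the box, D the crossing ones. Under K
  -- alone the sites 0 and z are decoupled, so only the sum over D survives in `gibbsMean_add_le`.
  set K : Λ → Λ → ℝ := fun a b =>
    if ((a : Site d) ∈ box d n ↔ (b : Site d) ∈ box d n) then β / 2 * nnCoupling J (a : Site d) b
    else 0 with hK
  set D : Λ → Λ → ℝ := fun a b =>
    if ((a : Site d) ∈ box d n ↔ (b : Site d) ∈ box d n) then 0
    else β / 2 * nnCoupling J (a : Site d) b with hD
  have hKD : (fun a b => K a b + D a b) =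
      fun a b : Λ => β / 2 * nnCoupling J (a : Site d) b := by
    ext a b
    simp only [hK, hD]
    split_ifs <;> simp
  have hK0 : ∀ a b, 0 ≤ K a b := fun a b => by
    simp only [hK]; split_ifs
    exacts [hc _ _, le_rfl]
  have hD0 : ∀ a b, 0 ≤ D a b := fun a b => by
    simp only [hD]; split_ifs
    exacts [le_rfl, hc _ _]
  have hmain := gibbsMean_add_le hρ hq hK0 hD0 ⟨0, h.1⟩ ⟨z, h.2⟩
  rw [hKD, gibbsMean_eq_zero_of_decoupled hρ (P := fun a : Λ => (a : Site d) ∈ box d n)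
    (fun a b ha hb => ⟨if_neg fun hh => hb (hh.1 ha), if_neg fun hh => hb (hh.2 ha)⟩)
    (mem_box.2 fun k => by simp)
    (fun hzb => absurd (mem_box.1 hzb i) (not_le.2 hz)), zero_add] at hmain
  refine hmain.trans ?_
  have hG : ∀ {a b : Site d} (ha : a ∈ Λ) (hb : b ∈ Λ), gibbsMean (ρ : Measure ℝ)
      (fun a b : Λ => β / 2 * nnCoupling J (a : Site d) b) (fun τ => τ ⟨a, ha⟩ * τ ⟨b, hb⟩) =
        twoPointIn J ρ β Λ a b := fun ha hb => (twoPointIn_eq ha hb).symm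
  have hin : ∀ {a : Site d}, (∃ k, (n : ℤ) ≤ |a k|) → twoPointIn J ρ β Λ 0 a ≤ s :=
    fun ⟨k, hk⟩ => (twoPointIn_zero_le hρ hJ hβ Λ _).trans (twoPoint_le_axisPoint hρ hJ hβ hk)
  have hout : ∀ {a : Site d}, (∀ k, |a k| ≤ n + 1) → twoPointIn J ρ β Λ z a ≤ A :=
    fun {a} ha => (twoPointIn_le hρ hJ hβ Λ z a).trans <| hA _ <| by
      have h1 := abs_sub_abs_le_abs_sub (z i) (a i)
      rw [abs_sub_comm] at h1
      have h2 := ha i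
      simp only [Pi.sub_apply]
      omega
  have hnn := twoPointIn_nonneg (d := d) hρ hJ hβ Λ
  have hcross : ∀ a b : Λ, D a b ≠ 0 →
      ((a : Site d) ∈ boxBoundary d n ∨ (b : Site d) ∈ boxBoundary d n) ∧
      (∃ k, (n : ℤ) ≤ |(a : Site d) k|) ∧ (∃ k, (n : ℤ) ≤ |(b : Site d) k|) ∧
      (∀ k, |(a : Site d) k| ≤ n + 1) ∧ ∀ k, |(b : Site d) k| ≤ n + 1 := by
    intro a b hab
    simp only [hD, nnCoupling] at hab
    split_ifs at hab with h1 h2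
    · exact absurd rfl hab
    · by_cases ha : (a : Site d) ∈ box d n
      · obtain ⟨e1, ⟨k, e2, e3⟩, e4, e5⟩ := mem_boxBoundary_of_adj ha (fun hb => h1 (by tauto)) h2
        exact ⟨Or.inl e1, ⟨k, e2⟩, ⟨k, e3⟩, e4, e5⟩
      · rw [Finset.sum_congr rfl fun k _ => abs_sub_comm ((a : Site d) k) ((b : Site d) k)] at h2
        obtain ⟨e1, ⟨k, e2, e3⟩, e4, e5⟩ :=
          mem_boxBoundary_of_adj (not_not.1 fun hb => h1 (by tauto)) ha h2
        exact ⟨Or.inr e1, ⟨k, e3⟩, ⟨k, e2⟩, e5, e4⟩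
    · exact absurd (mul_zero _) hab
  have hbd : ∑ x : Λ, ∑ y : Λ, (if (x : Site d) ∈ boxBoundary d n then
      β / 2 * nnCoupling J (x : Site d) y else 0) ≤ (boxBoundary d n).card * (β / 2 * T) := by
    have e1 : ∀ x : Λ, ∑ y : Λ, (if (x : Site d) ∈ boxBoundary d n then
        β / 2 * nnCoupling J (x : Site d) y else 0) ≤
        if (x : Site d) ∈ boxBoundary d n then β / 2 * T else 0 := by
      intro x
      split_ifs
      · rw [← Finset.mul_sum, Finset.sum_coe_sort Λ fun y => nnCoupling J (x : Site d) y]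
        exact mul_le_mul_of_nonneg_left (sum_nnCoupling_le hJ Λ x) (by positivity)
      · simp
    refine (Finset.sum_le_sum fun x _ => e1 x).trans ?_
    rw [Finset.sum_coe_sort Λ fun x => if x ∈ boxBoundary d n then β / 2 * T else 0,
      ← Finset.sum_filter, Finset.sum_const, nsmul_eq_mul]
    gcongr
    exact fun x hx => (Finset.mem_filter.1 hx).2
  -- Every crossing edge has an endpoint in the inner boundary; it occurs in two orientations, each
  -- with weight β/2.
  have hDsum : ∑ x, ∑ y, D x y ≤ (boxBoundary d n).card * (β * T) := by
    have e1 : ∀ x y : Λ, D x y ≤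
        (if (x : Site d) ∈ boxBoundary d n then β / 2 * nnCoupling J (x : Site d) y else 0) +
        (if (y : Site d) ∈ boxBoundary d n then β / 2 * nnCoupling J (y : Site d) x else 0) := by
      intro x y
      have h1 : 0 ≤ (if (x : Site d) ∈ boxBoundary d n then
          β / 2 * nnCoupling J (x : Site d) y else 0) := by
        split_ifs
        exacts [hc _ _, le_rfl]
      have h2 : 0 ≤ (if (y : Site d) ∈ boxBoundary d n then
          β / 2 * nnCoupling J (y : Site d) x else 0) := by
        split_ifs
        exacts [hc _ _, le_rfl]
      by_cases hxy : D x y = 0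
      · rw [hxy]; exact add_nonneg h1 h2
      · have hle : D x y ≤ β / 2 * nnCoupling J (x : Site d) y := by
          simp only [hD]; split_ifs
          exacts [hc _ _, le_rfl]
        rcases (hcross x y hxy).1 with hh | hh
        · rw [if_pos hh]; linarith
        · rw [if_pos hh, nnCoupling_comm (y : Site d)]; linarith
    have e2 := Finset.sum_le_sum fun x (_ : x ∈ Finset.univ) =>
      Finset.sum_le_sum fun y (_ : y ∈ Finset.univ) => e1 x y
    simp only [Finset.sum_add_distrib] at e2
    have e3 : ∑ x : Λ, ∑ y : Λ, (if (y : Site d) ∈ boxBoundary d n then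
        β / 2 * nnCoupling J (y : Site d) x else 0) =
        ∑ y : Λ, ∑ x : Λ, (if (y : Site d) ∈ boxBoundary d n then
        β / 2 * nnCoupling J (y : Site d) x else 0) := Finset.sum_comm
    rw [e3] at e2
    linarith
  -- Both endpoints have sup norm at least n, giving a factor s, and at most n + 1, giving a factor
  -- A for the correlation with z. The factor 2 accounts for the two products.
  have hterm : ∀ a b : Λ, D a b * (gibbsMean (ρ : Measure ℝ)
      (fun a b : Λ => β / 2 * nnCoupling J (a : Site d) b) (fun τ => τ ⟨0, h.1⟩ * τ a) *
      gibbsMean (ρ : Measure ℝ)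
      (fun a b : Λ => β / 2 * nnCoupling J (a : Site d) b) (fun τ => τ ⟨z, h.2⟩ * τ b) +
      gibbsMean (ρ : Measure ℝ)
      (fun a b : Λ => β / 2 * nnCoupling J (a : Site d) b) (fun τ => τ ⟨0, h.1⟩ * τ b) *
      gibbsMean (ρ : Measure ℝ)
      (fun a b : Λ => β / 2 * nnCoupling J (a : Site d) b) (fun τ => τ ⟨z, h.2⟩ * τ a)) ≤
        D a b * (2 * s * A) := by
    intro a b
    by_cases hab : D a b = 0
    · simp [hab]
    obtain ⟨-, e1, e2, e3, e4⟩ := hcross a b hab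
    have f1 := mul_le_mul (hin e1) (hout e4) (hnn z b) hs0
    have f2 := mul_le_mul (hin e2) (hout e3) (hnn z a) hs0
    rw [← hG h.1 a.2, ← hG h.2 b.2] at f1
    rw [← hG h.1 b.2, ← hG h.2 a.2] at f2
    exact mul_le_mul_of_nonneg_left (by linarith) (hD0 a b)
  refine (Finset.sum_le_sum fun a _ => Finset.sum_le_sum fun b _ => hterm a b).trans ?_
  simp only [← Finset.sum_mul]
  calc _ ≤ (boxBoundary d n).card * (β * T) * (2 * s * A) := by gcongr
    _ = _ := by ring

/-- Each use of the box inequality gains one factor and costs at most n + 1 in the i-th coordinate.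
-/
theorem twoPoint_le_mul_pow (hρ : EvenSubgaussian (ρ : Measure ℝ))
    (hq : QuadPositive (ρ : Measure ℝ)) (hJ : 0 ≤ J) (hβ : 0 ≤ β) {B : ℝ}
    (hB : ∀ x : Site d, twoPoint J ρ β x ≤ B) (n j : ℕ) (i : Fin d) (z : Site d)
    (hz : (j * (n + 1) : ℤ) ≤ |z i|) :
    twoPoint J ρ β z ≤ B * (2 * β * totalCoupling d J * (boxBoundary d n).card *
      twoPoint J ρ β (axisPoint d n)) ^ j := by
  induction j generalizing z with
  | zero => simpa using hB z
  | succ j ih =>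
    push_cast at hz
    have h0 : (0 : ℤ) ≤ j * (n + 1) := by positivity
    refine (twoPoint_le_mul_of_box hρ hq hJ hβ (n := n) (i := i) (by linarith)
      fun w hw => ih w (by linarith)).trans (le_of_eq ?_)
    ring

/-- The gap between M and r absorbs the prefactor B and the rounding in the exponent: eventually B
M^j ≤ r^{j+1} with j = ⌊k/(n+1)⌋, and j + 1 ≥ k/(n+1). -/
theorem correlationLength_le {r M B : ℝ} {n : ℕ} (hM : 0 ≤ M) (hMr : M < r) (hr : r < 1)
    (h : ∀ k : ℕ, twoPoint J ρ β (axisPoint d k) ≤ B * M ^ (k / (n + 1))) :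
    correlationLength d J ρ β ≤ ENNReal.ofReal ((n + 1) / -Real.log r) := by
  have hr0 : 0 < r := hM.trans_lt hMr
  set l := -Real.log r with hl
  have hl0 : 0 < l := by rw [hl]; linarith [Real.log_neg hr0 hr]
  have hn : (0 : ℝ) < n + 1 := by positivity
  have hlim : Tendsto (fun j : ℕ => B * (M / r) ^ j) atTop (𝓝 0) := by
    simpa using (tendsto_pow_atTop_nhds_zero_of_lt_one (by positivity)
      ((div_lt_one hr0).2 hMr)).const_mul B
  have hdiv : Tendsto (fun k : ℕ => k / (n + 1)) atTop atTop :=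
    Nat.tendsto_div_const_atTop n.succ_ne_zero
  refine limsup_le_of_le (by isBoundedDefault) ?_
  filter_upwards [hdiv.eventually (hlim.eventually (gt_mem_nhds hr0)), eventually_ge_atTop 1]
    with k hk hk1
  set j := k / (n + 1) with hj
  have hS : twoPoint J ρ β (axisPoint d k) ≤ Real.exp (-(k * l / (n + 1))) := by
    refine (h k).trans ?_
    have e1 : B * M ^ j ≤ r * r ^ j := by
      rw [div_pow, mul_div_assoc', div_lt_iff₀ (by positivity)] at hk
      exact hk.le
    refine e1.trans ?_
    rw [← pow_succ', ← Real.exp_log (pow_pos hr0 (j + 1)), Real.log_pow, Real.exp_le_exp]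
    have e2 : (k : ℝ) / (n + 1) ≤ j + 1 := by
      rw [div_le_iff₀ hn]
      have := Nat.lt_mul_div_succ k n.succ_pos
      have h' : k ≤ (j + 1) * (n + 1) := by rw [hj, mul_comm]; exact this.le
      exact_mod_cast h'
    have e3 := mul_le_mul_of_nonneg_right e2 hl0.le
    rw [div_mul_eq_mul_div] at e3
    push_cast
    rw [show Real.log r = -l by rw [hl, neg_neg]]
    linarith
  have hk0 : (0 : ℝ) < k := by exact_mod_cast hk1
  have hlog : ENNReal.ofReal (k * l / (n + 1)) ≤
      (-ENNReal.log (ENNReal.ofReal (twoPoint J ρ β (axisPoint d k)))).toENNReal := by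
    have e1 := ENNReal.log_le_log (ENNReal.ofReal_le_ofReal hS)
    rw [ENNReal.log_ofReal_of_pos (Real.exp_pos _), Real.log_exp] at e1
    have e2 := EReal.toENNReal_le_toENNReal (EReal.neg_le_neg_iff.2 e1)
    rw [← EReal.coe_neg, neg_neg, EReal.toENNReal_of_ne_top (EReal.coe_ne_top _)] at e2
    simpa using e2
  calc _ ≤ (k : ℝ≥0∞) / ENNReal.ofReal (k * l / (n + 1)) := ENNReal.div_le_div_left hlog _
    _ = ENNReal.ofReal (k / (k * l / (n + 1))) := by
      rw [ENNReal.ofReal_div_of_pos (x := (k : ℝ)) (y := k * l / (n + 1)) (by positivity),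
        ENNReal.ofReal_natCast]
    _ = _ := by congr 1; field_simp

theorem expNegDiv_le_one (a : ℝ) (ξ : ℝ≥0∞) : expNegDiv a ξ ≤ 1 := by
  unfold expNegDiv
  refine ENNReal.toReal_le_of_le_ofReal zero_le_one ?_
  rw [ENNReal.ofReal_one, ← EReal.exp_zero]
  refine EReal.exp_monotone ?_
  rw [EReal.neg_le, neg_zero]
  exact EReal.coe_ennreal_nonneg _

theorem expNegDiv_le {a r : ℝ} {ξ : ℝ≥0∞} (ha : 0 < a) (hr0 : 0 < r) (hr1 : r < 1)
    (hξ : ξ ≤ ENNReal.ofReal (a / -Real.log r)) : expNegDiv a ξ ≤ r := by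
  have hl0 : 0 < -Real.log r := by linarith [Real.log_neg hr0 hr1]
  have h1 : ENNReal.ofReal (-Real.log r) ≤ ENNReal.ofReal a / ξ := by
    refine le_trans (le_of_eq ?_) (ENNReal.div_le_div_left hξ _)
    rw [← ENNReal.ofReal_div_of_pos (by positivity)]
    congr 1
    field_simp
  unfold expNegDiv
  refine ENNReal.toReal_le_of_le_ofReal hr0.le ?_
  have h2 := EReal.exp_monotone (EReal.neg_le_neg_iff.2 (EReal.coe_ennreal_le_coe_ennreal_iff.2 h1))
  refine h2.trans (le_of_eq ?_)
  rw [EReal.coe_ennreal_ofReal, max_eq_left hl0.le, ← EReal.coe_neg, neg_neg, EReal.exp_coe,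
    Real.exp_log hr0]

/-- The right-hand side M is the decay factor of `twoPoint_le_mul_pow`. For r > M the bound by r is
trivial when r ≥ 1, and otherwise decay at rate M forces ξ ≤ (n+1)/(-log r); then r decreases to M.
-/
theorem expNegDiv_le_axisPoint (hd : 1 ≤ d) (hρ : EvenSubgaussian (ρ : Measure ℝ))
    (hq : QuadPositive (ρ : Measure ℝ)) (hJ : 0 ≤ J) (hβ : 0 ≤ β) (n : ℕ) :
    expNegDiv (n + 1) (correlationLength d J ρ β) ≤
      2 * β * totalCoupling d J * (boxBoundary d n).card * twoPoint J ρ β (axisPoint d n) := by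
  set M := 2 * β * totalCoupling d J * (boxBoundary d n).card *
    twoPoint J ρ β (axisPoint d n) with hM
  have hM0 : 0 ≤ M := by
    have h1 := totalCoupling_nonneg (d := d) hJ
    have h2 := twoPoint_nonneg hρ hJ hβ (axisPoint d n)
    positivity
  obtain ⟨B, hB⟩ := exists_twoPoint_le (d := d) hρ hJ hβ
  refine le_of_forall_gt_imp_ge_of_dense fun r hr => ?_
  rcases le_or_gt 1 r with h1 | h1
  · exact (expNegDiv_le_one _ _).trans h1
  refine expNegDiv_le (by positivity) (hM0.trans_lt hr) h1
    (correlationLength_le (B := B) hM0 hr h1 fun k => ?_)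
  refine twoPoint_le_mul_pow hρ hq hJ hβ hB n _ ⟨0, hd⟩ _ ?_
  rw [axisPoint_eq_single ⟨0, hd⟩ rfl]
  simp only [Pi.single_eq_same, Nat.abs_cast]
  exact_mod_cast Nat.div_mul_le_self k (n + 1)

/-- The scale is n = d‖x‖. The boundary of that box has at most 2d(2n+1)^{d-1} ≤ 2d(3d‖x‖)^{d-1}
sites, and with the factor 2 in the decay constant this gives 4d(3d)^{d-1}. -/
theorem twoPoint_ge (hd : 1 ≤ d) (hρ : EvenSubgaussian (ρ : Measure ℝ))
    (hq : QuadPositive (ρ : Measure ℝ)) (hJ : 0 ≤ J) (hβ : 0 ≤ β) {x : Site d}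
    (hx : x ≠ 0 ∨ d = 1) :
    1 / (4 * d * (3 * d) ^ (d - 1)) / (β * totalCoupling d J * ‖x‖ ^ (d - 1)) *
      expNegDiv (d * ‖x‖ + 1) (correlationLength d J ρ β) ≤ twoPoint J ρ β x := by
  set N : ℕ := Finset.univ.sup fun i => (x i).natAbs with hN
  have hxN : ∀ i, |x i| ≤ N := fun i => by
    rw [Int.abs_eq_natAbs]
    exact_mod_cast Finset.le_sup (f := fun i => (x i).natAbs) (Finset.mem_univ i)
  have hnorm : ‖x‖ = N := by
    refine le_antisymm ((pi_norm_le_iff_of_nonneg N.cast_nonneg).2 fun i => ?_) ?_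
    · rw [Int.norm_eq_abs]
      exact_mod_cast hxN i
    · have : Nonempty (Fin d) := ⟨⟨0, hd⟩⟩
      obtain ⟨i, -, hi⟩ := Finset.exists_mem_eq_sup Finset.univ Finset.univ_nonempty
        fun i => (x i).natAbs
      rw [hN, hi, Nat.cast_natAbs, Int.cast_abs, ← Int.norm_eq_abs]
      exact norm_le_pi_norm x i
  have hs0 := twoPoint_nonneg hρ hJ hβ x
  have hT0 : 0 ≤ totalCoupling d J := totalCoupling_nonneg hJ
  rw [hnorm]
  set E := expNegDiv (d * N + 1) (correlationLength d J ρ β)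
  have hdpos : (0 : ℝ) < d := by exact_mod_cast hd
  -- For x ≠ 0 this uses 1 ≤ dN; for d = 1 both exponents are zero, which admits x = 0.
  have hpow : (2 * ((d * N : ℕ) : ℝ) + 1) ^ (d - 1) ≤ (3 * d) ^ (d - 1) * (N : ℝ) ^ (d - 1) := by
    rw [← mul_pow]
    rcases hx with hx | rfl
    · have hN1 : 1 ≤ N := by
        have : (0 : ℝ) < N := hnorm ▸ norm_pos_iff.2 hx
        exact_mod_cast this
      have : 1 ≤ d * N := Nat.mul_pos hd hN1
      have h' : (1 : ℝ) ≤ d * N := by exact_mod_cast this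
      push_cast
      gcongr
      linarith
    · simp
  have hE : E ≤ β * totalCoupling d J * (N : ℝ) ^ (d - 1) *
      (4 * d * (3 * d) ^ (d - 1)) * twoPoint J ρ β x := by
    have h1 := expNegDiv_le_axisPoint (J := J) hd hρ hq hJ hβ (d * N)
    have h2 := axisPoint_le_twoPoint (J := J) hd hρ hJ hβ hxN
    have h3 : ((boxBoundary d (d * N)).card : ℝ) ≤
        d * (2 * (2 * ((d * N : ℕ) : ℝ) + 1) ^ (d - 1)) := by
      exact_mod_cast card_boxBoundary_le d (d * N)
    rw [Nat.cast_mul] at h1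
    refine h1.trans ?_
    calc _ ≤ 2 * β * totalCoupling d J * (d * (2 * ((3 * d) ^ (d - 1) * (N : ℝ) ^ (d - 1)))) *
          twoPoint J ρ β x := by
          have h4 := h3.trans (mul_le_mul_of_nonneg_left
            (mul_le_mul_of_nonneg_left hpow zero_le_two) hdpos.le)
          have h5 := twoPoint_nonneg hρ hJ hβ (axisPoint d (d * N))
          gcongr
      _ = _ := by ring
  have hC : (0 : ℝ) < 4 * d * (3 * d) ^ (d - 1) := by positivity
  -- If the denominator vanishes, division by zero makes the left-hand side 0.
  rcases (by positivity : 0 ≤ β * totalCoupling d J * (N : ℝ) ^ (d - 1)).eq_or_lt with h0 | h0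
  · rw [← h0]
    simpa using hs0
  · rw [div_div, one_div, inv_mul_le_iff₀ (by positivity)]
    linarith

end Decay

end GSModel

theorem mainTheorem10 (d : ℕ) (hd : 1 ≤ d) :
    ∃ c : ℝ, 0 < c ∧
      ∀ (J : ℝ) (ρ : ProbabilityMeasure ℝ) (β : ℝ),
        0 < J → GSModel.IsGriffithsSimon ρ →
        0 < β → ENNReal.ofReal β ≤ GSModel.criticalBeta d J ρ →
          (∀ x : GSModel.Site d,
            Tendsto (fun Λ : Finset (GSModel.Site d) => GSModel.twoPointIn J ρ β Λ 0 x) atTop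
              (𝓝 (GSModel.twoPoint J ρ β x))) ∧
          ∀ x : GSModel.Site d, (x ≠ 0 ∨ d = 1) →
            c / (β * GSModel.totalCoupling d J * ‖x‖ ^ (d - 1)) *
                GSModel.expNegDiv (d * ‖x‖ + 1) (GSModel.correlationLength d J ρ β) ≤
              GSModel.twoPoint J ρ β x := by
  have hdpos : (0 : ℝ) < d := by exact_mod_cast hd
  refine ⟨1 / (4 * d * (3 * d) ^ (d - 1)), by positivity, fun J ρ β hJ hρ hβ _ => ?_⟩
  exact ⟨fun x => GSModel.tendsto_twoPoint hρ.evenSubgaussian hJ.le hβ.le x, fun x hx =>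
    GSModel.twoPoint_ge hd hρ.evenSubgaussian hρ.quadPositive hJ.le hβ.le hx⟩
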